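/- Let $K\ge 0$, let $g$ be a probability density on $\mathbb R$ and let $r_{\rm stat}\in[0,1]$. Put $\kappa=Kr_{\rm stat}$ and consider the partially locked state $$f_{\rm stat}(\theta,\omega)=\begin{cases}\delta_{\arcsin(\omega/\kappa)}(\theta)\,g(\omega)&\text{if }|\omega|\le\kappa,\\[2pt] \dfrac{\sqrt{\omega^2-\kappa^2}}{2\pi|\omega-\kappa\sin\theta|}\,g(\omega)&\text{if }|\omega|>\kappa,\end{cases}$$ on $\mathbb T\times\mathbb R$, which is assumed to satisfy the self-consistency equation $r_{\rm stat}=\int_{\mathbb R}\int_{\mathbb T}e^{i\theta}f_{\rm stat}(\theta,\omega)\,d\theta\,d\omega$. Let $\hat f_\ell(\xi)=\int\!\int e^{-i\ell\theta-i\xi\omega}f_{\rm stat}(\theta,\omega)\,d\theta\,d\omega$ and $\hat g(\xi)=\int e^{-i\xi\omega}g(\omega)\,d\omega$. With $p_b(\xi)=(1+\xi)^b$ and weak derivatives $\partial_\xi$ on $(0,\infty)$, define in $[0,\infty]$ (the norms are $\infty$ if a weak derivative does not exist) $$\|u\|_{\phi,k}^2=\sum_{\ell\ge1}\int_0^\infty\big(|u_\ell|^2+|\partial_\xi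 u_\ell|^2\big)\,|\phi|^2\,\ell^{2k}\,d\xi,\qquad \|\hat g\|_\phi^2=\int_0^\infty\big(|\hat g|^2+|\partial_\xi\hat g|^2\big)|\phi|^2\,d\xi .$$ For $\ell\ge1$ let $$(r_r)_\ell=\tfrac{K\ell}{2}\big(\hat f_{\ell-1}-\hat f_{\ell+1}\big),\qquad (r_i)_\ell=\tfrac{K\ell i}{2}\big(\hat f_{\ell-1}+\hat f_{\ell+1}\big),\qquad (D\hat R\hat f)_\ell=i\ell\hat f_\ell .$$ Let $e^{tL_1}$ be the evolution, by weak solutions that are weakly continuous and locally bounded in time with values in the space of the norm $\|\cdot\|_{p_0,-1/2}$, of $(L_1u)_\ell=\ell\partial_\xi u_\ell+\frac{\kappa\ell}{2}(u_{\ell-1}-u_{\ell+1})$ on $\ell\ge1$, $\xi\ge0$, with $u_0\equiv0$. Let $$k_{Lc}(t)=-\begin{pmatrix}\operatorname{Re}(e^{tL_1}r_r)_1(0)&\operatorname{Re}(e^{tL_1}r_i)_1(0)\\ \operatorname{Im}(e^{tL_1}r_r)_1(0)&\operatorname{Im}(e^{tL_1}r_i)_1(0)\end{pmatrix}$$ and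 let $r_{Lc}$ be its locally integrable resolvent, $r_{Lc}+k_{Lc}\star r_{Lc}=r_{Lc}+r_{Lc}\star k_{Lc}=k_{Lc}$ on $(0,\infty)$, where $(A\star B)(t)=\int_0^tA(t-s)B(s)\,ds$. Whenever $r_{Lc}=\begin{pmatrix}0&0\\ c_r&c_i\end{pmatrix}+r_{Lcs}$ with constants $c_r,c_i\in\mathbb R$ and $r_{Lcs}\in L^1(\mathbb R^+)$, put $$\alpha(u)=\int_0^\infty\big(c_r\operatorname{Re}(e^{tL_1}u)_1(0)+c_i\operatorname{Im}(e^{tL_1}u)_1(0)\big)\,dt,\qquad r_\Theta=\frac{D\hat R\hat f}{\alpha(D\hat R\hat f)} .$$ **Proposition.** Let $b\ge0$, $k\in\{0,\frac12,1,\frac32,\dots\}$ and $\kappa\ge0$. There is a constant $C_{\rm stat}>0$, depending only on $k$, $b$ and $\kappa$, such that for all $K$, $r_{\rm stat}$ and $g$ as above with $Kr_{\rm stat}=\kappa$ $$\|\hat f\|_{p_b,k}\le C_{\rm stat}\,\|\hat g\|_{p_{b+k+1}},\qquad \|r_r\|_{p_b,k}\le K\,C_{\rm stat}\,\|\hat g\|_{p_{b+k+2}},\qquad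 \|r_i\|_{p_b,k}\le K\,C_{\rm stat}\,\|\hat g\|_{p_{b+k+2}},$$ and, if moreover $r_{\rm stat}>0$ and $\alpha$ is defined as above with $t\mapsto(e^{tL_1}D\hat R\hat f)_1(0)$ integrable on $(0,\infty)$, then $\alpha(D\hat R\hat f)\ne0$ and $$\|r_\Theta\|_{p_b,k}\le \frac{C_{\rm stat}}{r_{\rm stat}}\,\|\hat g\|_{p_{b+k+2}} .$$ In particular the bounds of $r_r,r_i,r_\Theta$ hold with a constant that depends only on $k$, $b$, $K$ and $r_{\rm stat}$. -/

import Mathlib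

open MeasureTheory Set
open scoped ENNReal

noncomputable section

namespace Kuramoto

/-! ### Weighted Sobolev norms on the half line -/

/-- Smooth real test functions with compact support in the open half line `(0, ∞)`. -/
def IsTest (φ : ℝ → ℝ) : Prop :=
  ContDiff ℝ ((⊤ : ℕ∞) : WithTop ℕ∞) φ ∧ HasCompactSupport φ ∧ tsupport φ ⊆ Ioi 0

/-- `w` is a weak derivative of `v` on `(0, ∞)`. -/
def IsWeakDeriv (v w : ℝ → ℂ) : Prop :=
  LocallyIntegrableOn v (Ioi 0) ∧ LocallyIntegrableOn w (Ioi 0) ∧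
    ∀ φ : ℝ → ℝ, IsTest φ →
      ∫ ξ in Ioi (0 : ℝ), v ξ * ((deriv φ ξ : ℝ) : ℂ)
        = -∫ ξ in Ioi (0 : ℝ), w ξ * ((φ ξ : ℝ) : ℂ)

/-- The weight `p_b(ξ) = (1 + ξ)^b`. -/
def p (b : ℝ) (ξ : ℝ) : ℝ := (1 + ξ) ^ b

/-- `∫₀^∞ (|v|² + |∂_ξ v|²) |φ|² dξ` with the weak derivative `∂_ξ v`. The weak derivative is unique
almost everywhere, so the infimum is over a single value; it is `∞` if there is no weak
derivative. -/
def sobolevSq (φ : ℝ → ℝ) (v : ℝ → ℂ) : ℝ≥0∞ :=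
  ⨅ (w : ℝ → ℂ) (_ : IsWeakDeriv v w),
    ∫⁻ ξ in Ioi (0 : ℝ), ENNReal.ofReal ((‖v ξ‖ ^ 2 + ‖w ξ‖ ^ 2) * φ ξ ^ 2)

/-- The norm `‖v‖_φ` of a function on the half line (used for the velocity profile). -/
def profileNorm (φ : ℝ → ℝ) (v : ℝ → ℂ) : ℝ≥0∞ :=
  sobolevSq φ v ^ (1 / 2 : ℝ)

/-- The norm `‖u‖_{φ,k}`, given by
`‖u‖²_{φ,k} = ∑_{ℓ ≥ 1} ∫₀^∞ (|u_ℓ|² + |∂_ξ u_ℓ|²) |φ|² ℓ^{2k} dξ`; only the modes `ℓ ≥ 1` and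
the frequencies `ξ > 0` enter. -/
def modeNorm (φ : ℝ → ℝ) (k : ℝ) (u : ℕ → ℝ → ℂ) : ℝ≥0∞ :=
  (∑' ℓ : ℕ, ENNReal.ofReal (((ℓ + 1 : ℕ) : ℝ) ^ (2 * k)) * sobolevSq φ (u (ℓ + 1))) ^ (1 / 2 : ℝ)

/-! ### The partially locked stationary state, with `κ = K r_stat` -/

/-- The conditional distribution of the phase `θ ∈ (-π, π]` given the velocity `ω`:
`f_stat(θ, ω) dθ = phaseMeasure κ ω (dθ) g(ω)`. -/
def phaseMeasure (κ ω : ℝ) : Measure ℝ :=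
  open Classical in
  if |ω| ≤ κ then Measure.dirac (Real.arcsin (ω / κ))
  else (volume.restrict (Ioc (-Real.pi) Real.pi)).withDensity
    fun θ => ENNReal.ofReal
      (Real.sqrt (ω ^ 2 - κ ^ 2) / (2 * Real.pi * |ω - κ * Real.sin θ|))

/-- `ĝ(ξ) = ∫ e^{-iξω} g(ω) dω`. -/
def gHat (g : ℝ → ℝ) (ξ : ℝ) : ℂ :=
  ∫ ω : ℝ, Complex.exp (-Complex.I * ξ * ω) * (g ω : ℂ)

/-- `(f̂_stat)_ℓ(ξ) = ∫ ∫ e^{-iℓθ - iξω} f_stat(θ, ω) dθ dω`, for `ℓ ≥ 0`. -/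
def fHat (κ : ℝ) (g : ℝ → ℝ) (ℓ : ℕ) (ξ : ℝ) : ℂ :=
  ∫ ω : ℝ, (∫ θ, Complex.exp (-Complex.I * ℓ * θ - Complex.I * ξ * ω) ∂(phaseMeasure κ ω))
    * (g ω : ℂ)

/-- `g` is a probability density, and the state `f_stat` with velocity distribution `g` and
coupling `K` satisfies the self-consistency equation with order parameter `r ∈ [0, 1]`. -/
structure IsStationaryState (K r : ℝ) (g : ℝ → ℝ) : Prop where
  K_nonneg : 0 ≤ K
  r_nonneg : 0 ≤ r
  r_le_one : r ≤ 1
  g_nonneg : ∀ ω, 0 ≤ g ω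
  g_integrable : Integrable g
  g_mass : ∫ ω : ℝ, g ω = 1
  self_consistent :
    (r : ℂ) = ∫ ω : ℝ, (∫ θ, Complex.exp (Complex.I * (θ : ℂ)) ∂(phaseMeasure (K * r) ω)) * (g ω : ℂ)

/-- `(r_r)_ℓ = (Kℓ/2) ((f̂_stat)_{ℓ-1} - (f̂_stat)_{ℓ+1})`. -/
def rR (K r : ℝ) (g : ℝ → ℝ) (ℓ : ℕ) (ξ : ℝ) : ℂ :=
  (K : ℂ) * ℓ / 2 * (fHat (K * r) g (ℓ - 1) ξ - fHat (K * r) g (ℓ + 1) ξ)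

/-- `(r_i)_ℓ = (Kℓi/2) ((f̂_stat)_{ℓ-1} + (f̂_stat)_{ℓ+1})`. -/
def rI (K r : ℝ) (g : ℝ → ℝ) (ℓ : ℕ) (ξ : ℝ) : ℂ :=
  (K : ℂ) * ℓ * Complex.I / 2 * (fHat (K * r) g (ℓ - 1) ξ + fHat (K * r) g (ℓ + 1) ξ)

/-- The rotation mode `(D R̂ f̂_stat)_ℓ = i ℓ (f̂_stat)_ℓ`. -/
def rotMode (κ : ℝ) (g : ℝ → ℝ) (ℓ : ℕ) (ξ : ℝ) : ℂ :=
  Complex.I * ℓ * fHat κ g ℓ ξ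

/-! ### The evolution `e^{tL₁}` -/

/-- `u_{ℓ-1}` with the convention `u_0 = 0`. -/
def lower (u : ℕ → ℝ → ℂ) (ℓ : ℕ) (ξ : ℝ) : ℂ :=
  if ℓ ≤ 1 then 0 else u (ℓ - 1) ξ

/-- `w(t) = e^{tL₁} v`: the weak solution of `∂_t w = L₁ w`, `w(0) = v`, where
`(L₁ u)_ℓ = ℓ ∂_ξ u_ℓ + (κℓ/2) (u_{ℓ-1} - u_{ℓ+1})` on `ℓ ≥ 1`, `ξ ≥ 0` with `u_0 = 0`.
It is locally bounded in time with values in the space `X` of the norm `‖·‖_{p_0,-1/2}`, which is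
the largest of the spaces of the norms `‖·‖_{p_b,-1/2}`, `b ≥ 0`. For such `w`, the
joint continuity of all the modes is the same as the weak continuity of `t ↦ w(t) ∈ X`. -/
structure IsEvolution (κ : ℝ) (v : ℕ → ℝ → ℂ) (w : ℝ → ℕ → ℝ → ℂ) : Prop where
  continuous_modes : ∀ ℓ, 1 ≤ ℓ →
    ContinuousOn (fun q : ℝ × ℝ => w q.1 ℓ q.2) (Ici 0 ×ˢ Ici 0)
  bounded : ∀ T : ℝ, ∃ M : ℝ, ∀ t ∈ Icc 0 T, modeNorm (p 0) (-1 / 2) (w t) ≤ ENNReal.ofReal M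
  initial : ∀ ℓ, 1 ≤ ℓ → ∀ ξ, 0 ≤ ξ → w 0 ℓ ξ = v ℓ ξ
  weak_eq : ∀ ℓ, 1 ≤ ℓ → ∀ φ : ℝ → ℝ, IsTest φ → ∀ t, 0 ≤ t →
    ∫ ξ in Ioi (0 : ℝ), w t ℓ ξ * ((φ ξ : ℝ) : ℂ)
      = (∫ ξ in Ioi (0 : ℝ), v ℓ ξ * ((φ ξ : ℝ) : ℂ))
        + ∫ s in (0 : ℝ)..t, ∫ ξ in Ioi (0 : ℝ),
            (-(ℓ : ℂ) * w s ℓ ξ * ((deriv φ ξ : ℝ) : ℂ)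
              + (κ : ℂ) * ℓ / 2 * (lower (w s) ℓ ξ - w s (ℓ + 1) ξ) * ((φ ξ : ℝ) : ℂ))

/-! ### The linearised Volterra equation and the functional `α` -/

/-- The convolution kernel `k_{Lc}(t)`, where `wr t = e^{tL₁} r_r` and `wi t = e^{tL₁} r_i`. -/
def kLc (wr wi : ℝ → ℕ → ℝ → ℂ) (t : ℝ) : Matrix (Fin 2) (Fin 2) ℝ :=
  -!![(wr t 1 0).re, (wi t 1 0).re; (wr t 1 0).im, (wi t 1 0).im]

/-- Entries of `(A ⋆ B)(t) = ∫₀^t A(t-s) B(s) ds`. -/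
def conv (A B : ℝ → Matrix (Fin 2) (Fin 2) ℝ) (t : ℝ) : Matrix (Fin 2) (Fin 2) ℝ :=
  fun i j => ∫ s in (0 : ℝ)..t, (A (t - s) * B s) i j

/-- `R` is the locally integrable resolvent of the kernel `A`:
`R + A ⋆ R = R + R ⋆ A = A` almost everywhere on `(0, ∞)`. -/
def IsResolvent (A R : ℝ → Matrix (Fin 2) (Fin 2) ℝ) : Prop :=
  (∀ i j, LocallyIntegrableOn (fun t => R t i j) (Ici 0)) ∧
    ∀ᵐ t ∂(volume.restrict (Ioi (0 : ℝ))), R t + conv A R t = A t ∧ R t + conv R A t = A t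

/-- `K_Θ = (0, 1)ᵀ ⊗ (c_r, c_i)`. -/
def KTheta (cr ci : ℝ) : Matrix (Fin 2) (Fin 2) ℝ := !![0, 0; cr, ci]

/-- `c_r, c_i` are the coefficients `c_{Θ,r}, c_{Θ,i}` of the stationary state: the resolvent of
`k_{Lc}` is `K_Θ + r_{Lcs}` with `K_Θ = (0, 1)ᵀ ⊗ (c_r, c_i)` and `r_{Lcs} ∈ L¹(ℝ⁺)`. -/
def IsRotationCoeff (K r : ℝ) (g : ℝ → ℝ) (cr ci : ℝ) : Prop :=
  ∃ wr wi : ℝ → ℕ → ℝ → ℂ, IsEvolution (K * r) (rR K r g) wr ∧ IsEvolution (K * r) (rI K r g) wi ∧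
    ∃ R : ℝ → Matrix (Fin 2) (Fin 2) ℝ, IsResolvent (kLc wr wi) R ∧
      ∀ i j, IntegrableOn (fun t => R t i j - KTheta cr ci i j) (Ioi 0)

/-- `a = α(u) = ∫₀^∞ (c_r Re (e^{tL₁} u)_1(0) + c_i Im (e^{tL₁} u)_1(0)) dt`, an absolutely
convergent integral. -/
def IsAlpha (κ cr ci : ℝ) (u : ℕ → ℝ → ℂ) (a : ℝ) : Prop :=
  ∃ w : ℝ → ℕ → ℝ → ℂ, IsEvolution κ u w ∧ IntegrableOn (fun t => w t 1 0) (Ioi 0) ∧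
    a = ∫ t in Ioi (0 : ℝ), (cr * (w t 1 0).re + ci * (w t 1 0).im)

/-- `r_Θ = D R̂ f̂_stat / a`, where `a = α(D R̂ f̂_stat)`. -/
def rTheta (κ : ℝ) (g : ℝ → ℝ) (a : ℝ) (ℓ : ℕ) (ξ : ℝ) : ℂ :=
  rotMode κ g ℓ ξ / (a : ℂ)

end Kuramoto

end

/-!
Given `ω`, the phase moments are the powers `β(ω)^ℓ` of a root of `κ β² + 2 i ω β = κ` in the
closed unit disc: this is clear for locked phases, and the density of the drifting ones is a
Poisson kernel. Hence `f̂_ℓ` is the Fourier transform of `β^ℓ g`, and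
`∂_ξ f̂_ℓ = (κ/2) (f̂_{ℓ+1} - f̂_{ℓ-1})`. Replacing `i ω` by `ε + i ω` moves the root into the
interior of the disc, so that all sums over `ℓ` converge. The derivative of the energy
`∑ ℓⁿ |f̂_ℓ|²` then telescopes up to `f̂₀ f̂₁` and the energy of order `n - 1`; integrating from
`∞` and using Hardy's inequality, each power of `ℓ` costs one factor `1 + ξ` in the weight,
uniformly in `ε`, and `ε → 0` by Fatou's lemma.

For `r_Θ`, stationarity says `L₁ (D R̂ f̂) = -r r_i`. By Duhamel's formula, which rests on the
uniqueness of weak solutions, `(e^{tL₁} D R̂ f̂)_1(0) = i r - r ∫₀ᵗ (e^{sL₁} r_i)_1(0) ds`. Up to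
sign the integral is that of a column of `k_{Lc}`, so the resolvent equation evaluates
`α(D R̂ f̂) = -r`.
-/

noncomputable section

namespace Kuramoto

open Filter Topology FourierTransform

/-! ### The moments of the conditional phase distribution -/

/-- The density of the drifting phases, `|ω| > κ`, in the conditional phase distribution. -/
def driftDensity (κ ω θ : ℝ) : ℝ :=
  Real.sqrt (ω ^ 2 - κ ^ 2) / (2 * Real.pi * |ω - κ * Real.sin θ|)

/-- The phase moment `∫ e^{-iℓθ} f_stat(dθ | ω)`, so that `(f̂_stat)_ℓ` is the Fourier transform of
`moment κ ℓ * g`. -/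
def moment (κ : ℝ) (ℓ : ℕ) (ω : ℝ) : ℂ :=
  ∫ θ, Complex.exp (-Complex.I * ℓ * θ) ∂(phaseMeasure κ ω)

section Drift

variable {κ ω : ℝ}

lemma driftDensity_nonneg (κ ω θ : ℝ) : 0 ≤ driftDensity κ ω θ := by
  unfold driftDensity; positivity

lemma abs_mul_sin_lt (hκ : 0 ≤ κ) (h : κ < |ω|) (θ : ℝ) : |κ * Real.sin θ| < |ω| := by
  rw [abs_mul, abs_of_nonneg hκ]
  exact (mul_le_of_le_one_right hκ (Real.abs_sin_le_one θ)).trans_lt h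

lemma sub_mul_sin_ne_zero (hκ : 0 ≤ κ) (h : κ < |ω|) (θ : ℝ) : ω - κ * Real.sin θ ≠ 0 := fun h0 =>
  (abs_mul_sin_lt hκ h θ).ne (by rw [← sub_eq_zero.mp h0])

lemma continuous_driftDensity (hκ : 0 ≤ κ) (h : κ < |ω|) : Continuous (driftDensity κ ω) := by
  unfold driftDensity
  refine Continuous.div (by fun_prop) (by fun_prop) fun θ => ?_
  have := abs_pos.mpr (sub_mul_sin_ne_zero hκ h θ)
  positivity

lemma poissonKernel_eq_of_quadratic {d : ℝ} (hd : d ≠ 0) (hq : d ^ 2 + κ ^ 2 = 2 * ω * d)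
    (θ : ℝ) :
    poissonKernel 0 (Complex.I * ((κ / d : ℝ) : ℂ)) (circleMap 0 1 θ)
      = (d - ω) / (ω - κ * Real.sin θ) := by
  have hpole : ‖Complex.I * ((κ / d : ℝ) : ℂ)‖ ^ 2 = κ ^ 2 / d ^ 2 := by
    rw [norm_mul, Complex.norm_I, one_mul, Complex.norm_real, Real.norm_eq_abs, sq_abs, div_pow]
  have hdist : ‖circleMap 0 1 θ - Complex.I * ((κ / d : ℝ) : ℂ)‖ ^ 2
      = 1 + κ ^ 2 / d ^ 2 - 2 * (κ / d) * Real.sin θ := by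
    rw [← Complex.normSq_eq_norm_sq, Complex.normSq_apply, circleMap_zero, Complex.exp_mul_I,
      ← Complex.ofReal_cos, ← Complex.ofReal_sin]
    simp only [Complex.sub_re, Complex.sub_im, Complex.add_re, Complex.add_im, Complex.mul_re,
      Complex.mul_im, Complex.ofReal_re, Complex.ofReal_im, Complex.I_re, Complex.I_im,
      Complex.one_re, Complex.one_im, Complex.ofReal_one]
    linear_combination Real.sin_sq_add_cos_sq θ
  rw [poissonKernel_def, sub_zero, sub_zero, norm_circleMap_zero, hpole, hdist,
    show 1 + κ ^ 2 / d ^ 2 - 2 * (κ / d) * Real.sin θ = (2 / d) * (ω - κ * Real.sin θ) by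
      field_simp; linarith,
    show |(1 : ℝ)| ^ 2 - κ ^ 2 / d ^ 2 = (2 / d) * (d - ω) by
      rw [abs_one]; field_simp; linarith,
    mul_div_mul_left _ _ (by positivity)]

lemma exists_driftRoot (hκ : 0 ≤ κ) (h : κ < |ω|) :
    ∃ d : ℝ, κ < |d| ∧ d ^ 2 + κ ^ 2 = 2 * ω * d ∧
      ∀ θ, (d - ω) / (ω - κ * Real.sin θ) = 2 * Real.pi * driftDensity κ ω θ := by
  have hdisc : 0 < ω ^ 2 - κ ^ 2 := by rw [← sq_abs ω]; nlinarith
  have hσ : 0 < Real.sqrt (ω ^ 2 - κ ^ 2) := Real.sqrt_pos.mpr hdisc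
  have hσ_sq : Real.sqrt (ω ^ 2 - κ ^ 2) ^ 2 = ω ^ 2 - κ ^ 2 := Real.sq_sqrt hdisc.le
  have hdensity (θ : ℝ) : 2 * Real.pi * driftDensity κ ω θ
      = Real.sqrt (ω ^ 2 - κ ^ 2) / |ω - κ * Real.sin θ| := by
    have := abs_pos.mpr (sub_mul_sin_ne_zero hκ h θ)
    unfold driftDensity
    field_simp
  rcases le_or_gt 0 ω with hω | hω
  · refine ⟨ω + Real.sqrt (ω ^ 2 - κ ^ 2), ?_, by linear_combination hσ_sq, fun θ => ?_⟩
    · rw [abs_of_nonneg (by positivity)]; linarith [abs_of_nonneg hω]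
    · have := (abs_lt.mp (abs_mul_sin_lt hκ h θ)).2
      rw [hdensity, abs_of_nonneg (by linarith [abs_of_nonneg hω]), add_sub_cancel_left]
  · refine ⟨ω - Real.sqrt (ω ^ 2 - κ ^ 2), ?_, by linear_combination hσ_sq, fun θ => ?_⟩
    · rw [abs_of_neg (by linarith)]; linarith [abs_of_neg hω]
    · have := (abs_lt.mp (abs_mul_sin_lt hκ h θ)).1
      rw [hdensity, abs_of_neg (by linarith [abs_of_neg hω]), div_neg, sub_sub_cancel_left,
        neg_div]

lemma phaseMeasure_of_le (h : |ω| ≤ κ) :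
    phaseMeasure κ ω = Measure.dirac (Real.arcsin (ω / κ)) := if_pos h

lemma phaseMeasure_of_lt (h : κ < |ω|) :
    phaseMeasure κ ω = (volume.restrict (Ioc (-Real.pi) Real.pi)).withDensity
      fun θ => ENNReal.ofReal (driftDensity κ ω θ) := if_neg (not_le.mpr h)

lemma integral_phaseMeasure_of_lt (hκ : 0 ≤ κ) (h : κ < |ω|) (f : ℝ → ℂ) :
    ∫ θ, f θ ∂(phaseMeasure κ ω) = ∫ θ in (-Real.pi)..Real.pi, driftDensity κ ω θ • f θ := by
  have := (continuous_driftDensity hκ h).measurable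
  rw [phaseMeasure_of_lt h, integral_withDensity_eq_integral_toReal_smul
      (by fun_prop) (ae_of_all _ fun _ => ENNReal.ofReal_lt_top),
    intervalIntegral.integral_of_le (by linarith [Real.pi_pos])]
  simp only [ENNReal.toReal_ofReal (driftDensity_nonneg κ ω _)]

/-- The drift density is a Poisson kernel, so holomorphic functions are averaged by evaluation. -/
lemma integral_driftDensity_smul_circleMap (hκ : 0 ≤ κ) {d : ℝ}
    (hd : κ < |d|) (hq : d ^ 2 + κ ^ 2 = 2 * ω * d)
    (hdensity : ∀ θ, (d - ω) / (ω - κ * Real.sin θ) = 2 * Real.pi * driftDensity κ ω θ)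
    {f : ℂ → ℂ} (hf : DiffContOnCl ℂ f (Metric.ball 0 1)) :
    ∫ θ in (-Real.pi)..Real.pi, driftDensity κ ω θ • f (circleMap 0 1 θ)
      = f (Complex.I * ((κ / d : ℝ) : ℂ)) := by
  have hd0 : d ≠ 0 := abs_pos.mp (hκ.trans_lt hd)
  have hmem : Complex.I * ((κ / d : ℝ) : ℂ) ∈ Metric.ball (0 : ℂ) 1 := by
    rw [mem_ball_zero_iff, norm_mul, Complex.norm_I, one_mul, Complex.norm_real, Real.norm_eq_abs,
      abs_div, abs_of_nonneg hκ]
    exact (div_lt_one (hκ.trans_lt hd)).mpr hd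
  rw [← hf.circleAverage_poissonKernel_smul hmem, Real.circleAverage_eq_integral_add (-Real.pi)]
  simp only [Pi.smul_apply', poissonKernel_eq_of_quadratic hd0 hq, hdensity]
  rw [intervalIntegral.integral_comp_add_right
      (fun θ => (2 * Real.pi * driftDensity κ ω θ) • f (circleMap 0 1 θ)), zero_add,
    two_mul Real.pi, add_neg_cancel_right, ← intervalIntegral.integral_smul]
  simp only [smul_smul]
  congr 1; ext θ
  rw [← two_mul, inv_mul_cancel_left₀ (by positivity)]

lemma exists_moment_eq_pow_of_lt (hκ : 0 ≤ κ) (h : κ < |ω|) :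
    ∃ β : ℂ, ‖β‖ ≤ 1 ∧ κ * β ^ 2 + 2 * (Complex.I * ω) * β = κ ∧ ∀ ℓ, moment κ ℓ ω = β ^ ℓ := by
  obtain ⟨d, hd, hq, hdensity⟩ := exists_driftRoot hκ h
  have hd0 : (d : ℂ) ≠ 0 := by exact_mod_cast abs_pos.mp (hκ.trans_lt hd)
  refine ⟨starRingEnd ℂ (Complex.I * ((κ / d : ℝ) : ℂ)), ?_, ?_, fun ℓ => ?_⟩
  · rw [RCLike.norm_conj, norm_mul, Complex.norm_I, one_mul, Complex.norm_real, Real.norm_eq_abs,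
      abs_div, abs_of_nonneg hκ]
    exact div_le_one_of_le₀ hd.le (abs_nonneg d)
  · have hqc : (d : ℂ) ^ 2 + κ ^ 2 = 2 * ω * d := by exact_mod_cast hq
    rw [map_mul, Complex.conj_I, Complex.conj_ofReal, Complex.ofReal_div]
    field_simp
    linear_combination (κ * Complex.I ^ 2) * hqc - κ * d ^ 2 * Complex.I_sq
  · rw [← map_pow, ← integral_driftDensity_smul_circleMap hκ hd hq hdensity
        (f := fun z => z ^ ℓ) (differentiable_id.pow ℓ).diffContOnCl,
      ← intervalIntegral.intervalIntegral_conj, moment, integral_phaseMeasure_of_lt hκ h]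
    congr 1; ext θ
    rw [Complex.real_smul, Complex.real_smul, map_mul, Complex.conj_ofReal, map_pow, circleMap_zero,
      Complex.ofReal_one, one_mul, ← Complex.exp_conj, map_mul, Complex.conj_ofReal,
      Complex.conj_I, ← Complex.exp_nat_mul]
    congr 2; ring

end Drift

section Locked

variable {κ ω : ℝ}

lemma mul_sin_arcsin_div (h : |ω| ≤ κ) : κ * Real.sin (Real.arcsin (ω / κ)) = ω := by
  rcases (abs_nonneg ω |>.trans h).eq_or_lt with rfl | hκ
  · rw [zero_mul, abs_nonpos_iff.mp h]
  · obtain ⟨hl, hr⟩ := abs_le.mp h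
    rw [Real.sin_arcsin, mul_div_cancel₀ _ hκ.ne']
    · rw [le_div_iff₀ hκ]; linarith
    · rw [div_le_iff₀ hκ]; linarith

lemma moment_of_le (h : |ω| ≤ κ) (ℓ : ℕ) :
    moment κ ℓ ω = Complex.exp (((-Real.arcsin (ω / κ) : ℝ) : ℂ) * Complex.I) ^ ℓ := by
  rw [moment, phaseMeasure_of_le h, integral_dirac, ← Complex.exp_nat_mul]
  congr 1; push_cast; ring

lemma exists_moment_eq_pow_of_le (h : |ω| ≤ κ) :
    ∃ β : ℂ, ‖β‖ ≤ 1 ∧ κ * β ^ 2 + 2 * (Complex.I * ω) * β = κ ∧ ∀ ℓ, moment κ ℓ ω = β ^ ℓ := by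
  refine ⟨_, (Complex.norm_exp_ofReal_mul_I _).le, ?_, moment_of_le h⟩
  have hω : (ω : ℂ) = κ * Complex.sin (Real.arcsin (ω / κ)) := by
    exact_mod_cast (mul_sin_arcsin_div h).symm
  generalize Real.arcsin (ω / κ) = θ at hω ⊢
  rw [hω, Complex.exp_mul_I, Complex.ofReal_neg, Complex.cos_neg, Complex.sin_neg]
  linear_combination (κ * Complex.sin_sq_add_cos_sq (θ : ℂ)) - κ * Complex.sin θ ^ 2 * Complex.I_sq

lemma re_moment_one_pos (h : |ω| < κ) : 0 < (moment κ 1 ω).re := by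
  have hκ : 0 < κ := (abs_nonneg ω).trans_lt h
  obtain ⟨hl, hr⟩ := abs_lt.mp h
  rw [moment_of_le h.le, pow_one, Complex.exp_ofReal_mul_I_re, Real.cos_neg]
  refine Real.cos_pos_of_mem_Ioo ⟨Real.neg_pi_div_two_lt_arcsin.mpr ?_,
    Real.arcsin_lt_pi_div_two.mpr ?_⟩
  · rw [lt_div_iff₀ hκ]; linarith
  · rw [div_lt_iff₀ hκ]; linarith

end Locked

section Moment

variable {κ : ℝ}

lemma exists_moment_eq_pow (hκ : 0 ≤ κ) (ω : ℝ) :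
    ∃ β : ℂ, ‖β‖ ≤ 1 ∧ κ * β ^ 2 + 2 * (Complex.I * ω) * β = κ ∧ ∀ ℓ, moment κ ℓ ω = β ^ ℓ :=
  (le_or_gt |ω| κ).elim exists_moment_eq_pow_of_le (exists_moment_eq_pow_of_lt hκ)

lemma moment_eq_pow (hκ : 0 ≤ κ) (ℓ : ℕ) (ω : ℝ) : moment κ ℓ ω = moment κ 1 ω ^ ℓ := by
  obtain ⟨β, -, -, hβ⟩ := exists_moment_eq_pow hκ ω
  rw [hβ ℓ, hβ 1, pow_one]

lemma norm_moment_one_le (hκ : 0 ≤ κ) (ω : ℝ) : ‖moment κ 1 ω‖ ≤ 1 := by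
  obtain ⟨β, hβ1, -, hβ⟩ := exists_moment_eq_pow hκ ω
  rwa [hβ 1, pow_one]

lemma quadratic_moment_one (hκ : 0 ≤ κ) (ω : ℝ) :
    κ * moment κ 1 ω ^ 2 + 2 * (Complex.I * ω) * moment κ 1 ω = κ := by
  obtain ⟨β, -, hquad, hβ⟩ := exists_moment_eq_pow hκ ω
  rwa [hβ 1, pow_one]

end Moment

/-! ### Damped phase factors -/

/-- The root `β` of `κ β² + 2 s β = κ` in the closed unit disc, for `Re s > 0`. The branch
`s √(1 + (κ / s)²)` of `√(s² + κ²)` is the one in the closed half plane around `s`. -/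
def dampedRoot (κ : ℝ) (s : ℂ) : ℂ := κ / (s + s * (1 + (κ / s) ^ 2) ^ (1 / 2 : ℂ))

/-- `β` is a measurable family of roots in the closed unit disc of `κ β² + 2 (ε + iω) β = κ`. The
powers `βˡ` then satisfy the recursion of the stationary moments, damped at the rate `ε`. -/
structure IsPhaseFactor (κ ε : ℝ) (β : ℝ → ℂ) : Prop where
  aestronglyMeasurable : AEStronglyMeasurable β volume
  norm_le_one : ∀ ω, ‖β ω‖ ≤ 1
  quadratic : ∀ ω : ℝ, κ * β ω ^ 2 + 2 * (ε + Complex.I * ω) * β ω = κ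

section DampedRoot

variable {κ : ℝ} {s : ℂ}

lemma measurable_dampedRoot (κ : ℝ) : Measurable (dampedRoot κ) := by
  unfold dampedRoot; fun_prop

lemma re_sqrt_nonneg (z : ℂ) : 0 ≤ (z ^ (1 / 2 : ℂ)).re := by
  rw [show (1 / 2 : ℂ) = ((1 / 2 : ℝ) : ℂ) by push_cast; rfl, Complex.cpow_ofReal_re]
  refine mul_nonneg (by positivity) (Real.cos_nonneg_of_mem_Icc ⟨?_, ?_⟩)
  · linarith [Complex.neg_pi_lt_arg z]
  · linarith [Complex.arg_le_pi z]

lemma norm_one_sub_sqrt_le (z : ℂ) : ‖1 - z ^ (1 / 2 : ℂ)‖ ≤ ‖1 + z ^ (1 / 2 : ℂ)‖ := by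
  have h := re_sqrt_nonneg z
  rw [← sq_le_sq₀ (norm_nonneg _) (norm_nonneg _), ← Complex.normSq_eq_norm_sq,
    ← Complex.normSq_eq_norm_sq, Complex.normSq_sub, Complex.normSq_add]
  simp only [one_mul, Complex.conj_re]
  linarith

lemma one_add_sqrt_ne_zero (z : ℂ) : 1 + z ^ (1 / 2 : ℂ) ≠ 0 := fun h => by
  have := congrArg Complex.re h
  simp only [Complex.add_re, Complex.one_re, Complex.zero_re] at this
  linarith [re_sqrt_nonneg z]

lemma quadratic_dampedRoot (hs : s ≠ 0) :
    κ * dampedRoot κ s ^ 2 + 2 * s * dampedRoot κ s = κ := by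
  have hsq : ((1 + (κ / s) ^ 2) ^ (1 / 2 : ℂ)) ^ 2 = 1 + (κ / s) ^ 2 := by
    rw [← Complex.cpow_nat_mul]; norm_num
  have hne := one_add_sqrt_ne_zero (1 + (κ / s) ^ 2)
  rw [dampedRoot, ← mul_one_add]
  set σ := (1 + ((κ : ℂ) / s) ^ 2) ^ (1 / 2 : ℂ)
  have hκσ : (κ : ℂ) ^ 2 = s ^ 2 * (σ ^ 2 - 1) := by rw [hsq]; field_simp; ring
  field_simp
  linear_combination κ * hκσ

lemma norm_dampedRoot_le_one (κ : ℝ) (s : ℂ) : ‖dampedRoot κ s‖ ≤ 1 := by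
  have hsq : ((1 + (κ / s) ^ 2) ^ (1 / 2 : ℂ)) ^ 2 = 1 + (κ / s) ^ 2 := by
    rw [← Complex.cpow_nat_mul]; norm_num
  have hne := one_add_sqrt_ne_zero (1 + (κ / s) ^ 2)
  have hle := norm_one_sub_sqrt_le (1 + (κ / s) ^ 2)
  rw [dampedRoot, ← mul_one_add, ← div_div, norm_div]
  set σ := (1 + ((κ : ℂ) / s) ^ 2) ^ (1 / 2 : ℂ)
  have hprod : ‖(κ : ℂ) / s‖ ^ 2 = ‖1 - σ‖ * ‖1 + σ‖ := by
    rw [← norm_pow, ← norm_mul, ← norm_neg, eq_sub_of_add_eq' hsq.symm]; congr 1; ring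
  refine div_le_one_of_le₀ ?_ (norm_nonneg _)
  rw [← sq_le_sq₀ (norm_nonneg _) (norm_nonneg _), hprod, sq]
  gcongr

lemma isPhaseFactor_dampedRoot (κ : ℝ) {ε : ℝ} (hε : 0 < ε) :
    IsPhaseFactor κ ε fun ω => dampedRoot κ (ε + Complex.I * ω) := by
  have hs (ω : ℝ) : (ε + Complex.I * ω : ℂ) ≠ 0 := fun h =>
    hε.ne' (by simpa using congrArg Complex.re h)
  exact {
    aestronglyMeasurable := ((measurable_dampedRoot κ).comp (by fun_prop)).aestronglyMeasurable
    norm_le_one := fun ω => norm_dampedRoot_le_one κ _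
    quadratic := fun ω => quadratic_dampedRoot (hs ω) }

end DampedRoot

namespace IsPhaseFactor

variable {κ ε : ℝ} {β γ : ℝ → ℂ}

lemma norm_pow_le_one (hβ : IsPhaseFactor κ ε β) (ℓ : ℕ) (ω : ℝ) : ‖β ω ^ ℓ‖ ≤ 1 := by
  rw [norm_pow]; exact pow_le_one₀ (norm_nonneg _) (hβ.norm_le_one ω)

lemma recursion (hβ : IsPhaseFactor κ ε β) (ℓ : ℕ) (ω : ℝ) :
    -Complex.I * ω * β ω ^ (ℓ + 1)
      = ε * β ω ^ (ℓ + 1) + κ / 2 * (β ω ^ (ℓ + 2) - β ω ^ ℓ) := by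
  linear_combination -(β ω ^ ℓ / 2) * hβ.quadratic ω

lemma mul_re_mul_one_sub_sq_norm (hβ : IsPhaseFactor κ ε β) (ω : ℝ) :
    κ * (β ω).re * (1 - ‖β ω‖ ^ 2) = 2 * ε * ‖β ω‖ ^ 2 := by
  have h := congrArg (fun z => (z * starRingEnd ℂ (β ω)).re) (hβ.quadratic ω)
  simp only [sq, Complex.add_re, Complex.add_im, Complex.mul_re, Complex.mul_im,
    Complex.ofReal_re, Complex.ofReal_im, Complex.conj_re, Complex.conj_im, Complex.I_re,
    Complex.I_im, Complex.re_ofNat, Complex.im_ofNat] at h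
  rw [← Complex.normSq_eq_norm_sq, Complex.normSq_apply]
  linear_combination -h

lemma norm_le_div (hκ : 0 ≤ κ) (hε : 0 < ε) (hβ : IsPhaseFactor κ ε β) (ω : ℝ) :
    ‖β ω‖ ≤ κ / (κ + ε) := by
  have hid := hβ.mul_re_mul_one_sub_sq_norm ω
  have hle := hβ.norm_le_one ω
  have hre : (β ω).re ≤ ‖β ω‖ := Complex.re_le_norm _
  rcases (norm_nonneg (β ω)).eq_or_lt with h0 | hpos
  · rw [← h0]; positivity
  have hdrop : ‖β ω‖ * (2 * ε * ‖β ω‖) ≤ ‖β ω‖ * (κ * (1 - ‖β ω‖ ^ 2)) :=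
    calc ‖β ω‖ * (2 * ε * ‖β ω‖) = κ * (β ω).re * (1 - ‖β ω‖ ^ 2) := by rw [hid]; ring
      _ ≤ κ * ‖β ω‖ * (1 - ‖β ω‖ ^ 2) := by
        have : 0 ≤ 1 - ‖β ω‖ ^ 2 := by nlinarith
        gcongr
      _ = ‖β ω‖ * (κ * (1 - ‖β ω‖ ^ 2)) := by ring
  rw [le_div_iff₀ (by positivity)]
  nlinarith [le_of_mul_le_mul_left hdrop hpos, mul_nonneg hκ (sq_nonneg (1 - ‖β ω‖))]

lemma re_nonneg (hκ : 0 < κ) (hε : 0 < ε) (hβ : IsPhaseFactor κ ε β) (ω : ℝ) : 0 ≤ (β ω).re := by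
  have hlt : ‖β ω‖ < 1 :=
    (hβ.norm_le_div hκ.le hε ω).trans_lt ((div_lt_one (by positivity)).mpr (by linarith))
  have hpos : 0 < 1 - ‖β ω‖ ^ 2 := by nlinarith [norm_nonneg (β ω)]
  have hid := hβ.mul_re_mul_one_sub_sq_norm ω
  refine nonneg_of_mul_nonneg_right (b := (β ω).re) (a := κ) ?_ hκ
  refine nonneg_of_mul_nonneg_left (a := κ * (β ω).re) ?_ hpos
  rw [hid]; positivity

end IsPhaseFactor

section DampingLimit

variable {κ ω : ℝ}

/-- The denominator obtained by subtracting the equations of the damped and the undamped root. -/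
lemma exists_pos_le_norm_root_add (hκ : 0 ≤ κ) (h : |ω| ≠ κ) :
    ∃ c > 0, ∀ ε > 0, ∀ β, IsPhaseFactor κ ε β →
      c ≤ ‖κ * (β ω + moment κ 1 ω) + 2 * (Complex.I * ω)‖ := by
  rcases lt_or_gt_of_ne h with h | h
  · have hκ' : 0 < κ := (abs_nonneg ω).trans_lt h
    refine ⟨κ * (moment κ 1 ω).re, mul_pos hκ' (re_moment_one_pos h), fun ε hε β hβ => ?_⟩
    refine le_trans ?_ (Complex.re_le_norm _)
    have hβre := mul_nonneg hκ (hβ.re_nonneg hκ' hε ω)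
    have hre : (κ * (β ω + moment κ 1 ω) + 2 * (Complex.I * ω)).re
        = κ * (β ω).re + κ * (moment κ 1 ω).re := by simp [mul_add]
    linarith
  · refine ⟨2 * (|ω| - κ), by linarith, fun ε _ β hβ => ?_⟩
    have hsum : ‖(κ : ℂ) * (β ω + moment κ 1 ω)‖ ≤ κ * (1 + 1) := by
      rw [norm_mul, Complex.norm_real, Real.norm_eq_abs, abs_of_nonneg hκ]
      gcongr
      exact norm_add_le_of_le (hβ.norm_le_one ω) (norm_moment_one_le hκ ω)
    have hfreq : ‖2 * (Complex.I * (ω : ℂ))‖ = 2 * |ω| := by simp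
    have := norm_sub_le_norm_add (2 * (Complex.I * (ω : ℂ))) (κ * (β ω + moment κ 1 ω))
    rw [add_comm]
    linarith

lemma tendsto_dampedRoot (hκ : 0 ≤ κ) (h : |ω| ≠ κ) :
    Tendsto (fun ε : ℝ => dampedRoot κ (ε + Complex.I * ω)) (𝓝[>] 0) (𝓝 (moment κ 1 ω)) := by
  obtain ⟨c, hc, hbound⟩ := exists_pos_le_norm_root_add hκ h
  have hlim : Tendsto (fun ε : ℝ => 2 * ε / c) (𝓝[>] 0) (𝓝 0) := by
    have : Continuous fun ε : ℝ => 2 * ε / c := by fun_prop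
    simpa using (this.tendsto 0).mono_left nhdsWithin_le_nhds
  rw [tendsto_iff_norm_sub_tendsto_zero]
  refine squeeze_zero' (Eventually.of_forall fun _ => norm_nonneg _) ?_ hlim
  filter_upwards [self_mem_nhdsWithin] with ε (hε : 0 < ε)
  have hβ := isPhaseFactor_dampedRoot κ hε
  set β : ℂ := dampedRoot κ (ε + Complex.I * ω)
  have hdiff : (β - moment κ 1 ω) * (κ * (β + moment κ 1 ω) + 2 * (Complex.I * ω))
      = -(2 * ε * β) := by
    linear_combination hβ.quadratic ω - quadratic_moment_one hκ ω
  rw [le_div_iff₀ hc]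
  calc ‖β - moment κ 1 ω‖ * c
      ≤ ‖β - moment κ 1 ω‖ * ‖κ * (β + moment κ 1 ω) + 2 * (Complex.I * ω)‖ := by
        gcongr; exact hbound ε hε _ hβ
    _ = 2 * ε * ‖β‖ := by rw [← norm_mul, hdiff]; simp [abs_of_pos hε]
    _ ≤ 2 * ε := mul_le_of_le_one_right (by positivity) (hβ.norm_le_one ω)

lemma ae_abs_ne (κ : ℝ) : ∀ᵐ ω : ℝ, |ω| ≠ κ := by
  filter_upwards [Measure.ae_ne volume κ, Measure.ae_ne volume (-κ)] with ω h h' hω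
  exact (eq_or_eq_neg_of_abs_eq hω).elim h h'

lemma isPhaseFactor_moment (hκ : 0 ≤ κ) : IsPhaseFactor κ 0 (moment κ 1) where
  aestronglyMeasurable := aestronglyMeasurable_of_tendsto_ae (𝓝[>] (0 : ℝ))
    (fun _ => ((measurable_dampedRoot κ).comp (by fun_prop)).aestronglyMeasurable)
    ((ae_abs_ne κ).mono fun _ => tendsto_dampedRoot hκ)
  norm_le_one := norm_moment_one_le hκ
  quadratic ω := by simpa using quadratic_moment_one hκ ω

end DampingLimit

/-! ### The Fourier modes -/

/-- The Fourier transform with angular frequency, in the normalisation of `gHat`. -/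
def angularFourier (h : ℝ → ℂ) (ξ : ℝ) : ℂ :=
  ∫ ω : ℝ, Complex.exp (-Complex.I * ξ * ω) * h ω

/-- The Fourier transform of `βˡ g`; for `β = moment κ 1` this is `(f̂_stat)_ℓ`, and the damped
phase factors approximate it. -/
def mode (β : ℝ → ℂ) (g : ℝ → ℝ) (ℓ : ℕ) : ℝ → ℂ :=
  angularFourier fun ω => β ω ^ ℓ * g ω

section AngularFourier

variable {h : ℝ → ℂ}

lemma norm_exp_neg_I_mul_mul (ξ ω : ℝ) : ‖Complex.exp (-Complex.I * ξ * ω)‖ = 1 := by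
  simp [Complex.norm_exp]

lemma angularFourier_eq_fourier (h : ℝ → ℂ) :
    angularFourier h = fun ξ => 𝓕 h ((2 * Real.pi)⁻¹ * ξ) := by
  ext ξ
  rw [Real.fourier_eq', angularFourier]
  congr 1; ext ω
  rw [smul_eq_mul]
  congr 2
  simp only [RCLike.inner_apply, conj_trivial]
  push_cast
  field_simp

lemma continuous_angularFourier (hh : Integrable h) : Continuous (angularFourier h) := by
  rw [angularFourier_eq_fourier]
  exact (VectorFourier.fourierIntegral_continuous Real.continuous_fourierChar
    (innerSL ℝ).continuous₂ hh).comp (by fun_prop)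

lemma hasDerivAt_angularFourier (hh : Integrable h) (hωh : Integrable fun ω : ℝ => ω * h ω)
    (ξ : ℝ) :
    HasDerivAt (angularFourier h) (angularFourier (fun ω => -Complex.I * ω * h ω) ξ) ξ := by
  have hfourier := Real.hasDerivAt_fourier hh
    (by simpa only [Complex.real_smul] using hωh) ((2 * Real.pi)⁻¹ * ξ)
  have hcomp := hfourier.scomp ξ ((hasDerivAt_id ξ).const_mul (2 * Real.pi)⁻¹)
  rw [angularFourier_eq_fourier h]
  refine hcomp.congr_deriv ?_
  rw [angularFourier_eq_fourier]
  beta_reduce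
  rw [Real.fourier_eq', Real.fourier_eq', ← integral_smul]
  congr 1; ext ω
  simp only [smul_eq_mul, Complex.real_smul]
  push_cast
  field_simp

lemma tendsto_angularFourier_atTop (h : ℝ → ℂ) : Tendsto (angularFourier h) atTop (𝓝 0) := by
  rw [angularFourier_eq_fourier]
  exact (Real.zero_at_infty_fourier h).comp
    ((tendsto_id.const_mul_atTop (by positivity)).mono_right atTop_le_cocompact)

lemma norm_angularFourier_le (h : ℝ → ℂ) (ξ : ℝ) : ‖angularFourier h ξ‖ ≤ ∫ ω, ‖h ω‖ := by
  refine (norm_integral_le_integral_norm _).trans_eq ?_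
  simp only [norm_mul, norm_exp_neg_I_mul_mul, one_mul]

end AngularFourier

lemma mode_zero (β : ℝ → ℂ) (g : ℝ → ℝ) : mode β g 0 = gHat g := by
  ext ξ; simp only [mode, angularFourier, gHat, pow_zero, one_mul]

lemma fHat_eq_mode {κ : ℝ} (hκ : 0 ≤ κ) (g : ℝ → ℝ) : fHat κ g = mode (moment κ 1) g := by
  ext ℓ ξ
  unfold fHat mode angularFourier
  congr 1; ext ω
  beta_reduce
  rw [← moment_eq_pow hκ, moment, ← mul_assoc, ← integral_const_mul]
  simp only [← Complex.exp_add]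
  congr 2; ext θ
  ring_nf

namespace IsPhaseFactor

variable {κ ε : ℝ} {β : ℝ → ℂ} {g : ℝ → ℝ}

lemma integrable_pow_mul (hβ : IsPhaseFactor κ ε β) (hg : Integrable g) (ℓ : ℕ) :
    Integrable fun ω => β ω ^ ℓ * (g ω : ℂ) :=
  hg.ofReal.bdd_mul (hβ.aestronglyMeasurable.pow ℓ) (ae_of_all _ (hβ.norm_pow_le_one ℓ))

lemma continuous_mode (hβ : IsPhaseFactor κ ε β) (hg : Integrable g) (ℓ : ℕ) :
    Continuous (mode β g ℓ) :=
  continuous_angularFourier (hβ.integrable_pow_mul hg ℓ)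

lemma hasDerivAt_mode (hβ : IsPhaseFactor κ ε β) (hg : Integrable g) (ℓ : ℕ) (ξ : ℝ) :
    HasDerivAt (mode β g (ℓ + 1))
      (ε * mode β g (ℓ + 1) ξ + κ / 2 * (mode β g (ℓ + 2) ξ - mode β g ℓ ξ)) ξ := by
  have hInt := hβ.integrable_pow_mul hg
  have hrec : (fun ω : ℝ => -Complex.I * ω * (β ω ^ (ℓ + 1) * (g ω : ℂ))) = fun ω =>
      ε * (β ω ^ (ℓ + 1) * g ω) + κ / 2 * (β ω ^ (ℓ + 2) * g ω - β ω ^ ℓ * g ω) := by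
    ext ω; rw [← mul_assoc, hβ.recursion]; ring
  have hint_rec := ((hInt (ℓ + 1)).const_mul (ε : ℂ)).add
    (((hInt (ℓ + 2)).sub (hInt ℓ)).const_mul (κ / 2 : ℂ))
  have hint_freq : Integrable fun ω : ℝ => (ω : ℂ) * (β ω ^ (ℓ + 1) * g ω) := by
    refine ((hint_rec.congr (.of_forall fun ω => (congrFun hrec ω).symm)).const_mul
      Complex.I).congr (.of_forall fun ω => ?_)
    linear_combination -(ω * (β ω ^ (ℓ + 1) * (g ω : ℂ))) * Complex.I_sq
  refine (hasDerivAt_angularFourier (hInt _) hint_freq ξ).congr_deriv ?_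
  have hint_exp (j : ℕ) : Integrable fun ω : ℝ =>
      Complex.exp (-Complex.I * ξ * ω) * (β ω ^ j * g ω) :=
    (hInt j).bdd_mul (Continuous.aestronglyMeasurable (by fun_prop))
      (ae_of_all _ fun ω => (norm_exp_neg_I_mul_mul ξ ω).le)
  have hint_diff : Integrable fun ω : ℝ => (κ / 2 : ℂ)
      * (Complex.exp (-Complex.I * ξ * ω) * (β ω ^ (ℓ + 2) * g ω)
        - Complex.exp (-Complex.I * ξ * ω) * (β ω ^ ℓ * g ω)) :=
    ((hint_exp _).sub (hint_exp _)).const_mul _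
  simp only [mode, angularFourier]
  rw [← integral_sub (hint_exp _) (hint_exp _), ← integral_const_mul, ← integral_const_mul,
    ← integral_add ((hint_exp _).const_mul _) hint_diff]
  congr 1; ext ω
  linear_combination Complex.exp (-Complex.I * ξ * ω) * congrFun hrec ω

lemma norm_mode_le (hβ : IsPhaseFactor κ ε β) (hκ : 0 ≤ κ) (hε : 0 < ε) (hg : Integrable g)
    (ℓ : ℕ) (ξ : ℝ) : ‖mode β g ℓ ξ‖ ≤ (κ / (κ + ε)) ^ ℓ * ∫ ω, |g ω| := by
  refine (norm_angularFourier_le _ ξ).trans ?_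
  rw [← integral_const_mul]
  refine integral_mono (hβ.integrable_pow_mul hg ℓ).norm (hg.abs.const_mul _) fun ω => ?_
  simp only [norm_mul, norm_pow, Complex.norm_real, Real.norm_eq_abs]
  gcongr
  exact hβ.norm_le_div hκ hε ω

end IsPhaseFactor

lemma tendsto_mode_dampedRoot {κ : ℝ} {g : ℝ → ℝ} (hκ : 0 ≤ κ) (hg : Integrable g) (ℓ : ℕ)
    (ξ : ℝ) :
    Tendsto (fun ε : ℝ => mode (fun ω => dampedRoot κ (ε + Complex.I * ω)) g ℓ ξ) (𝓝[>] 0)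
      (𝓝 (fHat κ g ℓ ξ)) := by
  rw [fHat_eq_mode hκ]
  refine tendsto_integral_filter_of_dominated_convergence (fun ω => ‖g ω‖) ?_ ?_ hg.norm ?_
  · filter_upwards [self_mem_nhdsWithin] with ε hε
    exact Continuous.aestronglyMeasurable (by fun_prop) |>.mul
      ((isPhaseFactor_dampedRoot κ hε).integrable_pow_mul hg ℓ).aestronglyMeasurable
  · refine Eventually.of_forall fun ε => ae_of_all _ fun ω => ?_
    rw [norm_mul, norm_mul, norm_exp_neg_I_mul_mul, one_mul, norm_pow, Complex.norm_real]
    exact mul_le_of_le_one_left (norm_nonneg _)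
      (pow_le_one₀ (norm_nonneg _) (norm_dampedRoot_le_one _ _))
  · filter_upwards [ae_abs_ne κ] with ω h
    exact (((tendsto_dampedRoot hκ h).pow ℓ).mul_const _).const_mul _

/-! ### The energy inequality -/

/-- The sum `∑_{ℓ ≥ 1} ℓᵃ s_ℓ`; both the squared norm `‖·‖²_{φ,k}` and the energies of the modes are
of this form. -/
def weightedSum (a : ℝ) (s : ℕ → ℝ≥0∞) : ℝ≥0∞ :=
  ∑' ℓ : ℕ, ENNReal.ofReal (((ℓ + 1 : ℕ) : ℝ) ^ a) * s (ℓ + 1)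

section WeightedSum

variable {a : ℝ} {s t : ℕ → ℝ≥0∞}

lemma weightedSum_mono (h : ∀ ℓ, s (ℓ + 1) ≤ t (ℓ + 1)) : weightedSum a s ≤ weightedSum a t :=
  ENNReal.tsum_le_tsum fun ℓ => mul_le_mul_right (h ℓ) _

lemma weightedSum_add (a : ℝ) (s t : ℕ → ℝ≥0∞) :
    weightedSum a (fun ℓ => s ℓ + t ℓ) = weightedSum a s + weightedSum a t := by
  simp only [weightedSum, mul_add, ENNReal.tsum_add]

lemma weightedSum_const_mul (a : ℝ) (c : ℝ≥0∞) (s : ℕ → ℝ≥0∞) :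
    weightedSum a (fun ℓ => c * s ℓ) = c * weightedSum a s := by
  simp only [weightedSum, mul_left_comm _ c, ENNReal.tsum_mul_left]

lemma weightedSum_sq_mul (a : ℝ) (s : ℕ → ℝ≥0∞) :
    weightedSum a (fun ℓ => (ℓ : ℝ≥0∞) ^ 2 * s ℓ) = weightedSum (a + 2) s := by
  refine tsum_congr fun ℓ => ?_
  have hℓ : (0 : ℝ) < ((ℓ + 1 : ℕ) : ℝ) := by positivity
  rw [Real.rpow_add hℓ, Real.rpow_two, ENNReal.ofReal_mul (by positivity),
    ENNReal.ofReal_pow hℓ.le, ENNReal.ofReal_natCast, mul_assoc]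

lemma weightedSum_succ_le (ha : 0 ≤ a) (s : ℕ → ℝ≥0∞) :
    weightedSum a (fun ℓ => s (ℓ + 1)) ≤ weightedSum a s := by
  refine le_trans (ENNReal.tsum_le_tsum fun ℓ => ?_)
    (ENNReal.tsum_comp_le_tsum_of_injective (add_left_injective 1)
      fun ℓ : ℕ => ENNReal.ofReal (((ℓ + 1 : ℕ) : ℝ) ^ a) * s (ℓ + 1))
  gcongr
  exact Nat.le_succ _

lemma weightedSum_pred_le (ha : 0 ≤ a) (s : ℕ → ℝ≥0∞) :
    weightedSum a (fun ℓ => s (ℓ - 1)) ≤ s 0 + ENNReal.ofReal (2 ^ a) * weightedSum a s := by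
  rw [weightedSum, tsum_eq_zero_add' ENNReal.summable, weightedSum, ← ENNReal.tsum_mul_left]
  simp only [zero_add, Nat.cast_one, Real.one_rpow, ENNReal.ofReal_one, one_mul, Nat.sub_self,
    Nat.add_sub_cancel]
  refine add_le_add_right (ENNReal.tsum_le_tsum fun ℓ => ?_) _
  rw [← mul_assoc, ← ENNReal.ofReal_mul (by positivity),
    ← Real.mul_rpow zero_le_two (by positivity)]
  gcongr
  push_cast
  linarith [Nat.cast_nonneg (α := ℝ) ℓ]

lemma measurable_weightedSum {s : ℕ → ℝ → ℝ≥0∞} (hs : ∀ ℓ, Measurable (s ℓ)) :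
    Measurable fun ξ => weightedSum a fun ℓ => s ℓ ξ :=
  Measurable.tsum fun ℓ => (hs (ℓ + 1)).const_mul _

end WeightedSum

/-- The energy `∑_{ℓ ≥ 1} ℓⁿ |x_ℓ|²`. -/
def modeEnergy (n : ℕ) (x : ℕ → ℂ) : ℝ≥0∞ :=
  weightedSum n fun ℓ => ‖x ℓ‖ₑ ^ 2

/-- The truncated energy `∑_{1 ≤ ℓ ≤ N} ℓⁿ |x_ℓ|²`. -/
def partialEnergy (n N : ℕ) (x : ℕ → ℂ) : ℝ :=
  ∑ j ∈ Finset.range N, (j + 1 : ℝ) ^ n * ‖x (j + 1)‖ ^ 2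

/-- The flux `∑_{1 ≤ ℓ ≤ N} ℓⁿ Re (conj x_ℓ (x_{ℓ+1} - x_{ℓ-1}))` driving the truncated energy. -/
def flux (n N : ℕ) (x : ℕ → ℂ) : ℝ :=
  ∑ j ∈ Finset.range N, (j + 1 : ℝ) ^ n * (starRingEnd ℂ (x (j + 1)) * (x (j + 2) - x j)).re

lemma flux_eq (n N : ℕ) (x : ℕ → ℂ) :
    flux n (N + 1) x = (N + 1 : ℝ) ^ n * (starRingEnd ℂ (x (N + 1)) * x (N + 2)).re
      - (starRingEnd ℂ (x 0) * x 1).re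
      - ∑ j ∈ Finset.range N, ((j + 2 : ℝ) ^ n - (j + 1 : ℝ) ^ n)
          * (starRingEnd ℂ (x (j + 1)) * x (j + 2)).re := by
  have hcomm (z w : ℂ) : (starRingEnd ℂ z * w).re = (starRingEnd ℂ w * z).re := by
    simp only [Complex.mul_re, Complex.conj_re, Complex.conj_im]; ring
  induction N with
  | zero =>
    rw [hcomm (x 0)]
    simp [flux, mul_sub]
  | succ N ih =>
    rw [flux, Finset.sum_range_succ, ← flux, ih, Finset.sum_range_succ, mul_sub, Complex.sub_re,
      hcomm (x (N + 1 + 1)) (x (N + 1))]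
    push_cast
    ring

lemma add_two_pow_sub_le (n j : ℕ) :
    (j + 2 : ℝ) ^ n - (j + 1 : ℝ) ^ n ≤ n * 2 ^ (n - 1) * (j + 1 : ℝ) ^ (n - 1) := by
  have hmax : max |(j + 2 : ℝ)| |(j + 1 : ℝ)| ≤ 2 * (j + 1 : ℝ) := by
    rw [abs_of_nonneg (by positivity), abs_of_nonneg (by positivity)]
    rw [max_eq_left (by linarith)]
    linarith [j.cast_nonneg (α := ℝ)]
  calc (j + 2 : ℝ) ^ n - (j + 1 : ℝ) ^ n
      ≤ |(j + 2 : ℝ) - (j + 1)| * n * max |(j + 2 : ℝ)| |(j + 1 : ℝ)| ^ (n - 1) :=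
        (le_abs_self _).trans (abs_pow_sub_pow_le _ _ _)
    _ ≤ 1 * n * (2 * (j + 1 : ℝ)) ^ (n - 1) := by
        gcongr
        norm_num [add_sub_add_left_eq_sub]
    _ = _ := by rw [mul_pow]; ring

lemma re_conj_mul_le (z w : ℂ) : |(starRingEnd ℂ z * w).re| ≤ ‖z‖ * ‖w‖ :=
  (Complex.abs_re_le_norm _).trans_eq (by rw [norm_mul, RCLike.norm_conj])

lemma sum_pow_sub_mul_re_le (n N : ℕ) (x : ℕ → ℂ) :
    ∑ j ∈ Finset.range N, ((j + 2 : ℝ) ^ n - (j + 1 : ℝ) ^ n)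
        * (starRingEnd ℂ (x (j + 1)) * x (j + 2)).re
      ≤ n * 2 ^ (n - 1) * partialEnergy (n - 1) (N + 1) x := by
  have hterm (j : ℕ) : ((j + 2 : ℝ) ^ n - (j + 1 : ℝ) ^ n)
        * (starRingEnd ℂ (x (j + 1)) * x (j + 2)).re
      ≤ n * 2 ^ (n - 1) * (((j + 1 : ℝ) ^ (n - 1) * ‖x (j + 1)‖ ^ 2
        + (j + 1 : ℝ) ^ (n - 1) * ‖x (j + 2)‖ ^ 2) / 2) := by
    have hcross : (starRingEnd ℂ (x (j + 1)) * x (j + 2)).re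
        ≤ (‖x (j + 1)‖ ^ 2 + ‖x (j + 2)‖ ^ 2) / 2 := by
      linarith [le_of_abs_le (re_conj_mul_le (x (j + 1)) (x (j + 2))),
        two_mul_le_add_sq ‖x (j + 1)‖ ‖x (j + 2)‖]
    have hincr : 0 ≤ (j + 2 : ℝ) ^ n - (j + 1 : ℝ) ^ n := by
      rw [sub_nonneg]; gcongr; norm_num
    calc _ ≤ ((j + 2 : ℝ) ^ n - (j + 1 : ℝ) ^ n)
          * ((‖x (j + 1)‖ ^ 2 + ‖x (j + 2)‖ ^ 2) / 2) := by gcongr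
      _ ≤ n * 2 ^ (n - 1) * (j + 1 : ℝ) ^ (n - 1)
          * ((‖x (j + 1)‖ ^ 2 + ‖x (j + 2)‖ ^ 2) / 2) := by
          gcongr; exact add_two_pow_sub_le n j
      _ = _ := by ring
  have hlow : ∑ j ∈ Finset.range N, (j + 1 : ℝ) ^ (n - 1) * ‖x (j + 1)‖ ^ 2
      ≤ partialEnergy (n - 1) (N + 1) x :=
    Finset.sum_le_sum_of_subset_of_nonneg (Finset.range_mono N.le_succ) fun _ _ _ => by positivity
  have hhigh : ∑ j ∈ Finset.range N, (j + 1 : ℝ) ^ (n - 1) * ‖x (j + 2)‖ ^ 2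
      ≤ partialEnergy (n - 1) (N + 1) x := by
    rw [partialEnergy, Finset.sum_range_succ']
    refine le_add_of_le_of_nonneg (Finset.sum_le_sum fun j _ => ?_) (by positivity)
    push_cast
    gcongr
    linarith
  refine (Finset.sum_le_sum fun j _ => hterm j).trans ?_
  rw [← Finset.mul_sum, ← Finset.sum_div, Finset.sum_add_distrib]
  gcongr
  linarith

lemma neg_flux_le (n N : ℕ) (x : ℕ → ℂ) :
    -flux n (N + 1) x ≤ (N + 1 : ℝ) ^ n * (‖x (N + 1)‖ * ‖x (N + 2)‖) + ‖x 0‖ * ‖x 1‖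
      + n * 2 ^ (n - 1) * partialEnergy (n - 1) (N + 1) x := by
  have hboundary := mul_le_mul_of_nonneg_left
    (neg_le_of_abs_le (re_conj_mul_le (x (N + 1)) (x (N + 2))))
    (by positivity : (0 : ℝ) ≤ (N + 1 : ℝ) ^ n)
  have hforcing := le_of_abs_le (re_conj_mul_le (x 0) (x 1))
  rw [flux_eq]
  linarith [sum_pow_sub_mul_re_le n N x]

lemma ofReal_partialEnergy (n N : ℕ) (x : ℕ → ℂ) :
    ENNReal.ofReal (partialEnergy n N x)
      = ∑ j ∈ Finset.range N, ENNReal.ofReal (((j + 1 : ℕ) : ℝ) ^ (n : ℝ)) * ‖x (j + 1)‖ₑ ^ 2 := by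
  rw [partialEnergy, ENNReal.ofReal_sum_of_nonneg fun _ _ => by positivity]
  refine Finset.sum_congr rfl fun j _ => ?_
  rw [ENNReal.ofReal_mul (by positivity), ENNReal.ofReal_pow (norm_nonneg _), ofReal_norm,
    Real.rpow_natCast, Nat.cast_succ]

lemma ofReal_partialEnergy_le (n N : ℕ) (x : ℕ → ℂ) :
    ENNReal.ofReal (partialEnergy n N x) ≤ modeEnergy n x := by
  rw [ofReal_partialEnergy]; exact ENNReal.sum_le_tsum _

lemma modeEnergy_le_of_tendsto {n : ℕ} {x : ℕ → ℂ} {c : ℕ → ℝ≥0∞} {C : ℝ≥0∞}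
    (hc : Tendsto c atTop (𝓝 C)) (h : ∀ N, ENNReal.ofReal (partialEnergy n (N + 1) x) ≤ c N) :
    modeEnergy n x ≤ C := by
  have hsum := (ENNReal.summable (f := fun ℓ : ℕ =>
    ENNReal.ofReal (((ℓ + 1 : ℕ) : ℝ) ^ (n : ℝ)) * ‖x (ℓ + 1)‖ₑ ^ 2)).hasSum.tendsto_sum_nat
  refine le_of_tendsto_of_tendsto' (hsum.comp (tendsto_add_atTop_nat 1)) hc fun N => ?_
  exact (ofReal_partialEnergy n (N + 1) x).symm.trans_le (h N)

/-- Solutions of the stationary hierarchy `F_{ℓ+1}' = ε F_{ℓ+1} + (κ/2) (F_{ℓ+2} - F_ℓ)` which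
vanish at infinity and decay geometrically in `ℓ`. For `ε > 0` the modes built from `dampedRoot` are
of this kind; the stationary state itself, at `ε = 0`, need not decay in `ℓ`. -/
structure IsDampedHierarchy (κ ε : ℝ) (F : ℕ → ℝ → ℂ) : Prop where
  continuous (ℓ : ℕ) : Continuous (F ℓ)
  hasDerivAt (ℓ : ℕ) (ξ : ℝ) :
    HasDerivAt (F (ℓ + 1)) (ε * F (ℓ + 1) ξ + κ / 2 * (F (ℓ + 2) ξ - F ℓ ξ)) ξ
  tendsto_zero (ℓ : ℕ) : Tendsto (F ℓ) atTop (𝓝 0)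
  geometric_decay : ∃ C q : ℝ, 0 ≤ q ∧ q < 1 ∧ ∀ ℓ ξ, ‖F ℓ ξ‖ ≤ C * q ^ ℓ

lemma isDampedHierarchy_dampedRoot {κ ε : ℝ} {g : ℝ → ℝ} (hκ : 0 ≤ κ) (hε : 0 < ε)
    (hg : Integrable g) :
    IsDampedHierarchy κ ε (mode (fun ω => dampedRoot κ (ε + Complex.I * ω)) g) := by
  have hβ := isPhaseFactor_dampedRoot κ hε
  refine ⟨hβ.continuous_mode hg, hβ.hasDerivAt_mode hg, fun ℓ => tendsto_angularFourier_atTop _,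
    ∫ ω, |g ω|, κ / (κ + ε), by positivity, ?_, fun ℓ ξ => ?_⟩
  · rw [div_lt_one (by positivity)]; linarith
  · rw [mul_comm]; exact hβ.norm_mode_le hκ hε hg ℓ ξ

namespace IsDampedHierarchy

variable {κ ε : ℝ} {F : ℕ → ℝ → ℂ}

lemma exists_summable_bound (hF : IsDampedHierarchy κ ε F) (n : ℕ) :
    ∃ B : ℕ → ℝ, Summable B ∧ (∀ (ℓ : ℕ) (ξ : ℝ), (ℓ + 1 : ℝ) ^ n * ‖F (ℓ + 1) ξ‖ ^ 2 ≤ B ℓ) ∧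
      ∀ (ℓ : ℕ) (ξ : ℝ), (ℓ + 1 : ℝ) ^ n * (‖F (ℓ + 1) ξ‖ * ‖F (ℓ + 2) ξ‖) ≤ B ℓ := by
  obtain ⟨C, q, hq0, hq1, hbound⟩ := hF.geometric_decay
  have hC : 0 ≤ C := by simpa using (norm_nonneg _).trans (hbound 0 0)
  have hmono (ℓ : ℕ) (ξ : ℝ) : ‖F (ℓ + 2) ξ‖ ≤ C * q ^ (ℓ + 1) :=
    (hbound _ ξ).trans (by gcongr C * ?_; exact pow_le_pow_of_le_one hq0 hq1.le (by omega))
  have hq2 : ‖q ^ 2‖ < 1 := by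
    rw [Real.norm_of_nonneg (by positivity)]
    exact pow_lt_one₀ hq0 hq1 two_ne_zero
  have hsummable := (summable_pow_mul_geometric_of_norm_lt_one n hq2).comp_injective
    (add_left_injective 1)
  refine ⟨fun ℓ => C ^ 2 * (((ℓ + 1 : ℕ) : ℝ) ^ n * (q ^ 2) ^ (ℓ + 1)), hsummable.mul_left _,
    fun ℓ ξ => ?_, fun ℓ ξ => ?_⟩
  · calc _ ≤ (ℓ + 1 : ℝ) ^ n * (C * q ^ (ℓ + 1)) ^ 2 := by gcongr; exact hbound _ ξ
      _ = _ := by push_cast; ring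
  · calc _ ≤ (ℓ + 1 : ℝ) ^ n * ((C * q ^ (ℓ + 1)) * (C * q ^ (ℓ + 1))) := by
          gcongr
          exacts [hbound _ ξ, hmono ℓ ξ]
      _ = _ := by push_cast; ring

lemma tendsto_modeEnergy (hF : IsDampedHierarchy κ ε F) (n : ℕ) :
    Tendsto (fun ξ => modeEnergy n fun ℓ => F ℓ ξ) atTop (𝓝 0) := by
  obtain ⟨B, hB, hle, -⟩ := hF.exists_summable_bound n
  have hnonneg (ℓ : ℕ) (ξ : ℝ) : 0 ≤ (ℓ + 1 : ℝ) ^ n * ‖F (ℓ + 1) ξ‖ ^ 2 := by positivity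
  have heq (ξ : ℝ) : modeEnergy n (fun ℓ => F ℓ ξ)
      = ENNReal.ofReal (∑' ℓ : ℕ, (ℓ + 1 : ℝ) ^ n * ‖F (ℓ + 1) ξ‖ ^ 2) := by
    rw [ENNReal.ofReal_tsum_of_nonneg (hnonneg · ξ)
      (hB.of_nonneg_of_le (hnonneg · ξ) (hle · ξ))]
    refine tsum_congr fun ℓ => ?_
    rw [ENNReal.ofReal_mul (by positivity), ENNReal.ofReal_pow (norm_nonneg _), ofReal_norm,
      Real.rpow_natCast, Nat.cast_succ]
  have hlim : Tendsto (fun ξ => ∑' ℓ : ℕ, (ℓ + 1 : ℝ) ^ n * ‖F (ℓ + 1) ξ‖ ^ 2) atTop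
      (𝓝 (∑' _ : ℕ, 0)) := by
    refine tendsto_tsum_of_dominated_convergence hB (fun ℓ => ?_)
      (.of_forall fun ξ ℓ => ?_)
    · simpa using ((hF.tendsto_zero (ℓ + 1)).norm.pow 2).const_mul ((ℓ + 1 : ℝ) ^ n)
    · rw [Real.norm_of_nonneg (hnonneg ℓ ξ)]; exact hle ℓ ξ
  simpa only [heq, tsum_zero, ENNReal.ofReal_zero] using ENNReal.tendsto_ofReal hlim

lemma hasDerivAt_partialEnergy (hF : IsDampedHierarchy κ ε F) (n N : ℕ) (ξ : ℝ) :
    HasDerivAt (fun y => partialEnergy n N fun ℓ => F ℓ y)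
      (2 * ε * partialEnergy n N (fun ℓ => F ℓ ξ) + κ * flux n N fun ℓ => F ℓ ξ) ξ := by
  have hterm (j : ℕ) : HasDerivAt (fun y => (j + 1 : ℝ) ^ n * ‖F (j + 1) y‖ ^ 2)
      ((j + 1 : ℝ) ^ n * (2 * ε * ‖F (j + 1) ξ‖ ^ 2
        + κ * (starRingEnd ℂ (F (j + 1) ξ) * (F (j + 2) ξ - F j ξ)).re)) ξ := by
    refine ((hF.hasDerivAt j ξ).norm_sq.const_mul _).congr_deriv ?_
    rw [Complex.inner, ← Complex.normSq_eq_norm_sq, Complex.normSq_apply]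
    simp only [Complex.mul_re, Complex.mul_im, Complex.add_re, Complex.add_im, Complex.sub_re,
      Complex.sub_im, Complex.conj_re, Complex.conj_im, Complex.ofReal_re, Complex.ofReal_im,
      Complex.div_ofNat_re, Complex.div_ofNat_im]
    ring
  refine (HasDerivAt.fun_sum fun j _ => hterm j).congr_deriv ?_
  rw [partialEnergy, flux, Finset.mul_sum, Finset.mul_sum, ← Finset.sum_add_distrib]
  exact Finset.sum_congr rfl fun j _ => by ring

end IsDampedHierarchy

/-- The sources `κ (|x_0 x_1| + n 2ⁿ⁻¹ ∑_{ℓ ≥ 1} ℓⁿ⁻¹ |x_ℓ|²)` of the energy of order `n`. -/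
def energySource (κ : ℝ) (n : ℕ) (x : ℕ → ℂ) : ℝ≥0∞ :=
  ENNReal.ofReal κ * (‖x 0‖ₑ * ‖x 1‖ₑ + n * 2 ^ (n - 1) * modeEnergy (n - 1) x)

lemma enorm_partialSource_le {κ : ℝ} (hκ : 0 ≤ κ) (n N : ℕ) (x : ℕ → ℂ) :
    ‖κ * (‖x 0‖ * ‖x 1‖ + n * 2 ^ (n - 1) * partialEnergy (n - 1) N x)‖ₑ
      ≤ energySource κ n x := by
  have hE : 0 ≤ partialEnergy (n - 1) N x := Finset.sum_nonneg fun _ _ => by positivity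
  rw [Real.enorm_of_nonneg (by positivity), energySource, ENNReal.ofReal_mul hκ,
    ENNReal.ofReal_add (by positivity) (by positivity), ENNReal.ofReal_mul (norm_nonneg _),
    ENNReal.ofReal_mul (by positivity), ENNReal.ofReal_mul (by positivity),
    ENNReal.ofReal_pow zero_le_two, ENNReal.ofReal_natCast, ENNReal.ofReal_ofNat, ofReal_norm,
    ofReal_norm]
  gcongr
  exact ofReal_partialEnergy_le _ _ _

namespace IsDampedHierarchy

variable {κ ε : ℝ} {F : ℕ → ℝ → ℂ}

lemma continuous_partialEnergy (hF : IsDampedHierarchy κ ε F) (n N : ℕ) :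
    Continuous fun ξ => partialEnergy n N fun ℓ => F ℓ ξ :=
  continuous_finsetSum _ fun _ _ => ((hF.continuous _).norm.pow 2).const_mul _

lemma continuous_flux (hF : IsDampedHierarchy κ ε F) (n N : ℕ) :
    Continuous fun ξ => flux n N fun ℓ => F ℓ ξ :=
  continuous_finsetSum _ fun _ _ => (Complex.continuous_re.comp
    ((Complex.continuous_conj.comp (hF.continuous _)).mul
      ((hF.continuous _).sub (hF.continuous _)))).const_mul _

lemma partialEnergy_le (hF : IsDampedHierarchy κ ε F) (hκ : 0 ≤ κ) (hε : 0 ≤ ε) {n N : ℕ} {B : ℝ}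
    (hB : ∀ y, (N + 1 : ℝ) ^ n * (‖F (N + 1) y‖ * ‖F (N + 2) y‖) ≤ B) {ξ X : ℝ} (hξX : ξ ≤ X) :
    partialEnergy n (N + 1) (fun ℓ => F ℓ ξ) ≤ partialEnergy n (N + 1) (fun ℓ => F ℓ X)
      + κ * B * (X - ξ) + ∫ y in ξ..X, κ * (‖F 0 y‖ * ‖F 1 y‖
        + n * 2 ^ (n - 1) * partialEnergy (n - 1) (N + 1) fun ℓ => F ℓ y) := by
  have hderiv_cont : Continuous fun y => 2 * ε * partialEnergy n (N + 1) (fun ℓ => F ℓ y)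
      + κ * flux n (N + 1) fun ℓ => F ℓ y :=
    ((hF.continuous_partialEnergy n _).const_mul _).add ((hF.continuous_flux n _).const_mul _)
  set S : ℝ → ℝ := fun y => κ * (‖F 0 y‖ * ‖F 1 y‖
    + n * 2 ^ (n - 1) * partialEnergy (n - 1) (N + 1) fun ℓ => F ℓ y)
  have hS : Continuous S :=
    continuous_const.mul (((hF.continuous 0).norm.mul (hF.continuous 1).norm).add
      ((hF.continuous_partialEnergy (n - 1) _).const_mul _))
  have hlower_cont : Continuous fun y => -(κ * B + S y) := (continuous_const.add hS).neg
  have hpointwise (y : ℝ) : -(κ * B + S y)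
      ≤ 2 * ε * partialEnergy n (N + 1) (fun ℓ => F ℓ y) + κ * flux n (N + 1) fun ℓ => F ℓ y := by
    have hE : 0 ≤ partialEnergy n (N + 1) fun ℓ => F ℓ y :=
      Finset.sum_nonneg fun _ _ => by positivity
    have hflux := mul_le_mul_of_nonneg_left
      ((neg_flux_le n N fun ℓ => F ℓ y).trans (add_le_add_left (add_le_add_left (hB y) _) _)) hκ
    linarith [mul_nonneg hε hE]
  have hmono := intervalIntegral.integral_mono hξX
    (hlower_cont.intervalIntegrable (μ := volume) ξ X) (hderiv_cont.intervalIntegrable ξ X)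
    hpointwise
  rw [intervalIntegral.integral_eq_sub_of_hasDerivAt
      (fun y _ => hF.hasDerivAt_partialEnergy n (N + 1) y) (hderiv_cont.intervalIntegrable ξ X),
    intervalIntegral.integral_neg, intervalIntegral.integral_add intervalIntegrable_const
    (hS.intervalIntegrable ξ X), intervalIntegral.integral_const, smul_eq_mul] at hmono
  linarith

lemma ofReal_partialEnergy_le_lintegral (hF : IsDampedHierarchy κ ε F) (hκ : 0 ≤ κ) (hε : 0 ≤ ε)
    {n N : ℕ} {B : ℝ} (hB : ∀ y, (N + 1 : ℝ) ^ n * (‖F (N + 1) y‖ * ‖F (N + 2) y‖) ≤ B)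
    {ξ X : ℝ} (hξX : ξ ≤ X) :
    ENNReal.ofReal (partialEnergy n (N + 1) fun ℓ => F ℓ ξ)
      ≤ modeEnergy n (fun ℓ => F ℓ X) + ENNReal.ofReal (κ * B * (X - ξ))
        + ∫⁻ y in Ioi ξ, energySource κ n fun ℓ => F ℓ y := by
  refine (ENNReal.ofReal_le_ofReal (hF.partialEnergy_le hκ hε hB hξX)).trans
    (ENNReal.ofReal_add_le.trans (add_le_add (ENNReal.ofReal_add_le.trans
      (add_le_add_left (ofReal_partialEnergy_le _ _ _) _)) ?_))
  rw [intervalIntegral.integral_of_le hξX]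
  refine (Real.ofReal_le_enorm _).trans ((enorm_integral_le_lintegral_enorm _).trans
    ((lintegral_mono fun y => ?_).trans (lintegral_mono_set Ioc_subset_Ioi_self)))
  exact enorm_partialSource_le hκ n _ _

lemma modeEnergy_le_lintegral (hF : IsDampedHierarchy κ ε F) (hκ : 0 ≤ κ) (hε : 0 ≤ ε) (n : ℕ)
    (ξ : ℝ) :
    modeEnergy n (fun ℓ => F ℓ ξ) ≤ ∫⁻ y in Ioi ξ, energySource κ n fun ℓ => F ℓ y := by
  obtain ⟨B, hB, -, hle⟩ := hF.exists_summable_bound n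
  have hfinite (X : ℝ) (hX : ξ ≤ X) : modeEnergy n (fun ℓ => F ℓ ξ)
      ≤ modeEnergy n (fun ℓ => F ℓ X) + ∫⁻ y in Ioi ξ, energySource κ n fun ℓ => F ℓ y := by
    have hboundary : Tendsto (fun N => ENNReal.ofReal (κ * B N * (X - ξ))) atTop (𝓝 0) := by
      simpa only [mul_zero, zero_mul, ENNReal.ofReal_zero] using
        ENNReal.tendsto_ofReal ((hB.tendsto_atTop_zero.const_mul κ).mul_const (X - ξ))
    refine modeEnergy_le_of_tendsto ?_ fun N =>
      hF.ofReal_partialEnergy_le_lintegral hκ hε (hle N) hX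
    simpa only [add_zero] using (tendsto_const_nhds.add hboundary).add tendsto_const_nhds
  refine ge_of_tendsto ?_ ((eventually_ge_atTop ξ).mono hfinite)
  simpa only [zero_add] using (hF.tendsto_modeEnergy n).add_const _

lemma enorm_one_sq_le (hF : IsDampedHierarchy κ ε F) (hκ : 0 ≤ κ) (hε : 0 ≤ ε) (ξ : ℝ) :
    ‖F 1 ξ‖ₑ ^ 2 ≤ ENNReal.ofReal κ * ∫⁻ y in Ioi ξ, ‖F 0 y‖ₑ * ‖F 1 y‖ₑ := by
  rw [← lintegral_const_mul' _ _ ENNReal.ofReal_ne_top]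
  calc ‖F 1 ξ‖ₑ ^ 2 ≤ modeEnergy 0 fun ℓ => F ℓ ξ := by
        simpa [partialEnergy] using ofReal_partialEnergy_le 0 1 fun ℓ => F ℓ ξ
    _ ≤ _ := hF.modeEnergy_le_lintegral hκ hε 0 ξ
    _ = _ := by simp only [energySource, Nat.cast_zero, zero_mul, add_zero]

lemma enorm_one_le_tail (hF : IsDampedHierarchy κ ε F) (hκ : 0 ≤ κ) (hε : 0 ≤ ε) (ξ : ℝ) :
    ‖F 1 ξ‖ₑ ≤ ENNReal.ofReal κ * ∫⁻ y in Ioi ξ, ‖F 0 y‖ₑ := by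
  set T := ∫⁻ y in Ioi ξ, ‖F 0 y‖ₑ
  set M := ⨆ y ∈ Ici ξ, ‖F 1 y‖ₑ
  have hleM (y : ℝ) (hy : ξ ≤ y) : ‖F 1 y‖ₑ ≤ M := le_biSup (fun y => ‖F 1 y‖ₑ) hy
  have hMtop : M ≠ ⊤ := by
    obtain ⟨C, q, -, -, hbound⟩ := hF.geometric_decay
    refine ne_top_of_le_ne_top (ENNReal.ofReal_ne_top (r := C * q ^ 1)) (iSup₂_le fun y _ => ?_)
    rw [← ofReal_norm]
    exact ENNReal.ofReal_le_ofReal (hbound 1 y)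
  have hsq (y : ℝ) (hy : ξ ≤ y) : ‖F 1 y‖ₑ ^ 2 ≤ ENNReal.ofReal κ * (T * M) := by
    refine (hF.enorm_one_sq_le hκ hε y).trans (mul_le_mul_right ?_ _)
    rw [← lintegral_mul_const' _ _ hMtop]
    refine (lintegral_mono_set (Ioi_subset_Ioi hy)).trans (setLIntegral_mono' measurableSet_Ioi ?_)
    exact fun z hz => mul_le_mul_right (hleM z (mem_Ioi.mp hz).le) _
  have hMsq : M ^ 2 ≤ ENNReal.ofReal κ * (T * M) := by
    rw [ENNReal.iSup₂_pow_of_ne_zero _ two_ne_zero]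
    exact iSup₂_le hsq
  refine (hleM ξ le_rfl).trans ?_
  rcases eq_or_ne M 0 with hM | hM
  · exact hM.trans_le zero_le
  · rwa [sq, ← mul_assoc, ENNReal.mul_le_mul_iff_left hM hMtop] at hMsq

lemma modeEnergy_le_tail (hF : IsDampedHierarchy κ ε F) (hκ : 0 ≤ κ) (hε : 0 ≤ ε) (n : ℕ)
    (ξ : ℝ) :
    modeEnergy n (fun ℓ => F ℓ ξ) ≤ ENNReal.ofReal κ ^ 2 * (∫⁻ y in Ioi ξ, ‖F 0 y‖ₑ) ^ 2
      + ENNReal.ofReal κ * (n * 2 ^ (n - 1))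
        * ∫⁻ y in Ioi ξ, modeEnergy (n - 1) fun ℓ => F ℓ y := by
  set T := ∫⁻ y in Ioi ξ, ‖F 0 y‖ₑ
  have hforcing : ∫⁻ y in Ioi ξ, ‖F 0 y‖ₑ * ‖F 1 y‖ₑ ≤ T * (ENNReal.ofReal κ * T) := by
    rw [← lintegral_mul_const _ (hF.continuous 0).enorm.measurable]
    refine setLIntegral_mono' measurableSet_Ioi fun y hy => mul_le_mul_right ?_ _
    exact (hF.enorm_one_le_tail hκ hε y).trans
      (mul_le_mul_right (lintegral_mono_set (Ioi_subset_Ioi (mem_Ioi.mp hy).le)) _)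
  have hmeas : Measurable fun y => ‖F 0 y‖ₑ * ‖F 1 y‖ₑ :=
    (hF.continuous 0).enorm.measurable.mul (hF.continuous 1).enorm.measurable
  refine (hF.modeEnergy_le_lintegral hκ hε n ξ).trans ?_
  simp only [energySource]
  rw [lintegral_const_mul' _ _ ENNReal.ofReal_ne_top,
    lintegral_add_left hmeas,
    lintegral_const_mul' _ _ (by finiteness), mul_add, ← mul_assoc (ENNReal.ofReal κ) (_ * _)]
  refine add_le_add_left ((mul_le_mul_right hforcing _).trans_eq ?_) _
  ring

end IsDampedHierarchy

/-! ### Hardy's inequality -/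

/-- The weight `(1 + ξ)^a` with values in `[0, ∞]`. -/
def wt (a ξ : ℝ) : ℝ≥0∞ :=
  ENNReal.ofReal ((1 + ξ) ^ a)

section Hardy

variable {a ξ : ℝ} {h : ℝ → ℝ≥0∞}

lemma measurable_wt (a : ℝ) : Measurable (wt a) := by unfold wt; fun_prop

lemma wt_zero (ξ : ℝ) : wt 0 ξ = 1 := by rw [wt, Real.rpow_zero, ENNReal.ofReal_one]

lemma wt_mul_wt (hξ : 0 < ξ) (a c : ℝ) : wt a ξ * wt c ξ = wt (a + c) ξ := by
  rw [wt, wt, wt, ← ENNReal.ofReal_mul (by positivity), ← Real.rpow_add (by positivity)]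

lemma wt_mono (hξ : 0 < ξ) {c : ℝ} (hac : a ≤ c) : wt a ξ ≤ wt c ξ :=
  ENNReal.ofReal_le_ofReal (Real.rpow_le_rpow_of_exponent_le (by linarith) hac)

lemma lintegral_wt_mono {c : ℝ} (hac : a ≤ c) (h : ℝ → ℝ≥0∞) :
    ∫⁻ ξ in Ioi 0, wt a ξ * h ξ ≤ ∫⁻ ξ in Ioi 0, wt c ξ * h ξ :=
  setLIntegral_mono' measurableSet_Ioi fun _ hξ => mul_le_mul_left (wt_mono hξ hac) _

lemma lintegral_wt_Ioo_le (ha : -1 < a) (hξ : 0 < ξ) :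
    ∫⁻ y in Ioo 0 ξ, wt a y ≤ ENNReal.ofReal (1 / (a + 1)) * wt (a + 1) ξ := by
  have ha1 : 0 < a + 1 := by linarith
  have hcont : ContinuousOn (fun y : ℝ => (1 + y) ^ a) (Icc 0 ξ) :=
    ContinuousOn.rpow_const (by fun_prop) fun y hy => Or.inl (by linarith [hy.1])
  have hnonneg : 0 ≤ᵐ[volume.restrict (Ioo 0 ξ)] fun y : ℝ => (1 + y) ^ a := by
    filter_upwards [ae_restrict_mem measurableSet_Ioo] with y hy
    exact Real.rpow_nonneg (by linarith [hy.1]) _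
  simp only [wt]
  rw [← ofReal_integral_eq_lintegral_ofReal (hcont.integrableOn_Icc.mono_set Ioo_subset_Icc_self)
    hnonneg, ← ENNReal.ofReal_mul (by positivity), ← integral_Ioc_eq_integral_Ioo,
    ← intervalIntegral.integral_of_le hξ.le,
    intervalIntegral.integral_comp_add_left (fun y : ℝ => y ^ a), integral_rpow (Or.inl ha),
    div_mul_eq_mul_div, one_mul]
  gcongr
  exact sub_le_self _ (by positivity)

lemma lintegral_wt_Ioi {s : ℝ} (hs : 1 < s) (hξ : 0 < ξ) :
    ∫⁻ y in Ioi ξ, wt (-s) y = ENNReal.ofReal (1 / (s - 1)) * wt (1 - s) ξ := by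
  have hs1 : 0 < s - 1 := by linarith
  have htranslate : ∫⁻ y in Ioi ξ, wt (-s) y
      = ∫⁻ y in Ioi (1 + ξ), ENNReal.ofReal (y ^ (-s)) := by
    rw [← (measurePreserving_add_left volume (1 : ℝ)).setLIntegral_comp_preimage
      (s := Ioi (1 + ξ)) (f := fun y => ENNReal.ofReal (y ^ (-s))) measurableSet_Ioi (by fun_prop),
      preimage_const_add_Ioi, add_sub_cancel_left]
    rfl
  have hnonneg : 0 ≤ᵐ[volume.restrict (Ioi (1 + ξ))] fun y : ℝ => y ^ (-s) := by
    filter_upwards [ae_restrict_mem measurableSet_Ioi] with y hy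
    exact Real.rpow_nonneg (by linarith [mem_Ioi.mp hy]) _
  rw [htranslate, ← ofReal_integral_eq_lintegral_ofReal
    (integrableOn_Ioi_rpow_of_lt (by linarith) (by linarith)) hnonneg,
    integral_Ioi_rpow_of_lt (by linarith) (by linarith), wt,
    ← ENNReal.ofReal_mul (one_div_nonneg.mpr hs1.le),
    neg_add_eq_sub, ← neg_sub s 1, div_neg, neg_div, neg_neg, div_mul_eq_mul_div, one_mul]

lemma lintegral_wt_mul_tail_le (ha : -1 < a) (hh : Measurable h) :
    ∫⁻ ξ in Ioi 0, wt a ξ * ∫⁻ y in Ioi ξ, h y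
      ≤ ENNReal.ofReal (1 / (a + 1)) * ∫⁻ y in Ioi 0, wt (a + 1) y * h y := by
  set Φ : ℝ → ℝ → ℝ≥0∞ := fun ξ y => (Ioi ξ).indicator (fun y => wt a ξ * h y) y
  have hΦ : Measurable (Function.uncurry Φ) := (((measurable_wt a).comp measurable_fst).mul
    (hh.comp measurable_snd)).indicator (measurableSet_lt measurable_fst measurable_snd)
  have hrow (ξ : ℝ) (hξ : ξ ∈ Ioi (0 : ℝ)) :
      wt a ξ * ∫⁻ y in Ioi ξ, h y = ∫⁻ y in Ioi 0, Φ ξ y := by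
    rw [setLIntegral_indicator measurableSet_Ioi,
      inter_eq_self_of_subset_left (Ioi_subset_Ioi (mem_Ioi.mp hξ).le), lintegral_const_mul _ hh]
  have hcolumn (y : ℝ) : ∫⁻ ξ in Ioi 0, Φ ξ y = (∫⁻ ξ in Ioo 0 y, wt a ξ) * h y := by
    have hslice : (fun ξ => Φ ξ y) = (Iio y).indicator fun ξ => wt a ξ * h y := by
      ext ξ; simp only [Φ, indicator, mem_Ioi, mem_Iio]
    rw [hslice, setLIntegral_indicator measurableSet_Iio, Iio_inter_Ioi,
      lintegral_mul_const _ (measurable_wt a)]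
  rw [setLIntegral_congr_fun measurableSet_Ioi hrow, lintegral_lintegral_swap hΦ.aemeasurable,
    ← lintegral_const_mul' _ _ ENNReal.ofReal_ne_top]
  refine setLIntegral_mono' measurableSet_Ioi fun y hy => ?_
  rw [hcolumn, ← mul_assoc]
  exact mul_le_mul_left (lintegral_wt_Ioo_le ha hy) _

lemma sq_tail_le {s : ℝ} (hs : 1 < s) (hh : Measurable h) (hξ : 0 < ξ) :
    (∫⁻ y in Ioi ξ, h y) ^ 2
      ≤ ENNReal.ofReal (1 / (s - 1)) * (wt (1 - s) ξ * ∫⁻ y in Ioi ξ, wt s y * h y ^ 2) := by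
  have hcauchySchwarz := ENNReal.lintegral_mul_le_Lp_mul_Lq (volume.restrict (Ioi ξ))
    Real.HolderConjugate.two_two (f := fun y => wt (s / 2) y * h y) (g := wt (-s / 2))
    ((measurable_wt _).mul hh).aemeasurable (measurable_wt _).aemeasurable
  have hprod : ∫⁻ y in Ioi ξ, ((fun y => wt (s / 2) y * h y) * wt (-s / 2)) y
      = ∫⁻ y in Ioi ξ, h y := by
    refine setLIntegral_congr_fun measurableSet_Ioi fun y hy => ?_
    rw [Pi.mul_apply, mul_right_comm, wt_mul_wt (hξ.trans hy), neg_div, add_neg_cancel, wt_zero,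
      one_mul]
  have hleft : ∫⁻ y in Ioi ξ, (wt (s / 2) y * h y) ^ (2 : ℝ)
      = ∫⁻ y in Ioi ξ, wt s y * h y ^ 2 := by
    refine setLIntegral_congr_fun measurableSet_Ioi fun y hy => ?_
    rw [ENNReal.rpow_two, mul_pow, sq (wt _ _), wt_mul_wt (hξ.trans hy), add_halves]
  have hright : ∫⁻ y in Ioi ξ, wt (-s / 2) y ^ (2 : ℝ)
      = ENNReal.ofReal (1 / (s - 1)) * wt (1 - s) ξ := by
    rw [← lintegral_wt_Ioi hs hξ]
    refine setLIntegral_congr_fun measurableSet_Ioi fun y hy => ?_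
    rw [ENNReal.rpow_two, sq (wt _ _), wt_mul_wt (hξ.trans hy), add_halves]
  rw [hprod, hleft, hright, ← ENNReal.mul_rpow_of_nonneg _ _ (by norm_num), one_div 2,
    ENNReal.le_rpow_inv_iff two_pos, ENNReal.rpow_two] at hcauchySchwarz
  refine hcauchySchwarz.trans_eq ?_
  ring

lemma hardy_tail_le (ha : -1 < a) (hh : Measurable h) :
    ∫⁻ ξ in Ioi 0, wt a ξ * (∫⁻ y in Ioi ξ, h y) ^ 2
      ≤ ENNReal.ofReal (2 / (a + 1)) ^ 2 * ∫⁻ y in Ioi 0, wt (a + 2) y * h y ^ 2 := by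
  -- Any exponent `1 < s < a + 2` works in the Cauchy–Schwarz step; the midpoint is the simplest.
  obtain ⟨s, hs⟩ : ∃ s, s = (a + 3) / 2 := ⟨_, rfl⟩
  set c := ENNReal.ofReal (2 / (a + 1))
  have hcs : ENNReal.ofReal (1 / (s - 1)) = c := by
    congr 1; rw [hs]; field_simp; ring
  have hpointwise (ξ : ℝ) (hξ : ξ ∈ Ioi (0 : ℝ)) : wt a ξ * (∫⁻ y in Ioi ξ, h y) ^ 2
      ≤ c * (wt (a + 1 - s) ξ * ∫⁻ y in Ioi ξ, wt s y * h y ^ 2) := by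
    rw [← hcs]
    refine (mul_le_mul_right (sq_tail_le (by linarith) hh hξ) _).trans_eq ?_
    rw [mul_left_comm, ← mul_assoc (wt a ξ), wt_mul_wt hξ, add_sub_assoc]
  calc ∫⁻ ξ in Ioi 0, wt a ξ * (∫⁻ y in Ioi ξ, h y) ^ 2
      ≤ ∫⁻ ξ in Ioi 0, c * (wt (a + 1 - s) ξ * ∫⁻ y in Ioi ξ, wt s y * h y ^ 2) :=
        setLIntegral_mono' measurableSet_Ioi hpointwise
    _ = c * ∫⁻ ξ in Ioi 0, wt (a + 1 - s) ξ * ∫⁻ y in Ioi ξ, wt s y * h y ^ 2 :=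
        lintegral_const_mul' _ _ ENNReal.ofReal_ne_top
    _ ≤ c * (ENNReal.ofReal (1 / (a + 1 - s + 1))
          * ∫⁻ y in Ioi 0, wt (a + 1 - s + 1) y * (wt s y * h y ^ 2)) := by
        gcongr
        exact lintegral_wt_mul_tail_le (by linarith) ((measurable_wt s).mul (hh.pow_const 2))
    _ = c ^ 2 * ∫⁻ y in Ioi 0, wt (a + 2) y * h y ^ 2 := by
        rw [show a + 1 - s + 1 = s - 1 by rw [hs]; ring, hcs, ← mul_assoc, ← sq]
        congr 1
        refine setLIntegral_congr_fun measurableSet_Ioi fun y hy => ?_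
        rw [← mul_assoc, wt_mul_wt hy, hs]
        ring_nf

end Hardy

namespace IsDampedHierarchy

variable {κ ε : ℝ} {F : ℕ → ℝ → ℂ}

lemma measurable_modeEnergy (hF : IsDampedHierarchy κ ε F) (n : ℕ) :
    Measurable fun ξ => modeEnergy n fun ℓ => F ℓ ξ :=
  measurable_weightedSum fun ℓ => (hF.continuous ℓ).enorm.measurable.pow_const 2

lemma lintegral_wt_mul_modeEnergy_le (hF : IsDampedHierarchy κ ε F) (hκ : 0 ≤ κ) (hε : 0 ≤ ε)
    {a : ℝ} (ha : -1 < a) (n : ℕ) :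
    ∫⁻ ξ in Ioi 0, wt a ξ * modeEnergy n (fun ℓ => F ℓ ξ)
      ≤ ENNReal.ofReal κ ^ 2 * ENNReal.ofReal (2 / (a + 1)) ^ 2
          * (∫⁻ y in Ioi 0, wt (a + 2) y * ‖F 0 y‖ₑ ^ 2)
        + ENNReal.ofReal κ * (n * 2 ^ (n - 1)) * ENNReal.ofReal (1 / (a + 1))
          * ∫⁻ y in Ioi 0, wt (a + 1) y * modeEnergy (n - 1) fun ℓ => F ℓ y := by
  have hF0 : Measurable fun y => ‖F 0 y‖ₑ := (hF.continuous 0).enorm.measurable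
  have htail : Measurable fun ξ => wt a ξ * (∫⁻ y in Ioi ξ, ‖F 0 y‖ₑ) ^ 2 :=
    (measurable_wt a).mul (Antitone.measurable (fun _ _ hξ =>
      lintegral_mono_set (Ioi_subset_Ioi hξ)) |>.pow_const 2)
  calc ∫⁻ ξ in Ioi 0, wt a ξ * modeEnergy n (fun ℓ => F ℓ ξ)
      ≤ ∫⁻ ξ in Ioi 0, (ENNReal.ofReal κ ^ 2 * (wt a ξ * (∫⁻ y in Ioi ξ, ‖F 0 y‖ₑ) ^ 2)
          + ENNReal.ofReal κ * (n * 2 ^ (n - 1))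
            * (wt a ξ * ∫⁻ y in Ioi ξ, modeEnergy (n - 1) fun ℓ => F ℓ y)) := by
        refine lintegral_mono fun ξ =>
          (mul_le_mul_right (hF.modeEnergy_le_tail hκ hε n ξ) _).trans_eq ?_
        ring
    _ = ENNReal.ofReal κ ^ 2 * (∫⁻ ξ in Ioi 0, wt a ξ * (∫⁻ y in Ioi ξ, ‖F 0 y‖ₑ) ^ 2)
          + ENNReal.ofReal κ * (n * 2 ^ (n - 1))
            * ∫⁻ ξ in Ioi 0, wt a ξ * ∫⁻ y in Ioi ξ, modeEnergy (n - 1) fun ℓ => F ℓ y := by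
        rw [lintegral_add_left (htail.const_mul _), lintegral_const_mul' _ _ (by finiteness),
          lintegral_const_mul' _ _ (by finiteness)]
    _ ≤ _ := by
        rw [mul_assoc (_ ^ 2), mul_assoc (_ * (_ * _))]
        gcongr
        · exact hardy_tail_le ha hF0
        · exact lintegral_wt_mul_tail_le ha (hF.measurable_modeEnergy _)

lemma exists_lintegral_modeEnergy_le (hκ : 0 ≤ κ) (n : ℕ) : ∀ a : ℝ, -1 < a →
    ∃ C : ℝ≥0∞, C ≠ ⊤ ∧ ∀ (ε : ℝ) (F : ℕ → ℝ → ℂ), 0 ≤ ε → IsDampedHierarchy κ ε F →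
      ∫⁻ ξ in Ioi 0, wt a ξ * modeEnergy n (fun ℓ => F ℓ ξ)
        ≤ C * ∫⁻ y in Ioi 0, wt (a + n + 2) y * ‖F 0 y‖ₑ ^ 2 := by
  induction n with
  | zero =>
    refine fun a ha => ⟨ENNReal.ofReal κ ^ 2 * ENNReal.ofReal (2 / (a + 1)) ^ 2, by finiteness,
      fun ε F hε hF => (hF.lintegral_wt_mul_modeEnergy_le hκ hε ha 0).trans_eq ?_⟩
    simp only [Nat.cast_zero, zero_mul, mul_zero, add_zero]
  | succ n ih =>
    intro a ha
    obtain ⟨C, hC, hle⟩ := ih (a + 1) (by linarith)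
    refine ⟨ENNReal.ofReal κ ^ 2 * ENNReal.ofReal (2 / (a + 1)) ^ 2
      + ENNReal.ofReal κ * ((n + 1 : ℕ) * 2 ^ n) * ENNReal.ofReal (1 / (a + 1)) * C,
      by finiteness, fun ε F hε hF => (hF.lintegral_wt_mul_modeEnergy_le hκ hε ha _).trans ?_⟩
    have hlower := hle ε F hε hF
    rw [show a + 1 + n + 2 = a + (n + 1 : ℕ) + 2 by push_cast; ring] at hlower
    rw [add_mul, mul_assoc _ C, Nat.add_sub_cancel]
    refine add_le_add (mul_le_mul_right (lintegral_wt_mono ?_ _) _) (mul_le_mul_right hlower _)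
    linarith [(n + 1).cast_nonneg (α := ℝ)]

end IsDampedHierarchy

lemma modeEnergy_le_liminf {ι : Type*} {l : Filter ι} [l.NeBot] {x : ι → ℕ → ℂ} {y : ℕ → ℂ}
    (h : ∀ ℓ, Tendsto (fun i => x i ℓ) l (𝓝 (y ℓ))) (n : ℕ) :
    modeEnergy n y ≤ liminf (fun i => modeEnergy n (x i)) l := by
  refine modeEnergy_le_of_tendsto tendsto_const_nhds fun N => ?_
  have hpartial : Tendsto (fun i => ENNReal.ofReal (partialEnergy n (N + 1) (x i))) l
      (𝓝 (ENNReal.ofReal (partialEnergy n (N + 1) y))) :=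
    ENNReal.tendsto_ofReal
      (tendsto_finsetSum _ fun j _ => ((h (j + 1)).norm.pow 2).const_mul _)
  rw [← hpartial.liminf_eq]
  exact liminf_le_liminf (.of_forall fun i => ofReal_partialEnergy_le _ _ _)

lemma exists_lintegral_modeEnergy_fHat_le {κ : ℝ} (hκ : 0 ≤ κ) (n : ℕ) {a : ℝ} (ha : -1 < a) :
    ∃ C : ℝ≥0∞, C ≠ ⊤ ∧ ∀ g : ℝ → ℝ, Integrable g →
      ∫⁻ ξ in Ioi 0, wt a ξ * modeEnergy n (fun ℓ => fHat κ g ℓ ξ)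
        ≤ C * ∫⁻ y in Ioi 0, wt (a + n + 2) y * ‖gHat g y‖ₑ ^ 2 := by
  obtain ⟨C, hC, hle⟩ := IsDampedHierarchy.exists_lintegral_modeEnergy_le hκ n a ha
  refine ⟨C, hC, fun g hg => ?_⟩
  set ε : ℕ → ℝ := fun j => 1 / (j + 1)
  set F : ℕ → ℕ → ℝ → ℂ := fun j => mode (fun ω => dampedRoot κ (ε j + Complex.I * ω)) g
  have hε (j : ℕ) : 0 < ε j := by positivity
  have hF (j : ℕ) : IsDampedHierarchy κ (ε j) (F j) := isDampedHierarchy_dampedRoot hκ (hε j) hg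
  have hlim (ξ : ℝ) (ℓ : ℕ) : Tendsto (fun j => F j ℓ ξ) atTop (𝓝 (fHat κ g ℓ ξ)) :=
    (tendsto_mode_dampedRoot hκ hg ℓ ξ).comp
      (tendsto_nhdsWithin_iff.mpr ⟨tendsto_one_div_add_atTop_nhds_zero_nat, .of_forall hε⟩)
  calc ∫⁻ ξ in Ioi 0, wt a ξ * modeEnergy n (fun ℓ => fHat κ g ℓ ξ)
      ≤ ∫⁻ ξ in Ioi 0, liminf (fun j => wt a ξ * modeEnergy n fun ℓ => F j ℓ ξ) atTop := by
        refine lintegral_mono fun ξ => ?_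
        rw [ENNReal.liminf_const_mul_of_ne_top (show wt a ξ ≠ ⊤ from ENNReal.ofReal_ne_top)]
        exact mul_le_mul_right (modeEnergy_le_liminf (hlim ξ) n) _
    _ ≤ liminf (fun j => ∫⁻ ξ in Ioi 0, wt a ξ * modeEnergy n fun ℓ => F j ℓ ξ) atTop :=
        lintegral_liminf_le fun j => (measurable_wt a).mul ((hF j).measurable_modeEnergy n)
    _ ≤ C * ∫⁻ y in Ioi 0, wt (a + n + 2) y * ‖gHat g y‖ₑ ^ 2 := by
        refine liminf_le_of_frequently_le' (Frequently.of_forall fun j => ?_)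
        simpa only [F, mode_zero] using hle (ε j) (F j) (hε j).le (hF j)

/-! ### Weak derivatives and the norms -/

lemma integrableOn_mul_of_compactSupport {v : ℝ → ℂ} (hv : LocallyIntegrableOn v (Ioi 0))
    {ψ : ℝ → ℝ} (hψ : Continuous ψ) (hc : HasCompactSupport ψ) (hs : tsupport ψ ⊆ Ioi 0) :
    IntegrableOn (fun ξ => v ξ * ((ψ ξ : ℝ) : ℂ)) (Ioi 0) := by
  have hprod : IntegrableOn (fun ξ => v ξ * ((ψ ξ : ℝ) : ℂ)) (tsupport ψ) :=
    (hv.integrableOn_compact_subset hs hc).mul_continuousOn (by fun_prop) hc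
  refine (hprod.integrable_of_forall_notMem_eq_zero fun ξ hξ => ?_).integrableOn
  rw [image_eq_zero_of_notMem_tsupport hξ, Complex.ofReal_zero, mul_zero]

/-- The pairing `∫ v φ` of a function with a test function. It is taken over all of `ℝ`, so that
translations act on it; test functions are supported in `(0, ∞)`. -/
def pair (v : ℝ → ℂ) (φ : ℝ → ℝ) : ℂ := ∫ ξ, v ξ * ((φ ξ : ℝ) : ℂ)

namespace IsTest

variable {φ : ℝ → ℝ}

lemma continuous (hφ : IsTest φ) : Continuous φ := hφ.1.continuous

lemma deriv (hφ : IsTest φ) : IsTest (deriv φ) :=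
  ⟨ContDiff.iterate_deriv 1 hφ.1, hφ.2.1.deriv, tsupport_deriv_subset.trans hφ.2.2⟩

lemma differentiable (hφ : IsTest φ) : Differentiable ℝ φ := hφ.1.differentiable (by simp)

lemma integrableOn_mul (hφ : IsTest φ) {v : ℝ → ℂ} (hv : LocallyIntegrableOn v (Ioi 0)) :
    IntegrableOn (fun ξ => v ξ * ((φ ξ : ℝ) : ℂ)) (Ioi 0) :=
  integrableOn_mul_of_compactSupport hv hφ.continuous hφ.2.1 hφ.2.2

lemma integrable_mul (hφ : IsTest φ) {v : ℝ → ℂ} (hv : Continuous v) :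
    Integrable fun ξ => v ξ * ((φ ξ : ℝ) : ℂ) := by
  have hφc := hφ.continuous
  exact Continuous.integrable_of_hasCompactSupport (by fun_prop)
    (hφ.2.1.comp_left (g := fun x : ℝ => (x : ℂ)) Complex.ofReal_zero).mul_left

lemma setIntegral_eq_pair (hφ : IsTest φ) (v : ℝ → ℂ) :
    ∫ ξ in Ioi (0 : ℝ), v ξ * ((φ ξ : ℝ) : ℂ) = pair v φ := by
  refine setIntegral_eq_integral_of_forall_compl_eq_zero fun ξ hξ => ?_
  rw [image_eq_zero_of_notMem_tsupport fun h => hξ (hφ.2.2 h), Complex.ofReal_zero, mul_zero]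

end IsTest

lemma isWeakDeriv_of_hasDerivAt {v w : ℝ → ℂ} (hd : ∀ ξ, HasDerivAt v (w ξ) ξ)
    (hw : Continuous w) : IsWeakDeriv v w := by
  have hv : Continuous v := continuous_iff_continuousAt.mpr fun ξ => (hd ξ).continuousAt
  refine ⟨hv.locallyIntegrable.locallyIntegrableOn _, hw.locallyIntegrable.locallyIntegrableOn _,
    fun φ hφ => ?_⟩
  rw [hφ.deriv.setIntegral_eq_pair, hφ.setIntegral_eq_pair]
  exact integral_mul_deriv_eq_deriv_mul_of_integrable (fun ξ _ => hd ξ)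
    (fun ξ _ => (hφ.differentiable ξ).hasDerivAt.ofReal_comp)
    (hφ.deriv.integrable_mul hv) (hφ.integrable_mul hw) (hφ.integrable_mul hv)

namespace IsWeakDeriv

variable {v w v' w' : ℝ → ℂ}

lemma const_mul (h : IsWeakDeriv v w) (c : ℂ) :
    IsWeakDeriv (fun ξ => c * v ξ) (fun ξ => c * w ξ) := by
  refine ⟨h.1.smul c, h.2.1.smul c, fun φ hφ => ?_⟩
  simp only [mul_assoc]
  rw [integral_const_mul, integral_const_mul, h.2.2 φ hφ, mul_neg]

lemma add (h : IsWeakDeriv v w) (h' : IsWeakDeriv v' w') :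
    IsWeakDeriv (fun ξ => v ξ + v' ξ) (fun ξ => w ξ + w' ξ) := by
  refine ⟨h.1.add h'.1, h.2.1.add h'.2.1, fun φ hφ => ?_⟩
  simp only [add_mul]
  rw [integral_add (hφ.deriv.integrableOn_mul h.1) (hφ.deriv.integrableOn_mul h'.1),
    integral_add (hφ.integrableOn_mul h.2.1) (hφ.integrableOn_mul h'.2.1), h.2.2 φ hφ,
    h'.2.2 φ hφ, neg_add]

end IsWeakDeriv

lemma enorm_add_sq_le (x y : ℂ) : ‖x + y‖ₑ ^ 2 ≤ 2 * (‖x‖ₑ ^ 2 + ‖y‖ₑ ^ 2) := by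
  have h := ENNReal.rpow_add_le_mul_rpow_add_rpow ‖x‖ₑ ‖y‖ₑ (one_le_two (α := ℝ))
  norm_num only [ENNReal.rpow_two, ENNReal.rpow_one] at h
  exact (pow_le_pow_left' (enorm_add_le x y) 2).trans h

lemma ofReal_sobolev_integrand (x y : ℂ) (s : ℝ) :
    ENNReal.ofReal ((‖x‖ ^ 2 + ‖y‖ ^ 2) * s ^ 2)
      = ENNReal.ofReal (s ^ 2) * (‖x‖ₑ ^ 2 + ‖y‖ₑ ^ 2) := by
  rw [mul_comm, ENNReal.ofReal_mul (by positivity), ENNReal.ofReal_add (by positivity)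
    (by positivity), ENNReal.ofReal_pow (norm_nonneg _), ENNReal.ofReal_pow (norm_nonneg _),
    ofReal_norm, ofReal_norm]

lemma ofReal_p_sq {ξ : ℝ} (hξ : 0 < ξ) (b : ℝ) : ENNReal.ofReal (p b ξ ^ 2) = wt (2 * b) ξ := by
  rw [p, wt, ← Real.rpow_natCast, ← Real.rpow_mul (by linarith), mul_comm b, Nat.cast_ofNat]

lemma measurable_p (b : ℝ) : Measurable (p b) := by
  unfold p; fun_prop

section SobolevSq

variable {φ : ℝ → ℝ} {v w : ℝ → ℂ}

lemma sobolevSq_eq (φ : ℝ → ℝ) (v : ℝ → ℂ) : sobolevSq φ v = ⨅ (w) (_ : IsWeakDeriv v w),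
    ∫⁻ ξ in Ioi (0 : ℝ), ENNReal.ofReal (φ ξ ^ 2) * (‖v ξ‖ₑ ^ 2 + ‖w ξ‖ₑ ^ 2) := by
  simp only [sobolevSq, ofReal_sobolev_integrand]

lemma sobolevSq_le (h : IsWeakDeriv v w) (φ : ℝ → ℝ) :
    sobolevSq φ v ≤ ∫⁻ ξ in Ioi (0 : ℝ), ENNReal.ofReal (φ ξ ^ 2) * (‖v ξ‖ₑ ^ 2 + ‖w ξ‖ₑ ^ 2) := by
  rw [sobolevSq_eq]
  exact iInf₂_le w h

lemma sobolevSq_const_mul_le (φ : ℝ → ℝ) (c : ℂ) (v : ℝ → ℂ) :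
    sobolevSq φ (fun ξ => c * v ξ) ≤ ‖c‖ₑ ^ 2 * sobolevSq φ v := by
  rcases eq_or_ne c 0 with rfl | hc
  · have hzero : IsWeakDeriv (fun ξ => 0 * v ξ) (fun _ => 0) := by
      simpa only [zero_mul] using
        isWeakDeriv_of_hasDerivAt (fun ξ => hasDerivAt_const ξ (0 : ℂ)) continuous_const
    refine (sobolevSq_le hzero φ).trans ?_
    simp
  · have hc' : ‖c‖ₑ ^ 2 ≠ 0 := pow_ne_zero 2 (enorm_ne_zero.mpr hc)
    simp only [sobolevSq_eq φ v, ENNReal.mul_iInf_of_ne hc' (by finiteness)]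
    refine le_iInf₂ fun w hw => (sobolevSq_le (hw.const_mul c) φ).trans_eq ?_
    rw [← lintegral_const_mul' _ _ (by finiteness)]
    refine lintegral_congr fun ξ => ?_
    simp only [enorm_mul, mul_pow]
    ring

lemma sobolevSq_add_le (hφ : Measurable φ) (v w : ℝ → ℂ) :
    sobolevSq φ (fun ξ => v ξ + w ξ) ≤ 2 * (sobolevSq φ v + sobolevSq φ w) := by
  simp only [sobolevSq_eq φ v, sobolevSq_eq φ w, ENNReal.iInf_add, ENNReal.add_iInf,
    ENNReal.mul_iInf_of_ne two_ne_zero ENNReal.ofNat_ne_top]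
  refine le_iInf₂ fun w' hw => le_iInf₂ fun v' hv => ?_
  have hmeas : AEMeasurable (fun ξ => ENNReal.ofReal (φ ξ ^ 2) * (‖v ξ‖ₑ ^ 2 + ‖v' ξ‖ₑ ^ 2))
      (volume.restrict (Ioi 0)) :=
    (hφ.pow_const 2).ennreal_ofReal.aemeasurable.mul
      ((hv.1.aestronglyMeasurable.enorm.pow_const 2).add
        (hv.2.1.aestronglyMeasurable.enorm.pow_const 2))
  rw [← lintegral_add_left' hmeas, ← lintegral_const_mul' _ _ ENNReal.ofNat_ne_top]
  refine (sobolevSq_le (hv.add hw) φ).trans (lintegral_mono fun ξ => ?_)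
  calc ENNReal.ofReal (φ ξ ^ 2) * (‖v ξ + w ξ‖ₑ ^ 2 + ‖v' ξ + w' ξ‖ₑ ^ 2)
      ≤ ENNReal.ofReal (φ ξ ^ 2) * (2 * (‖v ξ‖ₑ ^ 2 + ‖w ξ‖ₑ ^ 2)
          + 2 * (‖v' ξ‖ₑ ^ 2 + ‖w' ξ‖ₑ ^ 2)) := by gcongr <;> exact enorm_add_sq_le _ _
    _ = _ := by ring

lemma lintegral_wt_mul_sq_le_sobolevSq (b : ℝ) (v : ℝ → ℂ) :
    ∫⁻ ξ in Ioi (0 : ℝ), wt (2 * b) ξ * ‖v ξ‖ₑ ^ 2 ≤ sobolevSq (p b) v := by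
  rw [sobolevSq_eq]
  refine le_iInf₂ fun w _ => setLIntegral_mono' measurableSet_Ioi fun ξ hξ => ?_
  rw [ofReal_p_sq hξ]
  gcongr
  exact le_self_add

lemma profileNorm_mono {b c : ℝ} (h : b ≤ c) (v : ℝ → ℂ) :
    profileNorm (p b) v ≤ profileNorm (p c) v := by
  refine ENNReal.rpow_le_rpow ?_ (by norm_num)
  simp only [sobolevSq_eq]
  refine iInf₂_mono fun w _ => setLIntegral_mono' measurableSet_Ioi fun ξ hξ => ?_
  rw [ofReal_p_sq hξ, ofReal_p_sq hξ]
  gcongr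
  exact wt_mono hξ (by linarith)

end SobolevSq

lemma sqrt_mul_sq (c x : ℝ≥0∞) : (c ^ 2 * x) ^ (1 / 2 : ℝ) = c * x ^ (1 / 2 : ℝ) := by
  rw [ENNReal.mul_rpow_of_nonneg _ _ (by norm_num), ← ENNReal.rpow_natCast, ← ENNReal.rpow_mul]
  norm_num

section ModeNorm

variable {φ : ℝ → ℝ} {k : ℝ}

lemma modeNorm_eq (φ : ℝ → ℝ) (k : ℝ) (u : ℕ → ℝ → ℂ) :
    modeNorm φ k u = weightedSum (2 * k) (fun ℓ => sobolevSq φ (u ℓ)) ^ (1 / 2 : ℝ) := rfl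

lemma modeNorm_const_mul_le (φ : ℝ → ℝ) (k : ℝ) (c : ℂ) (u : ℕ → ℝ → ℂ) :
    modeNorm φ k (fun ℓ ξ => c * u ℓ ξ) ≤ ‖c‖ₑ * modeNorm φ k u := by
  simp only [modeNorm_eq]
  rw [← sqrt_mul_sq, ← weightedSum_const_mul]
  gcongr
  exact weightedSum_mono fun ℓ => sobolevSq_const_mul_le φ c _

lemma modeNorm_natCast_mul_le (φ : ℝ → ℝ) (k : ℝ) (u : ℕ → ℝ → ℂ) :
    modeNorm φ k (fun ℓ ξ => ℓ * u ℓ ξ) ≤ modeNorm φ (k + 1) u := by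
  simp only [modeNorm_eq]
  rw [mul_add, mul_one, ← weightedSum_sq_mul]
  gcongr
  refine weightedSum_mono fun ℓ => (sobolevSq_const_mul_le φ _ _).trans_eq ?_
  rw [← ofReal_norm, Complex.norm_natCast, ENNReal.ofReal_natCast]

lemma modeNorm_add_le (hφ : Measurable φ) (k : ℝ) (u v : ℕ → ℝ → ℂ) :
    modeNorm φ k (fun ℓ ξ => u ℓ ξ + v ℓ ξ) ≤ 2 * (modeNorm φ k u + modeNorm φ k v) := by
  have hhalf : (0 : ℝ) ≤ 1 / 2 := by norm_num
  calc modeNorm φ k (fun ℓ ξ => u ℓ ξ + v ℓ ξ)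
      ≤ (2 ^ 2 * (weightedSum (2 * k) (fun ℓ => sobolevSq φ (u ℓ))
          + weightedSum (2 * k) (fun ℓ => sobolevSq φ (v ℓ)))) ^ (1 / 2 : ℝ) := by
        rw [modeNorm_eq, ← weightedSum_add, ← weightedSum_const_mul]
        gcongr
        refine weightedSum_mono fun ℓ => (sobolevSq_add_le hφ _ _).trans ?_
        gcongr
        norm_num
    _ ≤ 2 * (modeNorm φ k u + modeNorm φ k v) := by
        rw [sqrt_mul_sq]
        gcongr
        exact ENNReal.rpow_add_le_add_rpow _ _ hhalf (by norm_num)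

lemma modeNorm_succ_le (φ : ℝ → ℝ) (hk : 0 ≤ k) (u : ℕ → ℝ → ℂ) :
    modeNorm φ k (fun ℓ => u (ℓ + 1)) ≤ modeNorm φ k u :=
  ENNReal.rpow_le_rpow (weightedSum_succ_le (by positivity) fun ℓ => sobolevSq φ (u ℓ))
    (by norm_num)

lemma modeNorm_pred_le (φ : ℝ → ℝ) (hk : 0 ≤ k) (u : ℕ → ℝ → ℂ) :
    modeNorm φ k (fun ℓ => u (ℓ - 1))
      ≤ profileNorm φ (u 0) + ENNReal.ofReal (2 ^ k) * modeNorm φ k u := by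
  have hpow : ENNReal.ofReal (2 ^ (2 * k)) = ENNReal.ofReal (2 ^ k) ^ 2 := by
    rw [mul_comm, Real.rpow_mul zero_le_two, Real.rpow_two, ENNReal.ofReal_pow (by positivity)]
  calc modeNorm φ k (fun ℓ => u (ℓ - 1))
      ≤ (sobolevSq φ (u 0) + ENNReal.ofReal (2 ^ k) ^ 2
          * weightedSum (2 * k) fun ℓ => sobolevSq φ (u ℓ)) ^ (1 / 2 : ℝ) := by
        rw [modeNorm_eq, ← hpow]
        gcongr
        exact weightedSum_pred_le (by positivity) fun ℓ => sobolevSq φ (u ℓ)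
    _ ≤ _ := by
        rw [profileNorm, modeNorm_eq, ← sqrt_mul_sq]
        exact ENNReal.rpow_add_le_add_rpow _ _ (by norm_num) (by norm_num)

lemma modeNorm_neighbours_le (hφ : Measurable φ) (hk : -1 ≤ k) (c : ℂ) {s : ℂ} (hs : ‖s‖ = 1)
    (u : ℕ → ℝ → ℂ) :
    modeNorm φ k (fun ℓ ξ => c * (ℓ * (u (ℓ - 1) ξ + s * u (ℓ + 1) ξ)))
      ≤ ‖c‖ₑ * (2 * (profileNorm φ (u 0)
          + (ENNReal.ofReal (2 ^ (k + 1)) + 1) * modeNorm φ (k + 1) u)) := by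
  have hk' : 0 ≤ k + 1 := by linarith
  refine (modeNorm_const_mul_le φ k c _).trans ?_
  gcongr
  refine (modeNorm_natCast_mul_le φ k fun ℓ ξ => u (ℓ - 1) ξ + s * u (ℓ + 1) ξ).trans ?_
  refine (modeNorm_add_le hφ (k + 1) (fun ℓ => u (ℓ - 1)) fun ℓ ξ => s * u (ℓ + 1) ξ).trans ?_
  rw [add_mul, one_mul, ← add_assoc]
  gcongr
  · exact modeNorm_pred_le φ hk' u
  · refine (modeNorm_const_mul_le φ (k + 1) s fun ℓ => u (ℓ + 1)).trans ?_
    rw [← ofReal_norm, hs, ENNReal.ofReal_one, one_mul]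
    exact modeNorm_succ_le φ hk' u

end ModeNorm

/-! ### Norm bounds for the stationary state -/

section Stationary

variable {κ : ℝ} {g : ℝ → ℝ}

lemma continuous_fHat (hκ : 0 ≤ κ) (hg : Integrable g) (ℓ : ℕ) : Continuous (fHat κ g ℓ) := by
  rw [fHat_eq_mode hκ]; exact (isPhaseFactor_moment hκ).continuous_mode hg ℓ

lemma fHat_zero (hκ : 0 ≤ κ) (g : ℝ → ℝ) : fHat κ g 0 = gHat g := by
  rw [fHat_eq_mode hκ]; exact mode_zero _ g

lemma hasDerivAt_fHat (hκ : 0 ≤ κ) (hg : Integrable g) (ℓ : ℕ) (ξ : ℝ) :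
    HasDerivAt (fHat κ g (ℓ + 1)) ((κ : ℂ) / 2 * (fHat κ g (ℓ + 2) ξ - fHat κ g ℓ ξ)) ξ := by
  rw [fHat_eq_mode hκ]
  simpa using (isPhaseFactor_moment hκ).hasDerivAt_mode hg ℓ ξ

lemma isWeakDeriv_fHat_succ (hκ : 0 ≤ κ) (hg : Integrable g) (ℓ : ℕ) :
    IsWeakDeriv (fHat κ g (ℓ + 1))
      (fun ξ => (κ : ℂ) / 2 * (fHat κ g (ℓ + 2) ξ - fHat κ g ℓ ξ)) := by
  have hc := continuous_fHat hκ hg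
  exact isWeakDeriv_of_hasDerivAt (hasDerivAt_fHat hκ hg ℓ) (by fun_prop)

lemma sobolevSq_fHat_succ_le (hκ : 0 ≤ κ) (hg : Integrable g) (b : ℝ) (ℓ : ℕ) {s : ℕ → ℝ≥0∞}
    (hs : ∀ j, s j = ∫⁻ ξ in Ioi (0 : ℝ), wt (2 * b) ξ * ‖fHat κ g j ξ‖ₑ ^ 2) :
    sobolevSq (p b) (fHat κ g (ℓ + 1))
      ≤ s (ℓ + 1) + 2 * ‖(κ : ℂ) / 2‖ₑ ^ 2 * (s (ℓ + 2) + s ℓ) := by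
  set A : ℝ≥0∞ := 2 * ‖(κ : ℂ) / 2‖ₑ ^ 2
  have hmeas (j : ℕ) : Measurable fun ξ => wt (2 * b) ξ * ‖fHat κ g j ξ‖ₑ ^ 2 :=
    (measurable_wt _).mul ((continuous_fHat hκ hg j).enorm.measurable.pow_const 2)
  have hderiv (ξ : ℝ) : ‖(κ : ℂ) / 2 * (fHat κ g (ℓ + 2) ξ - fHat κ g ℓ ξ)‖ₑ ^ 2
      ≤ A * (‖fHat κ g (ℓ + 2) ξ‖ₑ ^ 2 + ‖fHat κ g ℓ ξ‖ₑ ^ 2) := by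
    rw [enorm_mul, mul_pow, sub_eq_add_neg, ← enorm_neg (fHat κ g ℓ ξ), mul_right_comm, mul_comm]
    gcongr
    exact enorm_add_sq_le _ _
  rw [hs, hs, hs, ← lintegral_add_left (hmeas _), ← lintegral_const_mul' _ _ (by finiteness),
    ← lintegral_add_left (hmeas _)]
  refine (sobolevSq_le (isWeakDeriv_fHat_succ hκ hg ℓ) (p b)).trans
    (setLIntegral_mono' measurableSet_Ioi fun ξ hξ => ?_)
  rw [ofReal_p_sq hξ]
  calc _ ≤ wt (2 * b) ξ * (‖fHat κ g (ℓ + 1) ξ‖ₑ ^ 2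
        + A * (‖fHat κ g (ℓ + 2) ξ‖ₑ ^ 2 + ‖fHat κ g ℓ ξ‖ₑ ^ 2)) := by gcongr; exact hderiv ξ
    _ = _ := by ring

lemma weightedSum_lintegral_eq {n : ℕ} {x : ℕ → ℝ → ℂ} (hx : ∀ ℓ, Continuous (x ℓ)) (a : ℝ) :
    weightedSum n (fun ℓ => ∫⁻ ξ in Ioi (0 : ℝ), wt a ξ * ‖x ℓ ξ‖ₑ ^ 2)
      = ∫⁻ ξ in Ioi (0 : ℝ), wt a ξ * modeEnergy n fun ℓ => x ℓ ξ := by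
  have hmeas (ℓ : ℕ) : Measurable fun ξ => wt a ξ * ‖x ℓ ξ‖ₑ ^ 2 :=
    (measurable_wt a).mul ((hx ℓ).enorm.measurable.pow_const 2)
  simp only [modeEnergy, ← weightedSum_const_mul]
  simp only [weightedSum]
  rw [lintegral_tsum fun ℓ => ((hmeas (ℓ + 1)).const_mul _).aemeasurable]
  exact tsum_congr fun ℓ => (lintegral_const_mul _ (hmeas (ℓ + 1))).symm

lemma exists_modeNorm_fHat_le (hκ : 0 ≤ κ) {n : ℕ} {k : ℝ} (hk : 2 * k = n) {b : ℝ}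
    (hb : -(1 / 2) < b) :
    ∃ C : ℝ≥0∞, C ≠ ⊤ ∧ ∀ g : ℝ → ℝ, Integrable g →
      modeNorm (p b) k (fHat κ g) ≤ C * profileNorm (p (b + k + 1)) (gHat g) := by
  obtain ⟨C, hC, henergy⟩ := exists_lintegral_modeEnergy_fHat_le hκ n (a := 2 * b) (by linarith)
  set A : ℝ≥0∞ := 2 * ‖(κ : ℂ) / 2‖ₑ ^ 2
  have hA : A ≠ ⊤ := by finiteness
  refine ⟨(C + A * (C + (1 + ENNReal.ofReal (2 ^ (n : ℝ)) * C))) ^ (1 / 2 : ℝ), by finiteness,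
    fun g hg => ?_⟩
  set s : ℕ → ℝ≥0∞ := fun ℓ => ∫⁻ ξ in Ioi (0 : ℝ), wt (2 * b) ξ * ‖fHat κ g ℓ ξ‖ₑ ^ 2
  set I : ℝ≥0∞ := ∫⁻ ξ in Ioi (0 : ℝ), wt (2 * b + n + 2) ξ * ‖gHat g ξ‖ₑ ^ 2
  have hn : (0 : ℝ) ≤ n := n.cast_nonneg
  have hs_zero : s 0 ≤ I := by
    simp only [s, fHat_zero hκ]
    exact lintegral_wt_mono (by linarith) _
  have hs_sum : weightedSum n s ≤ C * I :=
    (weightedSum_lintegral_eq (continuous_fHat hκ hg) _).trans_le (henergy g hg)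
  have hI : I ≤ sobolevSq (p (b + k + 1)) (gHat g) := by
    have := lintegral_wt_mul_sq_le_sobolevSq (b + k + 1) (gHat g)
    rwa [show 2 * (b + k + 1) = 2 * b + n + 2 by linarith] at this
  rw [modeNorm_eq, profileNorm, ← ENNReal.mul_rpow_of_nonneg _ _ (by norm_num), hk]
  gcongr
  calc weightedSum n (fun ℓ => sobolevSq (p b) (fHat κ g ℓ))
      ≤ weightedSum n fun ℓ => s ℓ + A * (s (ℓ + 1) + s (ℓ - 1)) :=
        weightedSum_mono fun ℓ => sobolevSq_fHat_succ_le hκ hg b ℓ fun _ => rfl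
    _ = weightedSum n s
          + A * (weightedSum n (fun ℓ => s (ℓ + 1)) + weightedSum n fun ℓ => s (ℓ - 1)) := by
        rw [weightedSum_add, weightedSum_const_mul, weightedSum_add]
    _ ≤ C * I + A * (C * I + (I + ENNReal.ofReal (2 ^ (n : ℝ)) * (C * I))) := by
        gcongr
        · exact (weightedSum_succ_le hn s).trans hs_sum
        · refine (weightedSum_pred_le hn s).trans ?_
          gcongr
    _ = (C + A * (C + (1 + ENNReal.ofReal (2 ^ (n : ℝ)) * C))) * I := by ring
    _ ≤ _ := by gcongr

lemma exists_modeNorm_neighbours_fHat_le (hκ : 0 ≤ κ) {n : ℕ} {k : ℝ} (hk : 2 * k = n) {b : ℝ}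
    (hb : -(1 / 2) < b) :
    ∃ C : ℝ≥0∞, C ≠ ⊤ ∧ ∀ g : ℝ → ℝ, Integrable g → ∀ c s : ℂ, ‖s‖ = 1 →
      modeNorm (p b) k (fun ℓ ξ => c * (ℓ * (fHat κ g (ℓ - 1) ξ + s * fHat κ g (ℓ + 1) ξ)))
        ≤ ‖c‖ₑ * (C * profileNorm (p (b + k + 2)) (gHat g)) := by
  have hk₁ : -1 ≤ k := by linarith [n.cast_nonneg (α := ℝ)]
  obtain ⟨C, hC, hle⟩ := exists_modeNorm_fHat_le hκ (n := n + 2) (k := k + 1)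
    (by push_cast; linarith) hb
  refine ⟨2 * (1 + (ENNReal.ofReal (2 ^ (k + 1)) + 1) * C), by finiteness,
    fun g hg c s hs => (modeNorm_neighbours_le (measurable_p b) hk₁ c hs _).trans ?_⟩
  have hfHat := hle g hg
  rw [show b + (k + 1) + 1 = b + k + 2 by ring] at hfHat
  calc _ ≤ ‖c‖ₑ * (2 * (profileNorm (p (b + k + 2)) (gHat g)
        + (ENNReal.ofReal (2 ^ (k + 1)) + 1) * (C * profileNorm (p (b + k + 2)) (gHat g)))) := by
        rw [fHat_zero hκ]
        gcongr
        exact profileNorm_mono (by linarith) _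
    _ = _ := by ring

lemma exists_modeNorm_rotMode_le (hκ : 0 ≤ κ) {n : ℕ} {k : ℝ} (hk : 2 * k = n) {b : ℝ}
    (hb : -(1 / 2) < b) :
    ∃ C : ℝ≥0∞, C ≠ ⊤ ∧ ∀ g : ℝ → ℝ, Integrable g →
      modeNorm (p b) k (rotMode κ g) ≤ C * profileNorm (p (b + k + 2)) (gHat g) := by
  obtain ⟨C, hC, hle⟩ := exists_modeNorm_fHat_le hκ (n := n + 2) (k := k + 1)
    (by push_cast; linarith) hb
  refine ⟨C, hC, fun g hg => ?_⟩
  have hfHat := hle g hg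
  rw [show b + (k + 1) + 1 = b + k + 2 by ring] at hfHat
  calc modeNorm (p b) k (rotMode κ g)
      = modeNorm (p b) k fun ℓ ξ => Complex.I * (ℓ * fHat κ g ℓ ξ) := by
        simp only [← mul_assoc]; rfl
    _ ≤ ‖Complex.I‖ₑ * modeNorm (p b) (k + 1) (fHat κ g) :=
        (modeNorm_const_mul_le _ _ _ _).trans
          (mul_le_mul_right (modeNorm_natCast_mul_le _ _ _) _)
    _ ≤ _ := by
        rwa [← ofReal_norm, Complex.norm_I, ENNReal.ofReal_one, one_mul]

end Stationary

/-! ### Uniqueness of the evolution -/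

/-- A mild solution, with zero initial data and vanishing zeroth mode, of the transport hierarchy
`∂_t G_ℓ = ℓ ∂_a G_ℓ + (κℓ/2) (G_{ℓ-1} - G_{ℓ+1})` on the quadrant `t, a ≥ 0`: Duhamel's formula
along the characteristics `s ↦ a + ℓ (t - s)`, which never leave the quadrant. -/
structure IsMildSolution (κ : ℝ) (G : ℕ → ℝ → ℝ → ℂ) : Prop where
  continuous : ∀ ℓ, Continuous (Function.uncurry (G ℓ))
  zero_mode : ∀ t a, G 0 t a = 0
  duhamel : ∀ (ℓ : ℕ) (t a : ℝ), 0 ≤ t → 0 ≤ a → G (ℓ + 1) t a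
    = ∫ s in (0 : ℝ)..t, (κ : ℂ) * ((ℓ + 1 : ℕ) : ℂ) / 2
        * (G ℓ s (a + (ℓ + 1 : ℕ) * (t - s)) - G (ℓ + 2) s (a + (ℓ + 1 : ℕ) * (t - s)))
  bounded : ∀ T : ℝ, ∃ M : ℝ, 0 ≤ M ∧ ∀ (ℓ : ℕ) (t a : ℝ), 0 ≤ t → t ≤ T → 0 ≤ a →
    ‖G ℓ t a‖ ≤ M * ℓ

lemma norm_neighbour_difference_le {κ B : ℝ} (hκ : 0 ≤ κ) (m : ℕ) {x y : ℂ}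
    (hx : ‖x‖ ≤ B) (hy : ‖y‖ ≤ B) : ‖(κ : ℂ) * (m : ℂ) / 2 * (x - y)‖ ≤ κ * m * B := by
  rw [norm_mul, norm_div, norm_mul, Complex.norm_of_nonneg hκ, Complex.norm_natCast,
    Complex.norm_two]
  calc κ * m / 2 * ‖x - y‖ ≤ κ * m / 2 * (B + B) := by
        gcongr
        exact norm_sub_le_of_le hx hy
    _ = κ * m * B := by ring

lemma choose_succ_mul_succ (ℓ n : ℕ) :
    ((ℓ + 1 + (n + 1)).choose (n + 1) : ℝ) * (n + 1) = ((ℓ + 2 + n).choose n : ℝ) * (ℓ + 2) := by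
  have h := Nat.choose_succ_right_eq (ℓ + 2 + n) n
  rw [Nat.add_sub_cancel] at h
  rw [show ℓ + 1 + (n + 1) = ℓ + 2 + n by ring]
  exact_mod_cast h

lemma tendsto_pow_mul_choose_zero {x : ℝ} (hx : ‖x‖ < 1) (ℓ : ℕ) :
    Tendsto (fun n : ℕ => x ^ n * ((ℓ + n).choose n : ℝ)) atTop (𝓝 0) := by
  refine (summable_choose_mul_geometric_of_norm_lt_one ℓ hx).tendsto_atTop_zero.congr fun n => ?_
  rw [mul_comm, add_comm, Nat.choose_symm_add]

namespace IsMildSolution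

variable {κ : ℝ} {G : ℕ → ℝ → ℝ → ℂ}

lemma continuous_comp (hG : IsMildSolution κ G) (ℓ : ℕ) {γ : ℝ → ℝ} (hγ : Continuous γ) :
    Continuous fun s => G ℓ s (γ s) :=
  (hG.continuous ℓ).comp (continuous_id.prodMk hγ)

lemma continuous_source (hG : IsMildSolution κ G) (ℓ : ℕ) (t a : ℝ) :
    Continuous fun s => (κ : ℂ) * ((ℓ + 1 : ℕ) : ℂ) / 2
      * (G ℓ s (a + (ℓ + 1 : ℕ) * (t - s)) - G (ℓ + 2) s (a + (ℓ + 1 : ℕ) * (t - s))) :=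
  continuous_const.mul
    ((hG.continuous_comp ℓ (by fun_prop)).sub (hG.continuous_comp (ℓ + 2) (by fun_prop)))

-- The binomial coefficient absorbs the growth `ℓ (ℓ + 1) ⋯ (ℓ + n)` of the coefficients met by
-- `n` Duhamel iterations; together with `1 / n!` it grows only polynomially in `n`.
lemma norm_le_iterate (hG : IsMildSolution κ G) (hκ : 0 ≤ κ) {T M : ℝ} (hM : 0 ≤ M)
    (hb : ∀ (ℓ : ℕ) (t a : ℝ), 0 ≤ t → t ≤ T → 0 ≤ a → ‖G ℓ t a‖ ≤ M * ℓ) (n : ℕ) :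
    ∀ (ℓ : ℕ) (t a : ℝ), 0 ≤ t → t ≤ T → 0 ≤ a →
      ‖G ℓ t a‖ ≤ M * ℓ * ((κ * t) ^ n * ((ℓ + n).choose n : ℝ)) := by
  induction n with
  | zero => simpa using hb
  | succ n ih =>
    rintro (_ | ℓ) t a ht hT ha
    · simp [hG.zero_mode]
    set B : ℝ := M * (ℓ + 2 : ℕ) * ((ℓ + 2 + n).choose n : ℝ) with hB
    have hsource : ∀ s ∈ Ioc 0 t, ‖(κ : ℂ) * ((ℓ + 1 : ℕ) : ℂ) / 2
        * (G ℓ s (a + (ℓ + 1 : ℕ) * (t - s)) - G (ℓ + 2) s (a + (ℓ + 1 : ℕ) * (t - s)))‖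
        ≤ κ * (ℓ + 1 : ℕ) * (B * (κ * s) ^ n) := by
      intro s hs
      have hs0 : 0 ≤ s := hs.1.le
      have hγ : 0 ≤ a + (ℓ + 1 : ℕ) * (t - s) :=
        add_nonneg ha (mul_nonneg (Nat.cast_nonneg _) (sub_nonneg.mpr hs.2))
      refine norm_neighbour_difference_le hκ _ ((ih ℓ s _ hs0 (hs.2.trans hT) hγ).trans ?_)
        ((ih (ℓ + 2) s _ hs0 (hs.2.trans hT) hγ).trans_eq (by ring))
      calc M * ℓ * ((κ * s) ^ n * ((ℓ + n).choose n : ℝ))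
          ≤ M * (ℓ + 2 : ℕ) * ((κ * s) ^ n * ((ℓ + 2 + n).choose n : ℝ)) := by
            have hchoose := Nat.choose_le_choose n (show ℓ + n ≤ ℓ + 2 + n by omega)
            gcongr
            omega
        _ = B * (κ * s) ^ n := by ring
    rw [hG.duhamel ℓ t a ht ha]
    refine (intervalIntegral.norm_integral_le_of_norm_le ht (ae_of_all _ hsource)
      (Continuous.intervalIntegrable (by fun_prop) _ _)).trans_eq ?_
    simp only [mul_pow, intervalIntegral.integral_const_mul, integral_pow]
    rw [hB, eq_div_of_mul_eq (by positivity) (choose_succ_mul_succ ℓ n)]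
    push_cast
    ring

lemma eq_zero_of_mul_lt_one (hG : IsMildSolution κ G) (hκ : 0 ≤ κ) {t : ℝ} (ht : 0 ≤ t)
    (hκt : κ * t < 1) (ℓ : ℕ) {a : ℝ} (ha : 0 ≤ a) : G ℓ t a = 0 := by
  obtain ⟨M, hM, hb⟩ := hG.bounded t
  have hnorm : ‖κ * t‖ < 1 := by rwa [Real.norm_of_nonneg (mul_nonneg hκ ht)]
  have hlim := (tendsto_pow_mul_choose_zero hnorm ℓ).const_mul (M * ℓ)
  rw [mul_zero] at hlim
  exact norm_le_zero_iff.mp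
    (ge_of_tendsto' hlim fun n => hG.norm_le_iterate hκ hM hb n ℓ t a ht le_rfl ha)

lemma translate (hG : IsMildSolution κ G) {τ : ℝ} (hτ : 0 ≤ τ)
    (hzero : ∀ (ℓ : ℕ) (t a : ℝ), 0 ≤ t → t ≤ τ → 0 ≤ a → G ℓ t a = 0) :
    IsMildSolution κ fun ℓ t => G ℓ (t + τ) where
  continuous ℓ :=
    (hG.continuous ℓ).comp ((continuous_fst.add continuous_const).prodMk continuous_snd)
  zero_mode t := hG.zero_mode (t + τ)
  duhamel ℓ t a ht ha := by
    have hsource := hG.continuous_source ℓ (t + τ) a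
    rw [hG.duhamel ℓ (t + τ) a (by positivity) ha,
      ← intervalIntegral.integral_add_adjacent_intervals (hsource.intervalIntegrable 0 τ)
        (hsource.intervalIntegrable τ (t + τ)),
      intervalIntegral.integral_zero_ae (ae_of_all _ fun s hs => ?_), zero_add]
    · conv_lhs => arg 2; rw [← zero_add τ]
      rw [← intervalIntegral.integral_comp_add_right]
      simp only [add_sub_add_right_eq_sub]
    · rw [uIoc_of_le hτ] at hs
      have hγ : 0 ≤ a + (ℓ + 1 : ℕ) * (t + τ - s) :=
        add_nonneg ha (mul_nonneg (Nat.cast_nonneg _) (by linarith [hs.2]))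
      rw [hzero ℓ s _ hs.1.le hs.2 hγ, hzero (ℓ + 2) s _ hs.1.le hs.2 hγ, sub_zero, mul_zero]
  bounded T := by
    obtain ⟨M, hM, hb⟩ := hG.bounded (T + τ)
    exact ⟨M, hM, fun ℓ t a ht hT ha => hb ℓ (t + τ) a (by positivity) (by linarith) ha⟩

theorem eq_zero (hG : IsMildSolution κ G) (hκ : 0 ≤ κ) (ℓ : ℕ) {t a : ℝ} (ht : 0 ≤ t)
    (ha : 0 ≤ a) : G ℓ t a = 0 := by
  set δ : ℝ := 1 / (κ + 1) with hδ
  have hδ_pos : 0 < δ := by positivity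
  have hκδ : κ * δ < 1 := by rw [hδ, mul_one_div, div_lt_one (by positivity)]; linarith
  have hsteps : ∀ (N ℓ : ℕ) (t a : ℝ), 0 ≤ t → t ≤ N * δ → 0 ≤ a → G ℓ t a = 0 := by
    intro N
    induction N with
    | zero =>
      intro ℓ t a ht htN ha
      have hκt : κ * t ≤ 0 := mul_nonpos_of_nonneg_of_nonpos hκ (by simpa using htN)
      exact hG.eq_zero_of_mul_lt_one hκ ht (hκt.trans_lt one_pos) ℓ ha
    | succ N ih =>
      intro ℓ t a ht htN ha
      rcases le_total t (N * δ) with h | h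
      · exact ih ℓ t a ht h ha
      · have hstep : κ * (t - N * δ) < 1 := by
          refine lt_of_le_of_lt ?_ hκδ
          gcongr
          push_cast at htN
          linarith
        have hzero := (hG.translate (by positivity) ih).eq_zero_of_mul_lt_one hκ
          (sub_nonneg.mpr h) hstep ℓ ha
        rwa [sub_add_cancel] at hzero
  obtain ⟨N, hN⟩ := exists_nat_ge (t / δ)
  exact hsteps N ℓ t a ht ((div_le_iff₀ hδ_pos).mp hN) ha

end IsMildSolution

namespace IsTest

variable {φ : ℝ → ℝ}

lemma translate (hφ : IsTest φ) {a : ℝ} (ha : 0 ≤ a) : IsTest fun ξ => φ (ξ - a) := by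
  refine ⟨hφ.1.comp (contDiff_id.sub contDiff_const),
    hφ.2.1.comp_homeomorph (Homeomorph.subRight a), fun ξ hξ => ?_⟩
  have hsub : ξ - a ∈ tsupport φ := by
    rwa [show (fun ξ => φ (ξ - a)) = φ ∘ Homeomorph.subRight a from rfl,
      tsupport_comp_eq_preimage] at hξ
  exact ha.trans_lt (sub_pos.mp (hφ.2.2 hsub))

lemma continuous_pair (hφ : IsTest φ) {W : ℝ → ℝ → ℂ} (hW : Continuous (Function.uncurry W)) :
    Continuous (Function.uncurry fun t a => pair (W t) fun ξ => φ (ξ - a)) := by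
  have hpair : (Function.uncurry fun t a => pair (W t) fun ξ => φ (ξ - a))
      = fun q : ℝ × ℝ => ∫ η in tsupport φ, W q.1 (η + q.2) * ((φ η : ℝ) : ℂ) := by
    ext ⟨t, a⟩
    rw [setIntegral_eq_integral_of_forall_compl_eq_zero fun η hη => by
      rw [image_eq_zero_of_notMem_tsupport hη, Complex.ofReal_zero, mul_zero]]
    simp only [Function.uncurry_apply_pair]
    rw [pair, ← integral_add_right_eq_self _ a]
    simp only [add_sub_cancel_right]
  rw [hpair]
  have hφc := hφ.continuous
  refine continuous_parametric_integral_of_continuous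
    (f := fun (q : ℝ × ℝ) η => W q.1 (η + q.2) * ((φ η : ℝ) : ℂ)) ?_ hφ.2.1
  exact (hW.comp ((continuous_fst.comp continuous_fst).prodMk
    (continuous_snd.add (continuous_snd.comp continuous_fst)))).mul (by fun_prop)

lemma continuous_pair_time (hφ : IsTest φ) {W : ℝ → ℝ → ℂ}
    (hW : Continuous (Function.uncurry W)) : Continuous fun t => pair (W t) φ := by
  simpa only [Function.comp_def, Function.uncurry_apply_pair, id_eq, sub_zero] using
    (hφ.continuous_pair hW).comp (continuous_id.prodMk (continuous_const (y := (0 : ℝ))))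

lemma hasDerivAt_pair (hφ : IsTest φ) {v : ℝ → ℂ} (hv : Continuous v) (a : ℝ) :
    HasDerivAt (fun a => pair v fun ξ => φ (ξ - a))
      (-pair v fun ξ => _root_.deriv φ (ξ - a)) a := by
  have hconv (χ : ℝ → ℝ) (a : ℝ) : pair v (fun ξ => χ (ξ - a)) = MeasureTheory.convolution v
      (fun x => χ (-x)) (ContinuousLinearMap.lsmul ℝ ℝ).flip volume a := by
    simp only [pair, MeasureTheory.convolution_def, ContinuousLinearMap.flip_apply,
      ContinuousLinearMap.lsmul_apply, neg_sub, Complex.real_smul, mul_comm]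
  have h := HasCompactSupport.hasDerivAt_convolution_right (ContinuousLinearMap.lsmul ℝ ℝ).flip
    (hv.locallyIntegrable (μ := volume)) (hφ.2.1.comp_homeomorph (Homeomorph.neg ℝ))
    ((hφ.1.comp contDiff_neg).of_le (by exact_mod_cast le_top)) a
  rw [funext (hconv φ)]
  refine h.congr_deriv ?_
  rw [show φ ∘ Homeomorph.neg ℝ = fun x => φ (-x) from rfl, funext (deriv_comp_neg φ),
    ← hconv fun x => -_root_.deriv φ x]
  simp only [pair, Complex.ofReal_neg, mul_neg, integral_neg]

end IsTest

lemma hasDerivAt_along_curve {G Gt Ga : ℝ → ℝ → ℂ} {γ : ℝ → ℝ} {s c : ℝ}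
    (ht : ∀ᶠ q : ℝ × ℝ in 𝓝 (s, γ s), HasDerivAt (fun t => G t q.2) (Gt q.1 q.2) q.1)
    (ha : ∀ᶠ q : ℝ × ℝ in 𝓝 (s, γ s), HasDerivAt (fun x => G q.1 x) (Ga q.1 q.2) q.2)
    (hGt : Continuous (Function.uncurry Gt)) (hGa : Continuous (Function.uncurry Ga))
    (hγ : HasDerivAt γ c s) :
    HasDerivAt (fun t => G t (γ t)) (Gt s (γ s) + c * Ga s (γ s)) s := by
  have hspan : Continuous fun z : ℂ => ContinuousLinearMap.toSpanSingleton ℝ z :=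
    (ContinuousLinearMap.toSpanSingletonLIE ℝ ℂ).continuous
  have hG := hasStrictFDerivAt_uncurry_coprod (𝕜 := ℝ) (u := (s, γ s)) (f := G)
    (f₁ := fun t x => ContinuousLinearMap.toSpanSingleton ℝ (Gt t x))
    (f₂ := fun t x => ContinuousLinearMap.toSpanSingleton ℝ (Ga t x))
    (ht.mono fun q hq => hq.hasFDerivAt) (ha.mono fun q hq => hq.hasFDerivAt)
    (hspan.comp hGt).continuousAt (hspan.comp hGa).continuousAt
  refine (hG.hasFDerivAt.comp_hasDerivAt_of_eq s ((hasDerivAt_id s).prodMk hγ) rfl).congr_deriv ?_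
  simp [Function.HasUncurry.uncurry]

/-- The right-hand side `ℓ ∂_ξ u_ℓ + (κℓ/2) (u_{ℓ-1} - u_{ℓ+1})` of the hierarchy in the mode
`ℓ + 1`, tested against `φ` at time `s`. -/
def testedRhs (κ : ℝ) (W : ℕ → ℝ → ℝ → ℂ) (ℓ : ℕ) (φ : ℝ → ℝ) (s : ℝ) : ℂ :=
  -((ℓ + 1 : ℕ) : ℂ) * pair (W (ℓ + 1) s) (deriv φ)
    + (κ : ℂ) * ((ℓ + 1 : ℕ) : ℂ) / 2 * (pair (W ℓ s) φ - pair (W (ℓ + 2) s) φ)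

lemma testedRhs_translate (κ : ℝ) (W : ℕ → ℝ → ℝ → ℂ) (ℓ : ℕ) (φ : ℝ → ℝ) (a s : ℝ) :
    testedRhs κ W ℓ (fun ξ => φ (ξ - a)) s
      = -((ℓ + 1 : ℕ) : ℂ) * pair (W (ℓ + 1) s) (fun ξ => deriv φ (ξ - a))
        + (κ : ℂ) * ((ℓ + 1 : ℕ) : ℂ) / 2
          * (pair (W ℓ s) (fun ξ => φ (ξ - a)) - pair (W (ℓ + 2) s) (fun ξ => φ (ξ - a))) := by
  rw [testedRhs, funext (deriv_comp_sub_const φ a)]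

lemma continuous_testedRhs_translate (κ : ℝ) {W : ℕ → ℝ → ℝ → ℂ}
    (hW : ∀ ℓ, Continuous (Function.uncurry (W ℓ))) (ℓ : ℕ) {φ : ℝ → ℝ} (hφ : IsTest φ) :
    Continuous (Function.uncurry fun s a => testedRhs κ W ℓ (fun ξ => φ (ξ - a)) s) := by
  simp only [testedRhs_translate]
  exact (continuous_const.mul (hφ.deriv.continuous_pair (hW _))).add
    (continuous_const.mul ((hφ.continuous_pair (hW _)).sub (hφ.continuous_pair (hW _))))

lemma continuous_testedRhs (κ : ℝ) {W : ℕ → ℝ → ℝ → ℂ}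
    (hW : ∀ ℓ, Continuous (Function.uncurry (W ℓ))) (ℓ : ℕ) {φ : ℝ → ℝ} (hφ : IsTest φ) :
    Continuous (testedRhs κ W ℓ φ) := by
  simpa only [Function.comp_def, Function.uncurry_apply_pair, id_eq, sub_zero] using
    (continuous_testedRhs_translate κ hW ℓ hφ).comp
      (continuous_id.prodMk (continuous_const (y := (0 : ℝ))))

/-- A weak solution of `∂_t W = L₁ W` with zero initial data, given by continuous modes on the whole
plane and with a vanishing zeroth mode; only the quadrant `t, ξ ≥ 0` matters. -/
structure IsWeakNullSolution (κ : ℝ) (W : ℕ → ℝ → ℝ → ℂ) : Prop where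
  continuous : ∀ ℓ, Continuous (Function.uncurry (W ℓ))
  zero_mode : ∀ t ξ, W 0 t ξ = 0
  weak_eq : ∀ (ℓ : ℕ) (φ : ℝ → ℝ), IsTest φ → ∀ t, 0 ≤ t →
    pair (W (ℓ + 1) t) φ = ∫ s in (0 : ℝ)..t, testedRhs κ W ℓ φ s
  bounded : ∀ φ : ℝ → ℝ, IsTest φ → ∀ T : ℝ, ∃ M : ℝ, 0 ≤ M ∧ ∀ (ℓ : ℕ) (t a : ℝ),
    0 ≤ t → t ≤ T → 0 ≤ a → ‖pair (W ℓ t) fun ξ => φ (ξ - a)‖ ≤ M * ℓ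

lemma eq_zero_of_pair_eq_zero {v : ℝ → ℂ} (hv : Continuous v)
    (h : ∀ φ, IsTest φ → pair v φ = 0) {ξ : ℝ} (hξ : 0 ≤ ξ) : v ξ = 0 := by
  have hae := isOpen_Ioi.ae_eq_zero_of_integral_contDiff_smul_eq_zero (U := Ioi (0 : ℝ))
    (hv.locallyIntegrable.locallyIntegrableOn _ (μ := volume)) fun φ hsmooth hcompact hsupp => by
      simpa only [pair, Complex.real_smul, mul_comm] using h φ ⟨hsmooth, hcompact, hsupp⟩
  have hae' : v =ᵐ[volume.restrict (Ici (0 : ℝ))] fun _ => 0 := by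
    rw [Measure.restrict_congr_set Ioi_ae_eq_Ici.symm]
    exact (ae_restrict_iff' measurableSet_Ioi).mpr hae
  exact Measure.eqOn_of_ae_eq hae' hv.continuousOn continuousOn_const (by simp) hξ

namespace IsWeakNullSolution

variable {κ : ℝ} {W : ℕ → ℝ → ℝ → ℂ} {φ : ℝ → ℝ}

lemma hasDerivAt_pair_translate (hW : IsWeakNullSolution κ W) (hφ : IsTest φ) (ℓ : ℕ) {s a : ℝ}
    (hs : 0 < s) (ha : 0 ≤ a) :
    HasDerivAt (fun t => pair (W (ℓ + 1) t) fun ξ => φ (ξ - a))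
      (testedRhs κ W ℓ (fun ξ => φ (ξ - a)) s) s := by
  have hcont := continuous_testedRhs κ hW.continuous ℓ (hφ.translate ha)
  refine (hcont.integral_hasStrictDerivAt 0 s).hasDerivAt.congr_of_eventuallyEq ?_
  filter_upwards [lt_mem_nhds hs] with t ht
  exact hW.weak_eq ℓ _ (hφ.translate ha) t ht.le

-- Moving the test function along the characteristic cancels the transport term.
lemma hasDerivAt_pair_characteristic (hW : IsWeakNullSolution κ W) (hφ : IsTest φ) (ℓ : ℕ)
    {γ : ℝ → ℝ} {s : ℝ} (hs : 0 < s) (hγs : 0 < γ s)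
    (hγ : HasDerivAt γ (-((ℓ + 1 : ℕ) : ℝ)) s) :
    HasDerivAt (fun t => pair (W (ℓ + 1) t) fun ξ => φ (ξ - γ t))
      ((κ : ℂ) * ((ℓ + 1 : ℕ) : ℂ) / 2
        * (pair (W ℓ s) (fun ξ => φ (ξ - γ s)) - pair (W (ℓ + 2) s) fun ξ => φ (ξ - γ s))) s := by
  have hpos : ∀ᶠ q : ℝ × ℝ in 𝓝 (s, γ s), 0 < q.1 ∧ 0 < q.2 :=
    (continuous_fst.continuousAt.eventually (lt_mem_nhds hs)).and
      (continuous_snd.continuousAt.eventually (lt_mem_nhds hγs))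
  have h := hasDerivAt_along_curve
    (G := fun t a => pair (W (ℓ + 1) t) fun ξ => φ (ξ - a))
    (Ga := fun t a => -pair (W (ℓ + 1) t) fun ξ => deriv φ (ξ - a))
    (hpos.mono fun q hq => hW.hasDerivAt_pair_translate hφ ℓ hq.1 hq.2.le)
    (Eventually.of_forall fun q => hφ.hasDerivAt_pair
      ((hW.continuous (ℓ + 1)).comp (continuous_const.prodMk continuous_id)) q.2)
    (continuous_testedRhs_translate κ hW.continuous ℓ hφ)
    (hφ.deriv.continuous_pair (hW.continuous (ℓ + 1))).neg hγ
  refine h.congr_deriv ?_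
  rw [testedRhs_translate]
  push_cast
  ring

lemma isMildSolution (hW : IsWeakNullSolution κ W) (hφ : IsTest φ) :
    IsMildSolution κ fun ℓ t a => pair (W ℓ t) fun ξ => φ (ξ - a) where
  continuous ℓ := hφ.continuous_pair (hW.continuous ℓ)
  zero_mode t a := by simp only [pair, hW.zero_mode, zero_mul, integral_zero]
  bounded := hW.bounded φ hφ
  duhamel ℓ t a ht ha := by
    set γ : ℝ → ℝ := fun s => a + (ℓ + 1 : ℕ) * (t - s) with hγ
    have hγ_cont : Continuous γ := by fun_prop
    have hγ_deriv (s : ℝ) : HasDerivAt γ (-((ℓ + 1 : ℕ) : ℝ)) s := by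
      simpa only [id_eq, mul_neg, mul_one] using
        (((hasDerivAt_id s).const_sub t).const_mul ((ℓ + 1 : ℕ) : ℝ)).const_add a
    have hγ_pos (s : ℝ) (hs : s ∈ Ioo 0 t) : 0 < γ s :=
      add_pos_of_nonneg_of_pos ha (mul_pos (by positivity) (sub_pos.mpr hs.2))
    have hcont (j : ℕ) : Continuous fun s => pair (W j s) fun ξ => φ (ξ - γ s) :=
      (hφ.continuous_pair (hW.continuous j)).comp (continuous_id.prodMk hγ_cont)
    have hinitial : pair (W (ℓ + 1) 0) (fun ξ => φ (ξ - γ 0)) = 0 := by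
      rw [hW.weak_eq ℓ _ (hφ.translate (by positivity)) 0 le_rfl, intervalIntegral.integral_same]
    rw [intervalIntegral.integral_eq_sub_of_hasDerivAt_of_le ht (hcont (ℓ + 1)).continuousOn
      (fun s hs => hW.hasDerivAt_pair_characteristic hφ ℓ hs.1 (hγ_pos s hs) (hγ_deriv s))
      ((continuous_const.mul ((hcont ℓ).sub (hcont (ℓ + 2)))).intervalIntegrable _ _),
      hinitial, sub_zero, show γ t = a by simp only [hγ, sub_self, mul_zero, add_zero]]

theorem eq_zero (hW : IsWeakNullSolution κ W) (hκ : 0 ≤ κ) (ℓ : ℕ) {t ξ : ℝ} (ht : 0 ≤ t)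
    (hξ : 0 ≤ ξ) : W ℓ t ξ = 0 := by
  refine eq_zero_of_pair_eq_zero
    ((hW.continuous ℓ).comp (continuous_const.prodMk continuous_id)) (fun φ hφ => ?_) hξ
  change pair (W ℓ t) φ = 0
  simpa only [sub_zero] using (hW.isMildSolution hφ).eq_zero hκ ℓ ht le_rfl

end IsWeakNullSolution

/-! ### Duhamel's formula -/

/-- The modes of an evolution as functions on the whole plane, extended constantly from the quadrant
`t, ξ ≥ 0` and with vanishing zeroth mode. The extension is continuous, so that it can be paired
with test functions without measurability side conditions. -/
def extend (w : ℝ → ℕ → ℝ → ℂ) (ℓ : ℕ) (t ξ : ℝ) : ℂ :=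
  if ℓ = 0 then 0 else w (max t 0) ℓ (max ξ 0)

lemma extend_zero (w : ℝ → ℕ → ℝ → ℂ) (t ξ : ℝ) : extend w 0 t ξ = 0 := rfl

lemma extend_succ (w : ℝ → ℕ → ℝ → ℂ) (ℓ : ℕ) {t ξ : ℝ} (ht : 0 ≤ t) (hξ : 0 ≤ ξ) :
    extend w (ℓ + 1) t ξ = w t (ℓ + 1) ξ := by
  rw [extend, if_neg (Nat.succ_ne_zero ℓ), max_eq_left ht, max_eq_left hξ]

lemma lower_succ_eq_extend (w : ℝ → ℕ → ℝ → ℂ) (ℓ : ℕ) {t ξ : ℝ} (ht : 0 ≤ t) (hξ : 0 ≤ ξ) :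
    lower (w t) (ℓ + 1) ξ = extend w ℓ t ξ := by
  rcases ℓ with _ | ℓ
  · rw [lower, if_pos (by omega), extend_zero]
  · rw [lower, if_neg (by omega), Nat.add_sub_cancel, extend_succ w ℓ ht hξ]

lemma IsTest.pair_congr {φ : ℝ → ℝ} (hφ : IsTest φ) {u v : ℝ → ℂ} (h : ∀ ξ, 0 < ξ → u ξ = v ξ) :
    pair u φ = pair v φ := by
  rw [← hφ.setIntegral_eq_pair, ← hφ.setIntegral_eq_pair]
  exact setIntegral_congr_fun measurableSet_Ioi fun ξ hξ => by simp only [h ξ hξ]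

lemma IsTest.enorm_pair_le {φ : ℝ → ℝ} (hφ : IsTest φ) {v : ℝ → ℂ} (hv : Continuous v) :
    ‖pair v φ‖ₑ ≤ (∫⁻ ξ in Ioi (0 : ℝ), ‖v ξ‖ₑ ^ 2) + ∫⁻ ξ, ‖φ ξ‖ₑ ^ 2 := by
  have hmul (x y : ℝ≥0∞) : x * y ≤ x ^ 2 + y ^ 2 := by
    rcases le_total x y with h | h
    · exact (mul_le_mul_left h y).trans ((sq y).ge.trans le_add_self)
    · exact (mul_le_mul_right h x).trans ((sq x).ge.trans le_self_add)
  rw [← hφ.setIntegral_eq_pair]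
  calc ‖∫ ξ in Ioi (0 : ℝ), v ξ * ((φ ξ : ℝ) : ℂ)‖ₑ
      ≤ ∫⁻ ξ in Ioi (0 : ℝ), ‖v ξ * ((φ ξ : ℝ) : ℂ)‖ₑ := enorm_integral_le_lintegral_enorm _
    _ ≤ ∫⁻ ξ in Ioi (0 : ℝ), (‖v ξ‖ₑ ^ 2 + ‖φ ξ‖ₑ ^ 2) := lintegral_mono fun ξ => by
        rw [enorm_mul, ← ofReal_norm (φ ξ : ℂ), Complex.norm_real, ofReal_norm]
        exact hmul _ _
    _ = (∫⁻ ξ in Ioi (0 : ℝ), ‖v ξ‖ₑ ^ 2) + ∫⁻ ξ in Ioi (0 : ℝ), ‖φ ξ‖ₑ ^ 2 :=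
        lintegral_add_left (hv.enorm.measurable.pow_const 2) _
    _ ≤ _ := by gcongr; exact Measure.restrict_le_self

lemma IsTest.lintegral_sq_ne_top {φ : ℝ → ℝ} (hφ : IsTest φ) : ∫⁻ ξ, ‖φ ξ‖ₑ ^ 2 ≠ ⊤ := by
  have hφc := hφ.continuous
  have hInt : Integrable fun ξ => φ ξ * φ ξ :=
    Continuous.integrable_of_hasCompactSupport (by fun_prop) hφ.2.1.mul_right
  simp only [sq, ← enorm_mul]
  exact hInt.2.ne

lemma sobolevSq_le_modeNorm_sq (φ : ℝ → ℝ) (u : ℕ → ℝ → ℂ) (ℓ : ℕ) :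
    sobolevSq φ (u (ℓ + 1)) ≤ ((ℓ + 1 : ℕ) : ℝ≥0∞) * modeNorm φ (-1 / 2) u ^ 2 := by
  have hterm := ENNReal.le_tsum (f := fun ℓ : ℕ =>
    ENNReal.ofReal (((ℓ + 1 : ℕ) : ℝ) ^ (2 * (-1 / 2 : ℝ))) * sobolevSq φ (u (ℓ + 1))) ℓ
  have hweight : ENNReal.ofReal (((ℓ + 1 : ℕ) : ℝ) ^ (2 * (-1 / 2 : ℝ)))
      = ((ℓ + 1 : ℕ) : ℝ≥0∞)⁻¹ := by
    rw [show (2 * (-1 / 2) : ℝ) = -1 by norm_num, Real.rpow_neg_one,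
      ENNReal.ofReal_inv_of_pos (by positivity), ENNReal.ofReal_natCast]
  simp only [hweight] at hterm
  rw [ENNReal.inv_mul_le_iff (by simp) (by finiteness)] at hterm
  refine hterm.trans_eq ?_
  simp only [modeNorm, ← ENNReal.rpow_two, ← ENNReal.rpow_mul]
  norm_num

namespace IsEvolution

variable {κ : ℝ} {v : ℕ → ℝ → ℂ} {w : ℝ → ℕ → ℝ → ℂ}

lemma continuous_extend (hw : IsEvolution κ v w) (ℓ : ℕ) :
    Continuous (Function.uncurry (extend w ℓ)) := by
  rcases ℓ with _ | ℓ
  · exact continuous_const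
  · have hclamp : Continuous fun q : ℝ × ℝ => (max q.1 0, max q.2 0) := by fun_prop
    exact (hw.continuous_modes (ℓ + 1) (by omega)).comp_continuous hclamp fun q =>
      ⟨mem_Ici.mpr (le_max_right _ _), mem_Ici.mpr (le_max_right _ _)⟩

lemma continuous_extend_right (hw : IsEvolution κ v w) (ℓ : ℕ) (t : ℝ) :
    Continuous (extend w ℓ t) :=
  (hw.continuous_extend ℓ).comp (continuous_const.prodMk continuous_id)

lemma continuous_extend_left (hw : IsEvolution κ v w) (ℓ : ℕ) (ξ : ℝ) :
    Continuous fun t => extend w ℓ t ξ :=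
  (hw.continuous_extend ℓ).comp (continuous_id.prodMk continuous_const)

lemma setIntegral_rhs_eq_testedRhs (hw : IsEvolution κ v w) (ℓ : ℕ) {φ : ℝ → ℝ} (hφ : IsTest φ)
    {s : ℝ} (hs : 0 ≤ s) :
    ∫ ξ in Ioi (0 : ℝ), (-((ℓ + 1 : ℕ) : ℂ) * w s (ℓ + 1) ξ * ((deriv φ ξ : ℝ) : ℂ)
        + (κ : ℂ) * ((ℓ + 1 : ℕ) : ℂ) / 2 * (lower (w s) (ℓ + 1) ξ - w s (ℓ + 2) ξ)
          * ((φ ξ : ℝ) : ℂ))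
      = testedRhs κ (extend w) ℓ φ s := by
  have hInt (j : ℕ) {ψ : ℝ → ℝ} (hψ : IsTest ψ) :
      IntegrableOn (fun ξ => extend w j s ξ * ((ψ ξ : ℝ) : ℂ)) (Ioi 0) :=
    (hψ.integrable_mul (hw.continuous_extend_right j s)).integrableOn
  have hdiff : IntegrableOn (fun ξ => (κ : ℂ) * ((ℓ + 1 : ℕ) : ℂ) / 2
      * (extend w ℓ s ξ * ((φ ξ : ℝ) : ℂ) - extend w (ℓ + 2) s ξ * ((φ ξ : ℝ) : ℂ))) (Ioi 0) :=
    ((hInt ℓ hφ).sub (hInt (ℓ + 2) hφ)).const_mul _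
  rw [testedRhs, ← hφ.setIntegral_eq_pair, ← hφ.setIntegral_eq_pair, ← hφ.deriv.setIntegral_eq_pair,
    ← integral_sub (hInt ℓ hφ) (hInt (ℓ + 2) hφ), ← integral_const_mul, ← integral_const_mul,
    ← integral_add ((hInt (ℓ + 1) hφ.deriv).const_mul _) hdiff]
  refine setIntegral_congr_fun measurableSet_Ioi fun ξ hξ => ?_
  have hξ0 : 0 ≤ ξ := (mem_Ioi.mp hξ).le
  simp only [lower_succ_eq_extend w ℓ hs hξ0, extend_succ w ℓ hs hξ0,
    extend_succ w (ℓ + 1) hs hξ0]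
  ring

lemma pair_extend (hw : IsEvolution κ v w) (ℓ : ℕ) {φ : ℝ → ℝ} (hφ : IsTest φ) {t : ℝ}
    (ht : 0 ≤ t) : pair (extend w (ℓ + 1) t) φ = pair (extend w (ℓ + 1) 0) φ
      + ∫ s in (0 : ℝ)..t, testedRhs κ (extend w) ℓ φ s := by
  have hweak := hw.weak_eq (ℓ + 1) (by omega) φ hφ t ht
  rw [hφ.setIntegral_eq_pair, hφ.setIntegral_eq_pair] at hweak
  rw [hφ.pair_congr fun ξ hξ => extend_succ w ℓ ht hξ.le, hweak,
    hφ.pair_congr fun ξ hξ => (extend_succ w ℓ le_rfl hξ.le).trans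
      (hw.initial (ℓ + 1) (by omega) ξ hξ.le)]
  congr 1
  refine intervalIntegral.integral_congr fun s hs => ?_
  rw [uIcc_of_le ht] at hs
  exact hw.setIntegral_rhs_eq_testedRhs ℓ hφ hs.1

lemma lintegral_sq_extend_le (hw : IsEvolution κ v w) (T : ℝ) :
    ∃ M : ℝ≥0∞, M ≠ ⊤ ∧ ∀ (ℓ : ℕ) (t : ℝ), 0 ≤ t → t ≤ T →
      ∫⁻ ξ in Ioi (0 : ℝ), ‖extend w (ℓ + 1) t ξ‖ₑ ^ 2 ≤ ((ℓ + 1 : ℕ) : ℝ≥0∞) * M := by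
  obtain ⟨M, hM⟩ := hw.bounded T
  refine ⟨ENNReal.ofReal M ^ 2, by finiteness, fun ℓ t ht hT => ?_⟩
  calc ∫⁻ ξ in Ioi (0 : ℝ), ‖extend w (ℓ + 1) t ξ‖ₑ ^ 2
      = ∫⁻ ξ in Ioi (0 : ℝ), wt (2 * 0) ξ * ‖w t (ℓ + 1) ξ‖ₑ ^ 2 :=
        setLIntegral_congr_fun measurableSet_Ioi fun ξ hξ => by
          simp only [extend_succ w ℓ ht (mem_Ioi.mp hξ).le, wt, mul_zero, Real.rpow_zero,
            ENNReal.ofReal_one, one_mul]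
    _ ≤ sobolevSq (p 0) (w t (ℓ + 1)) := lintegral_wt_mul_sq_le_sobolevSq 0 _
    _ ≤ ((ℓ + 1 : ℕ) : ℝ≥0∞) * modeNorm (p 0) (-1 / 2) (w t) ^ 2 :=
        sobolevSq_le_modeNorm_sq (p 0) (w t) ℓ
    _ ≤ _ := by gcongr; exact hM t ⟨ht, hT⟩

lemma norm_pair_extend_le (hw : IsEvolution κ v w) {φ : ℝ → ℝ} (hφ : IsTest φ) (T : ℝ) :
    ∃ M : ℝ, 0 ≤ M ∧ ∀ (ℓ : ℕ) (t a : ℝ), 0 ≤ t → t ≤ T → 0 ≤ a →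
      ‖pair (extend w ℓ t) fun ξ => φ (ξ - a)‖ ≤ M * ℓ := by
  obtain ⟨M, hM, hbound⟩ := hw.lintegral_sq_extend_le T
  set S : ℝ≥0∞ := ∫⁻ ξ, ‖φ ξ‖ₑ ^ 2
  have hS : S ≠ ⊤ := hφ.lintegral_sq_ne_top
  refine ⟨(M + S).toReal, ENNReal.toReal_nonneg, ?_⟩
  rintro (_ | ℓ) t a ht hT ha
  · simp [pair, extend_zero]
  have hpair : ‖pair (extend w (ℓ + 1) t) fun ξ => φ (ξ - a)‖ₑ
      ≤ (M + S) * ((ℓ + 1 : ℕ) : ℝ≥0∞) := by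
    refine ((hφ.translate ha).enorm_pair_le (hw.continuous_extend_right (ℓ + 1) t)).trans ?_
    rw [lintegral_sub_right_eq_self fun ξ => ‖φ ξ‖ₑ ^ 2, add_mul, mul_comm M]
    refine add_le_add (hbound ℓ t ht hT) (le_mul_of_one_le_right' ?_)
    exact_mod_cast Nat.le_add_left 1 ℓ
  have hreal := ENNReal.toReal_mono (by finiteness) hpair
  rwa [toReal_enorm, ENNReal.toReal_mul, ENNReal.toReal_natCast] at hreal

end IsEvolution

section timeIntegral

variable {Y : ℝ → ℝ → ℂ}

lemma continuous_timeIntegral (hY : Continuous (Function.uncurry Y)) :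
    Continuous (Function.uncurry fun t ξ => ∫ s in (0 : ℝ)..t, Y s ξ) := by
  have hswap : Continuous (Function.uncurry fun (q : ℝ × ℝ) (s : ℝ) => Y s q.2) :=
    hY.comp (continuous_snd.prodMk (continuous_snd.comp continuous_fst))
  exact intervalIntegral.continuous_parametric_intervalIntegral_of_continuous hswap continuous_fst

lemma IsTest.pair_timeIntegral {φ : ℝ → ℝ} (hφ : IsTest φ) (hY : Continuous (Function.uncurry Y))
    {t : ℝ} (ht : 0 ≤ t) :
    pair (fun ξ => ∫ s in (0 : ℝ)..t, Y s ξ) φ = ∫ s in (0 : ℝ)..t, pair (Y s) φ := by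
  have hφc := hφ.continuous
  have hcont : Continuous (Function.uncurry fun (s ξ : ℝ) => Y s ξ * ((φ ξ : ℝ) : ℂ)) :=
    hY.mul (by fun_prop)
  have hcompact : IntegrableOn (Function.uncurry fun (s ξ : ℝ) => Y s ξ * ((φ ξ : ℝ) : ℂ))
      (Icc 0 t ×ˢ tsupport φ) (volume.prod volume) :=
    hcont.continuousOn.integrableOn_compact (isCompact_Icc.prod hφ.2.1)
  have hstrip : IntegrableOn (Function.uncurry fun (s ξ : ℝ) => Y s ξ * ((φ ξ : ℝ) : ℂ))
      (Icc 0 t ×ˢ univ) (volume.prod volume) := by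
    refine hcompact.of_forall_sdiff_eq_zero (measurableSet_Icc.prod MeasurableSet.univ) ?_
    rintro ⟨s, ξ⟩ ⟨hs, hξ⟩
    have hφξ : φ ξ = 0 := image_eq_zero_of_notMem_tsupport fun h => hξ ⟨hs.1, h⟩
    rw [Function.uncurry_apply_pair, hφξ, Complex.ofReal_zero, mul_zero]
  have hIoc := hstrip.mono_set (prod_mono_left (Ioc_subset_Icc_self (a := (0 : ℝ)) (b := t)))
  rw [IntegrableOn, ← Measure.prod_restrict, Measure.restrict_univ, ← uIoc_of_le ht] at hIoc
  simp only [pair]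
  rw [intervalIntegral_integral_swap hIoc]
  simp only [intervalIntegral.integral_mul_const]

end timeIntegral

lemma pair_const_mul (c : ℂ) (v : ℝ → ℂ) (φ : ℝ → ℝ) :
    pair (fun ξ => c * v ξ) φ = c * pair v φ := by
  simp only [pair, mul_assoc, integral_const_mul]

lemma IsTest.pair_add {φ : ℝ → ℝ} (hφ : IsTest φ) {u v : ℝ → ℂ} (hu : Continuous u)
    (hv : Continuous v) : pair (fun ξ => u ξ + v ξ) φ = pair u φ + pair v φ := by
  simp only [pair, add_mul]
  exact integral_add (hφ.integrable_mul hu) (hφ.integrable_mul hv)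

lemma IsTest.pair_sub {φ : ℝ → ℝ} (hφ : IsTest φ) {u v : ℝ → ℂ} (hu : Continuous u)
    (hv : Continuous v) : pair (fun ξ => u ξ - v ξ) φ = pair u φ - pair v φ := by
  simp only [pair, sub_mul]
  exact integral_sub (hφ.integrable_mul hu) (hφ.integrable_mul hv)

lemma integral_testedRhs {W : ℕ → ℝ → ℝ → ℂ} (hW : ∀ ℓ, Continuous (Function.uncurry (W ℓ)))
    (κ : ℝ) (ℓ : ℕ) {φ : ℝ → ℝ} (hφ : IsTest φ) (t : ℝ) :
    ∫ s in (0 : ℝ)..t, testedRhs κ W ℓ φ s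
      = -((ℓ + 1 : ℕ) : ℂ) * (∫ s in (0 : ℝ)..t, pair (W (ℓ + 1) s) (deriv φ))
        + (κ : ℂ) * ((ℓ + 1 : ℕ) : ℂ) / 2
          * ((∫ s in (0 : ℝ)..t, pair (W ℓ s) φ) - ∫ s in (0 : ℝ)..t, pair (W (ℓ + 2) s) φ) := by
  have hInt (j : ℕ) {ψ : ℝ → ℝ} (hψ : IsTest ψ) :
      IntervalIntegrable (fun s => pair (W j s) ψ) volume 0 t :=
    (hψ.continuous_pair_time (hW j)).intervalIntegrable 0 t
  rw [← intervalIntegral.integral_sub (hInt _ hφ) (hInt _ hφ),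
    ← intervalIntegral.integral_const_mul, ← intervalIntegral.integral_const_mul,
    ← intervalIntegral.integral_add ((hInt _ hφ.deriv).const_mul _)
      (((hInt _ hφ).sub (hInt _ hφ)).const_mul _)]
  rfl

/-- The difference between the two sides of Duhamel's formula `w(t) = w(0) + c ∫₀ᵗ y(s) ds`, where
`y` is the evolution of a multiple of `L₁ w(0)`. -/
def duhamelDefect (w y : ℝ → ℕ → ℝ → ℂ) (c : ℂ) (ℓ : ℕ) (t ξ : ℝ) : ℂ :=
  extend w ℓ t ξ - extend w ℓ 0 ξ - c * ∫ s in (0 : ℝ)..t, extend y ℓ s ξ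

namespace IsEvolution

variable {κ : ℝ} {u v : ℕ → ℝ → ℂ} {w y : ℝ → ℕ → ℝ → ℂ}

lemma continuous_duhamelDefect (hw : IsEvolution κ v w) (hy : IsEvolution κ u y) (c : ℂ) (ℓ : ℕ) :
    Continuous (Function.uncurry (duhamelDefect w y c ℓ)) :=
  ((hw.continuous_extend ℓ).sub ((hw.continuous_extend_right ℓ 0).comp continuous_snd)).sub
    (continuous_const.mul (continuous_timeIntegral (hy.continuous_extend ℓ)))

lemma pair_duhamelDefect (hw : IsEvolution κ v w) (hy : IsEvolution κ u y) (c : ℂ) (ℓ : ℕ)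
    {φ : ℝ → ℝ} (hφ : IsTest φ) {t : ℝ} (ht : 0 ≤ t) :
    pair (duhamelDefect w y c ℓ t) φ = pair (extend w ℓ t) φ - pair (extend w ℓ 0) φ
      - c * ∫ s in (0 : ℝ)..t, pair (extend y ℓ s) φ := by
  have hwc := hw.continuous_extend_right ℓ
  have hyc : Continuous fun ξ => ∫ s in (0 : ℝ)..t, extend y ℓ s ξ :=
    (continuous_timeIntegral (hy.continuous_extend ℓ)).comp (continuous_const.prodMk continuous_id)
  rw [← hφ.pair_timeIntegral (hy.continuous_extend ℓ) ht, ← hφ.pair_sub (hwc t) (hwc 0),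
    ← pair_const_mul]
  exact hφ.pair_sub ((hwc t).sub (hwc 0)) (continuous_const.mul hyc)

variable {c : ℂ}

lemma testedRhs_duhamelDefect (hw : IsEvolution κ v w) (hy : IsEvolution κ u y)
    {ℓ : ℕ} {φ : ℝ → ℝ} (hφ : IsTest φ)
    (h : testedRhs κ (extend w) ℓ φ 0 = c * pair (extend y (ℓ + 1) 0) φ) {t : ℝ} (ht : 0 ≤ t) :
    testedRhs κ (duhamelDefect w y c) ℓ φ t
      = testedRhs κ (extend w) ℓ φ t - c * pair (extend y (ℓ + 1) t) φ := by
  rw [hy.pair_extend ℓ hφ ht, integral_testedRhs hy.continuous_extend κ ℓ hφ]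
  simp only [testedRhs] at h ⊢
  rw [hw.pair_duhamelDefect hy c _ hφ.deriv ht, hw.pair_duhamelDefect hy c _ hφ ht,
    hw.pair_duhamelDefect hy c _ hφ ht]
  linear_combination -h

lemma norm_pair_duhamelDefect_le (hw : IsEvolution κ v w) (hy : IsEvolution κ u y) (c : ℂ)
    {φ : ℝ → ℝ} (hφ : IsTest φ) (T : ℝ) :
    ∃ M : ℝ, 0 ≤ M ∧ ∀ (ℓ : ℕ) (t a : ℝ), 0 ≤ t → t ≤ T → 0 ≤ a →
      ‖pair (duhamelDefect w y c ℓ t) fun ξ => φ (ξ - a)‖ ≤ M * ℓ := by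
  obtain ⟨M, hM, hwM⟩ := hw.norm_pair_extend_le hφ T
  obtain ⟨N, hN, hyN⟩ := hy.norm_pair_extend_le hφ T
  refine ⟨M + M + ‖c‖ * (N * |T|), by positivity, fun ℓ t a ht htT ha => ?_⟩
  have hT : |t - 0| ≤ |T| := by rwa [sub_zero, abs_of_nonneg ht, abs_of_nonneg (ht.trans htT)]
  have hintegral : ‖∫ s in (0 : ℝ)..t, pair (extend y ℓ s) fun ξ => φ (ξ - a)‖ ≤ N * ℓ * |T| := by
    refine (intervalIntegral.norm_integral_le_of_norm_le_const fun s hs => ?_).trans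
      (mul_le_mul_of_nonneg_left hT (by positivity))
    rw [uIoc_of_le ht] at hs
    exact hyN ℓ s a hs.1.le (hs.2.trans htT) ha
  rw [hw.pair_duhamelDefect hy c ℓ (hφ.translate ha) ht]
  calc _ ≤ ‖pair (extend w ℓ t) fun ξ => φ (ξ - a)‖ + ‖pair (extend w ℓ 0) fun ξ => φ (ξ - a)‖
        + ‖c * ∫ s in (0 : ℝ)..t, pair (extend y ℓ s) fun ξ => φ (ξ - a)‖ :=
        (norm_sub_le _ _).trans (add_le_add_left (norm_sub_le _ _) _)
    _ ≤ M * ℓ + M * ℓ + ‖c‖ * (N * ℓ * |T|) := by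
        rw [norm_mul]
        gcongr
        · exact hwM ℓ t a ht htT ha
        · exact hwM ℓ 0 a le_rfl (ht.trans htT) ha
    _ = _ := by ring

lemma isWeakNullSolution_duhamelDefect (hw : IsEvolution κ v w) (hy : IsEvolution κ u y)
    (h : ∀ ℓ φ, IsTest φ → testedRhs κ (extend w) ℓ φ 0 = c * pair (extend y (ℓ + 1) 0) φ) :
    IsWeakNullSolution κ (duhamelDefect w y c) where
  continuous := hw.continuous_duhamelDefect hy c
  zero_mode t ξ := by
    simp only [duhamelDefect, extend_zero, intervalIntegral.integral_zero, mul_zero, sub_zero]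
  bounded φ hφ := hw.norm_pair_duhamelDefect_le hy c hφ
  weak_eq ℓ φ hφ t ht := by
    have hrhs : ∫ s in (0 : ℝ)..t, testedRhs κ (duhamelDefect w y c) ℓ φ s
        = ∫ s in (0 : ℝ)..t, (testedRhs κ (extend w) ℓ φ s - c * pair (extend y (ℓ + 1) s) φ) :=
      intervalIntegral.integral_congr fun s hs => by
        rw [uIcc_of_le ht] at hs
        exact hw.testedRhs_duhamelDefect hy hφ (h ℓ φ hφ) hs.1
    have hpair := (hφ.continuous_pair_time (hy.continuous_extend (ℓ + 1))).intervalIntegrable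
      (μ := volume) 0 t
    rw [hrhs, intervalIntegral.integral_sub
      ((continuous_testedRhs κ hw.continuous_extend ℓ hφ).intervalIntegrable _ _)
      (hpair.const_mul c), intervalIntegral.integral_const_mul,
      hw.pair_duhamelDefect hy c (ℓ + 1) hφ ht, hw.pair_extend ℓ hφ ht]
    ring

theorem eq_add_integral (hw : IsEvolution κ v w) (hy : IsEvolution κ u y) (hκ : 0 ≤ κ)
    (h : ∀ ℓ φ, IsTest φ → testedRhs κ (extend w) ℓ φ 0 = c * pair (extend y (ℓ + 1) 0) φ)
    (ℓ : ℕ) {t ξ : ℝ} (ht : 0 ≤ t) (hξ : 0 ≤ ξ) :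
    w t (ℓ + 1) ξ = w 0 (ℓ + 1) ξ + c * ∫ s in (0 : ℝ)..t, y s (ℓ + 1) ξ := by
  have hdefect := (hw.isWeakNullSolution_duhamelDefect hy h).eq_zero hκ (ℓ + 1) ht hξ
  have hintegral : ∫ s in (0 : ℝ)..t, extend y (ℓ + 1) s ξ = ∫ s in (0 : ℝ)..t, y s (ℓ + 1) ξ :=
    intervalIntegral.integral_congr fun s hs => by
      rw [uIcc_of_le ht] at hs
      exact extend_succ y ℓ hs.1 hξ
  rw [duhamelDefect, hintegral, extend_succ w ℓ ht hξ, extend_succ w ℓ le_rfl hξ] at hdefect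
  linear_combination hdefect

end IsEvolution

/-! ### The evolution of the rotation mode -/

section rotation

variable {K r : ℝ} {g : ℝ → ℝ} {w wi : ℝ → ℕ → ℝ → ℂ}

lemma pair_fHat_succ_deriv {κ : ℝ} (hκ : 0 ≤ κ) (hg : Integrable g) (ℓ : ℕ) {φ : ℝ → ℝ}
    (hφ : IsTest φ) : pair (fHat κ g (ℓ + 1)) (deriv φ)
      = -((κ : ℂ) / 2 * (pair (fHat κ g (ℓ + 2)) φ - pair (fHat κ g ℓ) φ)) := by
  have hweak := (isWeakDeriv_fHat_succ hκ hg ℓ).2.2 φ hφ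
  rwa [hφ.deriv.setIntegral_eq_pair, hφ.setIntegral_eq_pair, pair_const_mul,
    hφ.pair_sub (continuous_fHat hκ hg _) (continuous_fHat hκ hg _)] at hweak

lemma pair_extend_rotMode {κ : ℝ} (hw : IsEvolution κ (rotMode κ g) w) (ℓ : ℕ) {φ : ℝ → ℝ}
    (hφ : IsTest φ) : pair (extend w ℓ 0) φ = Complex.I * ℓ * pair (fHat κ g ℓ) φ := by
  rw [← pair_const_mul]
  refine hφ.pair_congr fun ξ hξ => ?_
  rcases ℓ with _ | ℓ
  · rw [extend_zero, Nat.cast_zero, mul_zero, zero_mul]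
  · rw [extend_succ w ℓ le_rfl hξ.le, hw.initial (ℓ + 1) (by omega) ξ hξ.le, rotMode]

lemma pair_extend_rI (hκ : 0 ≤ K * r) (hg : Integrable g)
    (hwi : IsEvolution (K * r) (rI K r g) wi) (ℓ : ℕ) {φ : ℝ → ℝ} (hφ : IsTest φ) :
    pair (extend wi (ℓ + 1) 0) φ = (K : ℂ) * ((ℓ + 1 : ℕ) : ℂ) * Complex.I / 2
      * (pair (fHat (K * r) g ℓ) φ + pair (fHat (K * r) g (ℓ + 2)) φ) := by
  rw [← hφ.pair_add (continuous_fHat hκ hg _) (continuous_fHat hκ hg _), ← pair_const_mul]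
  refine hφ.pair_congr fun ξ hξ => ?_
  rw [extend_succ wi ℓ le_rfl hξ.le, hwi.initial (ℓ + 1) (by omega) ξ hξ.le, rI,
    Nat.add_sub_cancel]

-- `L₁ (D R̂ f̂) = -r · r_i`, since the rotation mode only feels the dropped zeroth mode.
lemma testedRhs_rotMode (hκ : 0 ≤ K * r) (hg : Integrable g)
    (hw : IsEvolution (K * r) (rotMode (K * r) g) w) (hwi : IsEvolution (K * r) (rI K r g) wi)
    (ℓ : ℕ) {φ : ℝ → ℝ} (hφ : IsTest φ) :
    testedRhs (K * r) (extend w) ℓ φ 0 = -(r : ℂ) * pair (extend wi (ℓ + 1) 0) φ := by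
  rw [testedRhs, pair_extend_rotMode hw _ hφ.deriv, pair_extend_rotMode hw _ hφ,
    pair_extend_rotMode hw _ hφ, pair_extend_rI hκ hg hwi ℓ hφ, pair_fHat_succ_deriv hκ hg ℓ hφ]
  push_cast
  ring

lemma IsStationaryState.fHat_one_zero (hs : IsStationaryState K r g) :
    fHat (K * r) g 1 0 = r := by
  have hconj := congrArg (starRingEnd ℂ) hs.self_consistent
  rw [Complex.conj_ofReal, ← integral_conj] at hconj
  rw [hconj, fHat]
  refine integral_congr_ae (ae_of_all _ fun ω => ?_)
  simp only [map_mul, Complex.conj_ofReal, ← integral_conj, ← Complex.exp_conj, Complex.conj_I,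
    Nat.cast_one, Complex.ofReal_zero, mul_one, mul_zero, zero_mul, sub_zero]

lemma IsStationaryState.evolution_rotMode_one (hs : IsStationaryState K r g)
    (hw : IsEvolution (K * r) (rotMode (K * r) g) w) (hwi : IsEvolution (K * r) (rI K r g) wi)
    {t : ℝ} (ht : 0 ≤ t) :
    w t 1 0 = Complex.I * r - r * ∫ s in (0 : ℝ)..t, wi s 1 0 := by
  have hκ : 0 ≤ K * r := mul_nonneg hs.K_nonneg hs.r_nonneg
  rw [hw.eq_add_integral hwi hκ (fun ℓ φ => testedRhs_rotMode hκ hs.g_integrable hw hwi ℓ) 0 ht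
    le_rfl, hw.initial 1 le_rfl 0 le_rfl, rotMode, hs.fHat_one_zero]
  push_cast
  ring

end rotation

/-! ### The functional `α` on the rotation mode -/

section convolution

variable {ρ h : ℝ → ℝ} {T : ℝ}

lemma intervalIntegral_convolution_comm (ρ h : ℝ → ℝ) (t : ℝ) :
    ∫ s in (0 : ℝ)..t, ρ (t - s) * h s = ∫ s in (0 : ℝ)..t, ρ s * h (t - s) := by
  simpa only [sub_sub_cancel, sub_self, sub_zero] using
    intervalIntegral.integral_comp_sub_left (a := 0) (b := t) (fun s => ρ s * h (t - s)) t

lemma intervalIntegral_convolution_eq_setIntegral (ρ h : ℝ → ℝ) {t : ℝ} (ht : t ∈ Ioc 0 T) :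
    ∫ s in (0 : ℝ)..t, ρ (t - s) * h s
      = ∫ s in Ioc 0 T, ρ s * (Icc 0 T).indicator h (t - s) := by
  rw [intervalIntegral_convolution_comm, intervalIntegral.integral_of_le ht.1.le,
    ← integral_indicator measurableSet_Ioc, ← integral_indicator measurableSet_Ioc]
  refine integral_congr_ae (ae_of_all _ fun s => ?_)
  simp only [indicator, mem_Ioc, mem_Icc, sub_nonneg]
  have := ht.2
  split_ifs <;> grind

lemma setIntegral_mul_indicator_comp_sub (h : ℝ → ℝ) (c : ℝ) {s : ℝ} (hs : s ∈ Ioc 0 T) :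
    ∫ t in Ioc 0 T, c * (Icc 0 T).indicator h (t - s) = c * ∫ u in (0 : ℝ)..(T - s), h u := by
  have hwindow : ∫ t in Ioc 0 T, (Icc 0 T).indicator h (t - s) = ∫ t in Icc s T, h (t - s) := by
    rw [← integral_indicator measurableSet_Ioc, ← integral_indicator measurableSet_Icc]
    refine integral_congr_ae (ae_of_all _ fun t => ?_)
    simp only [indicator, mem_Ioc, mem_Icc, sub_nonneg]
    have := hs.1
    split_ifs <;> grind
  rw [integral_const_mul, hwindow, integral_Icc_eq_integral_Ioc,
    ← intervalIntegral.integral_of_le hs.2, intervalIntegral.integral_comp_sub_right h s, sub_self]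

lemma integrable_convolution_integrand_triangle (hρ : IntegrableOn ρ (Ioc 0 T))
    (hh : Continuous h) :
    Integrable (Function.uncurry fun t s => ρ s * (Icc 0 T).indicator h (t - s))
      ((volume.restrict (Ioc 0 T)).prod (volume.restrict (Ioc 0 T))) := by
  have hwindow : Integrable ((Icc 0 T).indicator h) :=
    (hh.continuousOn.integrableOn_compact isCompact_Icc).integrable_indicator measurableSet_Icc
  have hplane := (Integrable.convolution_integrand (ContinuousLinearMap.mul ℝ ℝ) hρ
    hwindow).restrict (s := Ioc 0 T ×ˢ univ)
  rwa [← Measure.prod_restrict, Measure.restrict_univ] at hplane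

lemma intervalIntegrable_convolution (hT : 0 ≤ T) (hρ : IntegrableOn ρ (Ioc 0 T))
    (hh : Continuous h) :
    IntervalIntegrable (fun t => ∫ s in (0 : ℝ)..t, ρ (t - s) * h s) volume 0 T :=
  (intervalIntegrable_iff_integrableOn_Ioc_of_le hT).mpr
    (IntegrableOn.congr_fun (integrable_convolution_integrand_triangle hρ hh).integral_prod_left
      (fun _ ht => (intervalIntegral_convolution_eq_setIntegral ρ h ht).symm) measurableSet_Ioc)

lemma integral_convolution_eq (hT : 0 ≤ T) (hρ : IntegrableOn ρ (Ioc 0 T)) (hh : Continuous h) :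
    ∫ t in (0 : ℝ)..T, ∫ s in (0 : ℝ)..t, ρ (t - s) * h s
      = ∫ s in (0 : ℝ)..T, ρ s * ∫ u in (0 : ℝ)..(T - s), h u := by
  rw [intervalIntegral.integral_of_le hT, intervalIntegral.integral_of_le hT,
    setIntegral_congr_fun measurableSet_Ioc
      fun _ ht => intervalIntegral_convolution_eq_setIntegral ρ h ht,
    integral_integral_swap (integrable_convolution_integrand_triangle hρ hh),
    setIntegral_congr_fun measurableSet_Ioc
      fun s hs => setIntegral_mul_indicator_comp_sub h (ρ s) hs]

end convolution

lemma integral_Ioi_eq_neg_of_integrable_add {y : ℝ → ℝ} {c : ℝ} (hy : Continuous y)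
    (hInt : IntegrableOn y (Ioi 0))
    (hprim : IntegrableOn (fun T => (∫ s in (0 : ℝ)..T, y s) + c) (Ioi 0)) :
    ∫ t in Ioi (0 : ℝ), y t = -c := by
  have hderiv (T : ℝ) : HasDerivAt (fun T => (∫ s in (0 : ℝ)..T, y s) + c) (y T) T :=
    (hy.integral_hasStrictDerivAt 0 T).hasDerivAt.add_const c
  have hlim := tendsto_zero_of_hasDerivAt_of_integrableOn_Ioi (fun T _ => hderiv T) hInt hprim
  rw [integral_Ioi_of_hasDerivAt_of_tendsto' (fun T _ => hderiv T) hInt hlim,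
    intervalIntegral.integral_same, zero_add, zero_sub]

/-- The antiderivative of `h` with value `e` at `0`. -/
def primitiveFrom (e : ℝ) (h : ℝ → ℝ) (t : ℝ) : ℝ := e + ∫ u in (0 : ℝ)..t, h u

lemma continuous_primitiveFrom (e : ℝ) {h : ℝ → ℝ} (hh : Continuous h) :
    Continuous (primitiveFrom e h) :=
  continuous_const.add
    (intervalIntegral.continuous_primitive (fun a b => hh.intervalIntegrable a b) 0)

section Volterra

variable {ι : Type*} [Fintype ι] {ρ h : ι → ℝ → ℝ} {e c : ι → ℝ} {f q : ℝ → ℝ}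

lemma integral_mul_primitiveFrom {ρ h : ℝ → ℝ} (e : ℝ) {T : ℝ} (hT : 0 ≤ T)
    (hρ : IntegrableOn ρ (Ioc 0 T)) (hh : Continuous h) :
    ∫ s in (0 : ℝ)..T, ρ s * primitiveFrom e h (T - s)
      = ∫ t in (0 : ℝ)..T, (e * ρ t + ∫ s in (0 : ℝ)..t, ρ (t - s) * h s) := by
  have hρi : IntervalIntegrable ρ volume 0 T :=
    (intervalIntegrable_iff_integrableOn_Ioc_of_le hT).mpr hρ
  have hprim : Continuous fun s => ∫ u in (0 : ℝ)..(T - s), h u :=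
    (intervalIntegral.continuous_primitive (fun a b => hh.intervalIntegrable a b) 0).comp
      (continuous_const.sub continuous_id)
  rw [intervalIntegral.integral_add (hρi.const_mul e) (intervalIntegrable_convolution hT hρ hh),
    integral_convolution_eq hT hρ hh,
    ← intervalIntegral.integral_add (hρi.const_mul e) (hρi.mul_continuousOn hprim.continuousOn)]
  simp only [primitiveFrom, mul_add, mul_comm e]

lemma sum_integral_mul_primitiveFrom {T : ℝ} (hT : 0 ≤ T) (hρ : ∀ j, IntegrableOn (ρ j) (Ioc 0 T))
    (hh : ∀ j, Continuous (h j))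
    (hrow : ∀ᵐ t ∂volume.restrict (Ioc 0 T),
      ∑ j, (e j * ρ j t + ∫ s in (0 : ℝ)..t, ρ j (t - s) * h j s) = f t) :
    ∑ j, ∫ s in (0 : ℝ)..T, ρ j s * primitiveFrom (e j) (h j) (T - s)
      = ∫ t in (0 : ℝ)..T, f t := by
  have hInt (j : ι) : IntervalIntegrable
      (fun t => e j * ρ j t + ∫ s in (0 : ℝ)..t, ρ j (t - s) * h j s) volume 0 T :=
    (((intervalIntegrable_iff_integrableOn_Ioc_of_le hT).mpr (hρ j)).const_mul (e j)).add
      (intervalIntegrable_convolution hT (hρ j) (hh j))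
  rw [Finset.sum_congr rfl fun j _ => integral_mul_primitiveFrom (e j) hT (hρ j) (hh j),
    ← intervalIntegral.integral_finsetSum fun j _ => hInt j,
    intervalIntegral.integral_of_le hT, intervalIntegral.integral_of_le hT]
  exact integral_congr_ae hrow

lemma integral_mul_comp_sub_eq_add {ρ Z : ℝ → ℝ} {c T : ℝ} (hT : 0 ≤ T)
    (hρ : IntegrableOn (fun t => ρ t - c) (Ioc 0 T)) (hZ : Continuous Z) :
    ∫ s in (0 : ℝ)..T, ρ s * Z (T - s)
      = (∫ s in (0 : ℝ)..T, (ρ s - c) * Z (T - s)) + ∫ s in (0 : ℝ)..T, c * Z s := by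
  have hZrev : Continuous fun s => Z (T - s) := hZ.comp (continuous_const.sub continuous_id)
  have hrev : ∫ s in (0 : ℝ)..T, c * Z (T - s) = ∫ s in (0 : ℝ)..T, c * Z s := by
    simpa only [sub_self, sub_zero] using
      intervalIntegral.integral_comp_sub_left (a := 0) (b := T) (fun s => c * Z s) T
  rw [← hrev, ← intervalIntegral.integral_add
    (((intervalIntegrable_iff_integrableOn_Ioc_of_le hT).mpr hρ).mul_continuousOn
      hZrev.continuousOn) ((hZrev.intervalIntegrable _ _).const_mul c)]
  simp only [sub_mul, sub_add_cancel]

-- The constant part `c` of the resolvent row integrates `primitiveFrom`, and its integrable part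
-- contributes an integrable convolution, so `∫₀ᵀ ∑ c · primitiveFrom + ℓ` is integrable in `T`;
-- since it converges as `T → ∞`, its limit is zero.
lemma integral_sum_mul_primitiveFrom {ℓ : ℝ} (hh : ∀ j, Continuous (h j))
    (hρ : ∀ j, IntegrableOn (fun t => ρ j t - c j) (Ioi 0))
    (hprim : ∀ j, IntegrableOn (primitiveFrom (e j) (h j)) (Ioi 0))
    (hrow : ∀ᵐ t ∂volume.restrict (Ioi (0 : ℝ)),
      ∑ j, (e j * ρ j t + ∫ s in (0 : ℝ)..t, ρ j (t - s) * h j s) = f t)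
    (hq : IntegrableOn q (Ioi 0)) (hf : ∀ T, 0 < T → ∫ t in (0 : ℝ)..T, f t = q T - ℓ) :
    ∫ t in Ioi (0 : ℝ), ∑ j, c j * primitiveFrom (e j) (h j) t = -ℓ := by
  have hZ (j : ι) := continuous_primitiveFrom (e j) (hh j)
  have hconv (j : ι) := integrable_posConvolution (μ := volume) (hρ j) (hprim j)
    (ContinuousLinearMap.mul ℝ ℝ)
  refine integral_Ioi_eq_neg_of_integrable_add
    (continuous_finsetSum _ fun j _ => continuous_const.mul (hZ j))
    (integrable_finsetSum _ fun j _ => (hprim j).const_mul (c j)) ?_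
  refine (hq.sub (integrable_finsetSum Finset.univ fun j _ => (hconv j).integrableOn)).congr_fun
    (fun T hT => ?_) measurableSet_Ioi
  have hT0 : (0 : ℝ) ≤ T := (mem_Ioi.mp hT).le
  have hρT (j : ι) : IntegrableOn (fun t => ρ j t - c j) (Ioc 0 T) :=
    (hρ j).mono_set Ioc_subset_Ioi_self
  have hρT' (j : ι) : IntegrableOn (ρ j) (Ioc 0 T) :=
    ((hρT j).add (integrableOn_const (C := c j) (by simp))).congr
      (ae_of_all _ fun t => sub_add_cancel (ρ j t) (c j))
  have hsum := sum_integral_mul_primitiveFrom hT0 hρT' hh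
    (ae_restrict_of_ae_restrict_of_subset Ioc_subset_Ioi_self hrow)
  rw [hf T hT, Finset.sum_congr rfl fun j _ => integral_mul_comp_sub_eq_add hT0 (hρT j) (hZ j),
    Finset.sum_add_distrib] at hsum
  rw [intervalIntegral.integral_finsetSum
    fun j _ => ((hZ j).intervalIntegrable _ _).const_mul (c j)]
  simp only [Pi.sub_apply, posConvolution, indicator_of_mem hT, ContinuousLinearMap.mul_apply']
  linear_combination -hsum

end Volterra

/-- The coordinates of a complex number, in the order of the rows of `kLc`. -/
def reIm (z : ℂ) : Fin 2 → ℝ := ![z.re, z.im]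

lemma continuous_reIm (j : Fin 2) : Continuous fun z => reIm z j := by
  fin_cases j
  exacts [Complex.continuous_re, Complex.continuous_im]

lemma integrable_reIm {α : Type*} [MeasurableSpace α] {μ : Measure α} {f : α → ℂ}
    (hf : Integrable f μ) (j : Fin 2) : Integrable (fun x => reIm (f x) j) μ := by
  fin_cases j
  exacts [hf.re, hf.im]

lemma primitiveFrom_reIm (z : ℂ) {r : ℝ} {f : ℝ → ℂ} (hf : Continuous f) (j : Fin 2) (t : ℝ) :
    primitiveFrom (reIm z j) (fun s => r * -reIm (f s) j) t
      = reIm (z - r * ∫ s in (0 : ℝ)..t, f s) j := by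
  have hInt : IntervalIntegrable f volume 0 t := hf.intervalIntegrable 0 t
  have hre := Complex.reCLM.intervalIntegral_comp_comm hInt
  have him := Complex.imCLM.intervalIntegral_comp_comm hInt
  simp only [Complex.reCLM_apply, Complex.imCLM_apply] at hre him
  rw [primitiveFrom, intervalIntegral.integral_const_mul, intervalIntegral.integral_neg]
  fin_cases j
  · simp [reIm, hre, sub_eq_add_neg]
  · simp [reIm, him, sub_eq_add_neg]

lemma kLc_one (wr wi : ℝ → ℕ → ℝ → ℂ) (t : ℝ) (j : Fin 2) :
    kLc wr wi t j 1 = -reIm (wi t 1 0) j := by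
  fin_cases j <;> rfl

lemma sum_KTheta_one_mul_reIm (cr ci : ℝ) (z : ℂ) :
    ∑ j, KTheta cr ci 1 j * reIm z j = cr * z.re + ci * z.im := by
  rw [Fin.sum_univ_two]
  rfl

lemma IsResolvent.add_sum_convolution {A R : ℝ → Matrix (Fin 2) (Fin 2) ℝ} (hR : IsResolvent A R)
    {i j : Fin 2} {h : Fin 2 → ℝ → ℝ} (hh : ∀ l, Continuous (h l))
    (hA : ∀ l s, 0 ≤ s → A s l j = h l s) : ∀ᵐ t ∂volume.restrict (Ioi (0 : ℝ)),
      R t i j + ∑ l, ∫ s in (0 : ℝ)..t, R (t - s) i l * h l s = h i t := by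
  filter_upwards [hR.2, ae_restrict_mem measurableSet_Ioi] with t ht ht0
  have hentry : R t i j + ∫ s in (0 : ℝ)..t, ∑ l, R (t - s) i l * A s l j = A t i j :=
    congrFun (congrFun ht.2 i) j
  have hInt (l : Fin 2) :
      IntervalIntegrable (fun s => R (t - s) i l * h l s) volume 0 t := by
    have hRt : IntervalIntegrable (fun s => R s i l) volume t 0 :=
      ((intervalIntegrable_iff_integrableOn_Icc_of_le ht0.le).mpr
        ((hR.1 i l).integrableOn_compact_subset Icc_subset_Ici_self isCompact_Icc)).symm
    have hrev := hRt.comp_sub_left t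
    rw [sub_self, sub_zero] at hrev
    exact hrev.mul_continuousOn (hh l).continuousOn
  rw [← intervalIntegral.integral_finsetSum fun l _ => hInt l, ← hA i t ht0.le, ← hentry]
  congr 1
  refine intervalIntegral.integral_congr fun s hs => ?_
  rw [uIcc_of_le ht0.le] at hs
  exact Finset.sum_congr rfl fun l _ => by rw [hA l s hs.1]

section alpha

variable {K r : ℝ} {g : ℝ → ℝ}

lemma IsStationaryState.reIm_evolution_rotMode {w wi : ℝ → ℕ → ℝ → ℂ}
    (hs : IsStationaryState K r g) (hw : IsEvolution (K * r) (rotMode (K * r) g) w)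
    (hwi : IsEvolution (K * r) (rI K r g) wi) (j : Fin 2) {t : ℝ} (ht : 0 ≤ t) :
    reIm (w t 1 0) j = primitiveFrom (reIm (Complex.I * r) j)
      (fun s => r * -reIm (extend wi 1 s 0) j) t := by
  rw [primitiveFrom_reIm _ (hwi.continuous_extend_left 1 0), hs.evolution_rotMode_one hw hwi ht]
  congr 3
  refine intervalIntegral.integral_congr fun s hs => ?_
  rw [uIcc_of_le ht] at hs
  exact (extend_succ wi 0 hs.1 le_rfl).symm

lemma IsResolvent.sum_row_rotMode {wr wi : ℝ → ℕ → ℝ → ℂ}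
    {R : ℝ → Matrix (Fin 2) (Fin 2) ℝ} (hR : IsResolvent (kLc wr wi) R) (r : ℝ)
    (hwi : Continuous fun s => extend wi 1 s 0) : ∀ᵐ t ∂volume.restrict (Ioi (0 : ℝ)),
      ∑ j, (reIm (Complex.I * r) j * R t 1 j
        + ∫ s in (0 : ℝ)..t, R (t - s) 1 j * (r * -reIm (extend wi 1 s 0) j))
        = r * -reIm (extend wi 1 t 0) 1 := by
  filter_upwards [hR.add_sum_convolution (i := 1) (j := 1)
    (h := fun l s => -reIm (extend wi 1 s 0) l)
    (fun l => ((continuous_reIm l).comp hwi).neg)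
    (fun l s hs => by rw [kLc_one, extend_succ wi 0 hs le_rfl])] with t ht
  simp only [mul_left_comm _ r, intervalIntegral.integral_const_mul]
  rw [Finset.sum_add_distrib, ← Finset.mul_sum, ← ht, Fin.sum_univ_two]
  simp [reIm, mul_add]

theorem IsAlpha.rotMode_eq_neg {cr ci a : ℝ}
    (ha : IsAlpha (K * r) cr ci (rotMode (K * r) g) a) (hs : IsStationaryState K r g)
    (hc : IsRotationCoeff K r g cr ci) : a = -r := by
  obtain ⟨wr, wi, -, hwi, R, hR, hInt⟩ := hc
  obtain ⟨w, hw, hwint, rfl⟩ := ha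
  have hext : Continuous fun s => extend wi 1 s 0 := hwi.continuous_extend_left 1 0
  have hforcing (j : Fin 2) : Continuous fun s => r * -reIm (extend wi 1 s 0) j :=
    ((continuous_reIm j).comp hext).neg.const_mul r
  have hcoord (j : Fin 2) {t : ℝ} (ht : t ∈ Ioi 0) :=
    hs.reIm_evolution_rotMode hw hwi j (mem_Ioi.mp ht).le
  have hprim (j : Fin 2) : IntegrableOn (primitiveFrom (reIm (Complex.I * r) j)
      fun s => r * -reIm (extend wi 1 s 0) j) (Ioi 0) :=
    IntegrableOn.congr_fun (integrable_reIm hwint j) (fun _ ht => hcoord j ht) measurableSet_Ioi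
  have hzero := integral_sum_mul_primitiveFrom (q := primitiveFrom (reIm (Complex.I * r) 1)
      fun s => r * -reIm (extend wi 1 s 0) 1) (ℓ := r) hforcing (hInt 1) hprim
    (hR.sum_row_rotMode r hext) (hprim 1) fun T _ => by simp [primitiveFrom, reIm]
  rw [← hzero]
  refine setIntegral_congr_fun measurableSet_Ioi fun t ht => ?_
  simp only [← hcoord _ ht, sum_KTheta_one_mul_reIm]

end alpha

/-! ### The four bounds -/

lemma exists_modeNorm_rR_rI_le {κ : ℝ} (hκ : 0 ≤ κ) {n : ℕ} {k : ℝ} (hk : 2 * k = n) {b : ℝ}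
    (hb : -(1 / 2) < b) :
    ∃ C : ℝ≥0∞, C ≠ ⊤ ∧ ∀ (K r : ℝ) (g : ℝ → ℝ), 0 ≤ K → K * r = κ → Integrable g →
      modeNorm (p b) k (rR K r g)
          ≤ ENNReal.ofReal K * (C * profileNorm (p (b + k + 2)) (gHat g)) ∧
        modeNorm (p b) k (rI K r g)
          ≤ ENNReal.ofReal K * (C * profileNorm (p (b + k + 2)) (gHat g)) := by
  obtain ⟨C, hC, hbound⟩ := exists_modeNorm_neighbours_fHat_le hκ hk hb
  refine ⟨C, hC, fun K r g hK hKr hg => ?_⟩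
  have hhalf {s : ℂ} (hs : ‖s‖ = 1) : ‖(K : ℂ) / 2 * s‖ₑ ≤ ENNReal.ofReal K := by
    rw [← ofReal_norm, norm_mul, hs, mul_one, norm_div, Complex.norm_real,
      Real.norm_of_nonneg hK, Complex.norm_two]
    exact ENNReal.ofReal_le_ofReal (half_le_self hK)
  have hrR : rR K r g = fun ℓ ξ =>
      (K : ℂ) / 2 * 1 * (ℓ * (fHat κ g (ℓ - 1) ξ + -1 * fHat κ g (ℓ + 1) ξ)) := by
    funext ℓ ξ
    simp only [rR, hKr]
    ring
  have hrI : rI K r g = fun ℓ ξ =>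
      (K : ℂ) / 2 * Complex.I * (ℓ * (fHat κ g (ℓ - 1) ξ + 1 * fHat κ g (ℓ + 1) ξ)) := by
    funext ℓ ξ
    simp only [rI, hKr]
    ring
  rw [hrR, hrI]
  exact ⟨(hbound g hg _ _ (by simp)).trans (mul_le_mul_left (hhalf norm_one) _),
    (hbound g hg _ _ norm_one).trans (mul_le_mul_left (hhalf Complex.norm_I) _)⟩

lemma modeNorm_rTheta_le (φ : ℝ → ℝ) (k κ : ℝ) (g : ℝ → ℝ) (a : ℝ) :
    modeNorm φ k (rTheta κ g a) ≤ ENNReal.ofReal |a|⁻¹ * modeNorm φ k (rotMode κ g) := by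
  have hrTheta : rTheta κ g a = fun ℓ ξ => (a : ℂ)⁻¹ * rotMode κ g ℓ ξ := by
    funext ℓ ξ
    rw [rTheta, div_eq_inv_mul]
  rw [hrTheta, ← Real.norm_eq_abs, ← Complex.norm_real, ← norm_inv, ofReal_norm]
  exact modeNorm_const_mul_le φ k _ _

lemma le_ofReal_mul_mul {x N D : ℝ≥0∞} {c C : ℝ} (hc : 0 ≤ c) (hD : D ≤ ENNReal.ofReal C)
    (hx : x ≤ ENNReal.ofReal c * (D * N)) : x ≤ ENNReal.ofReal (c * C) * N := by
  rw [ENNReal.ofReal_mul hc, mul_assoc]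
  exact hx.trans (by gcongr)

end Kuramoto

end

open Kuramoto in
theorem mainTheorem4_general (b : ℝ) (hb : -(1 / 2) < b) (n : ℕ) (k : ℝ) (hk : k = (n : ℝ) / 2)
    (κ : ℝ) (hκ : 0 ≤ κ) :
    ∃ C : ℝ, 0 < C ∧ ∀ (K r : ℝ) (g : ℝ → ℝ), 0 ≤ K → K * r = κ → Integrable g →
      modeNorm (p b) k (fHat (K * r) g)
          ≤ ENNReal.ofReal C * profileNorm (p (b + k + 1)) (gHat g) ∧
      modeNorm (p b) k (rR K r g)
          ≤ ENNReal.ofReal (K * C) * profileNorm (p (b + k + 2)) (gHat g) ∧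
      modeNorm (p b) k (rI K r g)
          ≤ ENNReal.ofReal (K * C) * profileNorm (p (b + k + 2)) (gHat g) ∧
      (IsStationaryState K r g → 0 < r → ∀ cr ci a : ℝ, IsRotationCoeff K r g cr ci →
        IsAlpha (K * r) cr ci (rotMode (K * r) g) a →
        a ≠ 0 ∧ modeNorm (p b) k (rTheta (K * r) g a)
          ≤ ENNReal.ofReal (C / r) * profileNorm (p (b + k + 2)) (gHat g)) := by
  have hkn : 2 * k = n := by linarith
  obtain ⟨C₁, hC₁, hf⟩ := exists_modeNorm_fHat_le hκ hkn hb
  obtain ⟨C₂, hC₂, hR⟩ := exists_modeNorm_rR_rI_le hκ hkn hb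
  obtain ⟨C₃, hC₃, hΘ⟩ := exists_modeNorm_rotMode_le hκ hkn hb
  have hfinite : C₁ + C₂ + C₃ < ⊤ := by finiteness
  obtain ⟨C, -, hC, -⟩ := ENNReal.lt_iff_exists_real_btwn.mp hfinite
  have hle₁ : C₁ ≤ ENNReal.ofReal C := (le_add_right le_self_add).trans hC.le
  have hle₂ : C₂ ≤ ENNReal.ofReal C := (le_add_right le_add_self).trans hC.le
  have hle₃ : C₃ ≤ ENNReal.ofReal C := le_add_self.trans hC.le
  refine ⟨C, ENNReal.ofReal_pos.mp (bot_le.trans_lt hC), fun K r g hK hKr hg => ⟨?_,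
    le_ofReal_mul_mul hK hle₂ (hR K r g hK hKr hg).1,
    le_ofReal_mul_mul hK hle₂ (hR K r g hK hKr hg).2, fun hs hr cr ci a hc ha => ?_⟩⟩
  · rw [hKr]
    exact (hf g hg).trans (by gcongr)
  · obtain rfl := ha.rotMode_eq_neg hs hc
    refine ⟨neg_ne_zero.mpr hr.ne', ?_⟩
    rw [div_eq_inv_mul]
    refine le_ofReal_mul_mul (inv_nonneg.mpr hr.le) hle₃ ((modeNorm_rTheta_le _ _ _ _ _).trans ?_)
    rw [abs_neg, abs_of_pos hr, hKr]
    gcongr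
    exact hΘ g hg

theorem mainTheorem4 (b : ℝ) (hb : 0 ≤ b) (n : ℕ) (k : ℝ) (hk : k = (n : ℝ) / 2)
    (κ : ℝ) (hκ : 0 ≤ κ) :
    ∃ C : ℝ, 0 < C ∧ ∀ (K r : ℝ) (g : ℝ → ℝ), K * r = κ → Kuramoto.IsStationaryState K r g →
      Kuramoto.modeNorm (Kuramoto.p b) k (Kuramoto.fHat (K * r) g)
          ≤ ENNReal.ofReal C
            * Kuramoto.profileNorm (Kuramoto.p (b + k + 1)) (Kuramoto.gHat g) ∧
      Kuramoto.modeNorm (Kuramoto.p b) k (Kuramoto.rR K r g)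
          ≤ ENNReal.ofReal (K * C)
            * Kuramoto.profileNorm (Kuramoto.p (b + k + 2)) (Kuramoto.gHat g) ∧
      Kuramoto.modeNorm (Kuramoto.p b) k (Kuramoto.rI K r g)
          ≤ ENNReal.ofReal (K * C)
            * Kuramoto.profileNorm (Kuramoto.p (b + k + 2)) (Kuramoto.gHat g) ∧
      (0 < r → ∀ cr ci a : ℝ, Kuramoto.IsRotationCoeff K r g cr ci →
        Kuramoto.IsAlpha (K * r) cr ci (Kuramoto.rotMode (K * r) g) a →
        a ≠ 0 ∧
        Kuramoto.modeNorm (Kuramoto.p b) k (Kuramoto.rTheta (K * r) g a)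
          ≤ ENNReal.ofReal (C / r)
            * Kuramoto.profileNorm (Kuramoto.p (b + k + 2)) (Kuramoto.gHat g)) := by
  obtain ⟨C, hC, hbound⟩ := mainTheorem4_general b (by linarith) n k hk κ hκ
  refine ⟨C, hC, fun K r g hKr hs => ?_⟩
  obtain ⟨hf, hr, hi, hΘ⟩ := hbound K r g hs.K_nonneg hKr hs.g_integrable
  exact ⟨hf, hr, hi, hΘ hs⟩
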